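/- **Setting.** Let $k$ be a field of characteristic $0$ and $\mathcal H$ a Hopf algebra over $k$ (coproduct $\Delta(h)=h^{(0)}\otimes h^{(1)}$, counit $\epsilon$) whose antipode $S$ is bijective. Let $A$ be a Yetter–Drinfeld $\mathcal H$-algebra: a unital $k$-algebra which is a left $\mathcal H$-module algebra and a right $\mathcal H^{op}$-comodule algebra (a counital coassociative coaction $\rho(a)=a_{<0>}\otimes a_{<1>}\in A\otimes\mathcal H$ with $\rho(1)=1\otimes1$ and $\rho(ab)=a_{<0>}b_{<0>}\otimes b_{<1>}a_{<1>}$), with $$(h^{(1)}\cdot a)_{<0>}\otimes (h^{(1)}\cdot a)_{<1>}h^{(0)}=h^{(0)}\cdot a_{<0>}\otimes h^{(1)}a_{<1>}.$$ *Cohomology.* Let $F(\mathcal H)=\mathrm{Hom}_k(\mathcal H,k)$. Let $C^n_{\mathcal H}(A)$ be the space of $(n+1)$-linear maps $f:A^{n+1}\to F(\mathcal H)$ with $f(h^{(0)}\cdot a_0,\dots,h^{(n)}\cdot a_n)(g)=f(a_0,\dots,a_n)(S(h^{(1)})gh^{(0)})$ for all $h,g,a_i$. It is a cocyclic module with the operators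 $$\begin{aligned} (T f)(a_0,\dots,a_n)(g)&=f(S^{-1}(g^{(0)})\cdot a_n,a_0,\dots,a_{n-1})(g^{(1)}),\\ (\partial^i f)(a_0,\dots,a_{n+1})&=f(a_0,\dots,a_ia_{i+1},\dots,a_{n+1})\quad(0\le i\le n),\qquad \partial^{n+1}=T\partial^0,\\ (\sigma^i f)(a_0,\dots,a_n)&=f(a_0,\dots,a_i,1,a_{i+1},\dots,a_n)\quad(0\le i\le n). \end{aligned}$$ Put $b=\sum_{i=0}^{n+1}(-1)^i\partial^i:C^n\to C^{n+1}$ and $B=N\sigma(1-(-1)^{n+1}T):C^{n+1}\to C^n$, where $(\sigma f)(a_0,\dots,a_n)=f(1,a_0,\dots,a_n)$ and $N=\sum_{i=0}^n(-1)^{in}T^i$. The group $HC^n_{\mathcal H}(A)$ is the $n$-th cohomology of the complex of cyclic equivariant cochains ($Tf=(-1)^nf$) with differential $b$. The group $HP^0_{\mathcal H}(A)$ is the even cohomology of the normalized $(b,B)$-complex: its cocycles are the finite families $f=(f_{2n})_{0\le n\le m}$ of equivariant cochains $f_{2n}\in C_{\mathcal H}^{2n}(A)$ killed by all $\sigma^i$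 with $(b+B)f=0$, taken modulo the elements $(b+B)\psi$ for finite odd families $\psi$ of normalized equivariant cochains. *K-theory.* For finite-dimensional left $\mathcal H$-modules $U,V,W$, $\mathcal H$ acts on $\mathrm{Hom}(V,W)$ by $h\cdot u=h^{(0)}uS(h^{(1)})$ and diagonally on $A\otimes\mathrm{Hom}(V,W)$, and there is an associative product $$A\otimes \mathrm{Hom}(V,W)\times A\otimes\mathrm{Hom}(U,V)\to A\otimes\mathrm{Hom}(U,W),\quad (a\otimes u)(c\otimes v)=a\,c_{<0>}\otimes(c_{<1>}\cdot u)v,$$ which makes $A\otimes\mathrm{End}(V)$ an algebra. Let $P_{\mathcal H}(A)$ be the set of $\mathcal H$-invariant idempotents ($e^2=e$, $h\cdot e=\epsilon(h)e$) of the algebras $A\otimes\mathrm{End}(V)$, for all $V$. Idempotents $e\in A\otimes\mathrm{End}(V)$ and $e'\in A\otimes\mathrm{End}(W)$ are Murray–von Neumann equivalent if there are $\mathcal H$-invariant $\gamma_1\in A\otimes\mathrm{Hom}(V,W)$ and $\gamma_2\in A\otimes\mathrm{Hom}(W,V)$ with $\gamma_2\gamma_1=e$ and $\gamma_1\gamma_2=e'$.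 The classes form a commutative monoid under direct sum, and $K_0^{\mathcal H}(A)$ is its Grothendieck group. *Generalized trace.* For $f\in C^n_{\mathcal H}(A)$ and a finite-dimensional $\mathcal H$-module $V$ let $\Psi^nf$ be the $(n+1)$-linear map from $A\otimes\mathrm{End}(V)$ to $F(\mathcal H)$ with $$\Psi^nf(a_0\otimes u_0,\dots,a_n\otimes u_n)(g)=f(a_{0<0>},\dots,a_{n<0>})(g^{(1)})\;\mathrm{tr}\big(S(a_{0<1>})u_0\,S(a_{1<1>})u_1\cdots S(a_{n<1>})u_n\,g^{(0)}\big),$$ elements of $\mathcal H$ acting on $V$. Let $R(\mathcal H)\subseteq F(\mathcal H)$ be the space of functionals $\varphi$ with $\varphi(S^2(h^{(0)})gS(h^{(1)}))=\epsilon(h)\varphi(g)$ for all $h,g\in\mathcal H$. **Theorem.** (1) For each $n\ge0$ there is a unique well-defined pairing, additive in the first and $k$-linear in the second variable, $$K_0^{\mathcal H}(A)\times HC^{2n}_{\mathcal H}(A)\to R(\mathcal H),\qquad \langle[e],(f)\rangle(g)=\Psi^{2n}f(e,e,\dots,e)(g),$$ for all $e\in P_{\mathcal H}(A)$, all cyclic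 equivariant cocycles $f\in C^{2n}_{\mathcal H}(A)$ and all $g\in\mathcal H$. (2) There is a unique well-defined pairing, additive in the first and $k$-linear in the second variable, $K_0^{\mathcal H}(A)\times HP^0_{\mathcal H}(A)\to R(\mathcal H)$ with $$\langle[e],(f)\rangle(g)=\Psi^0 f_0(e)(g)+\sum_{n=1}^m(-1)^n\frac{(2n)!}{n!}\,\Psi^{2n}f_{2n}\big(e-\tfrac12,e,\dots,e\big)(g)$$ for all $e\in P_{\mathcal H}(A)$, all normalized even periodic cocycles $f=(f_{2n})_{0\le n\le m}$ and all $g\in\mathcal H$. Here $\tfrac12$ stands for $\tfrac12(1\otimes\mathrm{id}_V)$ if $e\in A\otimes\mathrm{End}(V)$. -/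

import Mathlib

open scoped TensorProduct

universe u v w

namespace EquivariantCyclic

noncomputable section

/-! ### Sweedler calculus -/

section Sweedler

variable {k : Type u} [Field k] {H : Type v} [Ring H] [HopfAlgebra k H]
variable {E : Type*} [AddCommMonoid E] [Module k E]

/-- For a bilinear map `B`, the linear map `h ↦ B(h⁽⁰⁾, h⁽¹⁾)`. -/
def sweedler₂ : (H →ₗ[k] H →ₗ[k] E) →ₗ[k] (H →ₗ[k] E) where
  toFun B := TensorProduct.lift B ∘ₗ Coalgebra.comul
  map_add' B B' := by
    rw [← LinearMap.add_comp]; congr 1; ext; simp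
  map_smul' c B := by
    rw [RingHom.id_apply, ← LinearMap.smul_comp]; congr 1; ext; simp

/-- For an `m`-linear map `M`, the linear map `h ↦ M(h⁽⁰⁾, h⁽¹⁾, …, h⁽ᵐ⁻¹⁾)`, where
`h⁽⁰⁾ ⊗ ⋯ ⊗ h⁽ᵐ⁻¹⁾` is the iterated coproduct of `h` (for `m = 0` it is `h ↦ ε(h) M()`). -/
def sweedler : (m : ℕ) →
    MultilinearMap k (fun _ : Fin m => H) E →ₗ[k] (H →ₗ[k] E)
  | 0 =>
    { toFun := fun M => (Coalgebra.counit (R := k) (A := H)).smulRight (M Fin.elim0)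
      map_add' := fun M N => by
        ext h; simp only [LinearMap.smulRight_apply, LinearMap.add_apply, ← smul_add]; rfl
      map_smul' := fun c M => by
        ext h
        simp only [LinearMap.smulRight_apply, LinearMap.smul_apply, RingHom.id_apply]
        rw [smul_comm]; rfl }
  | m + 1 =>
    { toFun := fun M => sweedler₂ (sweedler m ∘ₗ M.curryLeft)
      map_add' := fun M N => by
        have : (M + N).curryLeft = M.curryLeft + N.curryLeft := by ext; simp
        rw [this, LinearMap.comp_add, map_add]
      map_smul' := fun c M => by
        have : (c • M).curryLeft = c • M.curryLeft := by ext; simp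
        rw [this, LinearMap.comp_smul, map_smul, RingHom.id_apply] }

variable (k H) in
/-- The antipode is bijective. -/
class BijectiveAntipode : Prop where
  bijective : Function.Bijective (HopfAlgebra.antipode k : H →ₗ[k] H)

variable (k H) in
/-- The inverse `S⁻¹` of a bijective antipode. -/
def antipodeInv [BijectiveAntipode k H] : H →ₗ[k] H :=
  ((LinearEquiv.ofBijective (HopfAlgebra.antipode k : H →ₗ[k] H)
    BijectiveAntipode.bijective).symm : H →ₗ[k] H)

variable (k) in
/-- The linear map `h ↦ S²(h⁽⁰⁾) g S(h⁽¹⁾)`, i.e. the action `h ↦ h · g` of `H` on itself. -/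
def twistedAdjoint (g : H) : H →ₗ[k] H :=
  sweedler₂ (LinearMap.mk₂ k
    (fun x y : H => HopfAlgebra.antipode k (HopfAlgebra.antipode k x) * g *
      HopfAlgebra.antipode k y)
    (by intros; simp [add_mul]) (by intros; simp) (by intros; simp [mul_add])
    (by intros; simp))

variable (k) in
/-- The linear map `h ↦ S(h⁽¹⁾) g h⁽⁰⁾`, which is `h ↦ S⁻¹(h) · g` for the action
`h · g = S²(h⁽⁰⁾) g S(h⁽¹⁾)`. -/
def twistedAdjointInv (g : H) : H →ₗ[k] H :=
  sweedler₂ (LinearMap.mk₂ k (fun x y : H => HopfAlgebra.antipode k y * g * x)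
    (by intros; simp [mul_add]) (by intros; simp) (by intros; simp [add_mul])
    (by intros; simp))

variable (k H) in
/-- The space `R(H)` of invariant functionals on `H`:
those `φ : H → k` with `φ(S²(h⁽⁰⁾) g S(h⁽¹⁾)) = ε(h) φ(g)` for all `h, g`. -/
def invariantFunctionals : Submodule k ((H →ₗ[k] k)) where
  carrier := {φ | ∀ h g : H, φ (twistedAdjoint k g h) = Coalgebra.counit (R := k) h * φ g}
  add_mem' := by
    intro a b ha hb h g
    exact (congrArg₂ (· + ·) (ha h g) (hb h g)).trans (mul_add _ _ _).symm
  zero_mem' := fun h g => by simp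
  smul_mem' := by
    intro c a ha h g
    exact (congrArg (c * ·) (ha h g)).trans (mul_left_comm _ _ _)

end Sweedler

/-! ### Module algebras and Yetter–Drinfeld algebras -/

section Algebras

variable (k : Type u) [Field k] (H : Type v) [Ring H] [HopfAlgebra k H]
variable (A : Type w) [Ring A] [Algebra k A]

/-- A left `H`-module algebra structure on the algebra `A`. -/
structure ModuleAlgebra where
  /-- the action of `H` on `A` -/
  act : H →ₐ[k] Module.End k A
  /-- `h · (a b) = (h⁽⁰⁾ · a) (h⁽¹⁾ · b)` -/
  act_mul : ∀ (h : H) (a b : A),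
    act h (a * b) = sweedler₂ ((LinearMap.mul k A).compl₁₂
      (act.toLinearMap.flip a) (act.toLinearMap.flip b)) h
  /-- `h · 1 = ε(h) 1` -/
  act_one : ∀ h : H, act h 1 = Coalgebra.counit (R := k) h • (1 : A)

/-- A Yetter–Drinfeld `H`-algebra structure on the algebra `A`: a left `H`-module algebra which is
also a right `Hᵒᵖ`-comodule algebra, the two structures satisfying the Yetter–Drinfeld condition. -/
structure YetterDrinfeldAlgebra extends ModuleAlgebra k H A where
  /-- the coaction `ρ(a) = a₍₀₎ ⊗ a₍₁₎` -/
  coact : A →ₗ[k] A ⊗[k] H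
  /-- coassociativity: `(ρ ⊗ id) ρ = (id ⊗ Δ) ρ` -/
  coact_coassoc : ∀ a : A,
    TensorProduct.assoc k A H H (coact.rTensor H (coact a)) =
      (Coalgebra.comul (R := k) (A := H)).lTensor A (coact a)
  /-- counitality: `(id ⊗ ε) ρ = id` -/
  coact_counit : ∀ a : A,
    (Coalgebra.counit (R := k) (A := H)).lTensor A (coact a) = a ⊗ₜ[k] (1 : k)
  /-- `ρ(1) = 1 ⊗ 1` -/
  coact_one : coact 1 = 1 ⊗ₜ[k] 1
  /-- `ρ(a b) = a₍₀₎ b₍₀₎ ⊗ b₍₁₎ a₍₁₎` -/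
  coact_mul : ∀ a b : A,
    coact (a * b) =
      TensorProduct.map₂ (LinearMap.mul k A) (LinearMap.mul k H).flip (coact a) (coact b)
  /-- `(h⁽¹⁾ · a)₍₀₎ ⊗ (h⁽¹⁾ · a)₍₁₎ h⁽⁰⁾ = h⁽⁰⁾ · a₍₀₎ ⊗ h⁽¹⁾ a₍₁₎` -/
  yetterDrinfeld : ∀ (h : H) (a : A),
    sweedler₂ (LinearMap.mk₂ k
      (fun x y : H => (LinearMap.mulRight k x).lTensor A (coact (act y a)))
      (by
        intro x x' y
        have : LinearMap.mulRight k (x + x') = LinearMap.mulRight k x + LinearMap.mulRight k x' := by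
          ext; simp [mul_add]
        simp [this, LinearMap.lTensor_add])
      (by
        intro c x y
        have : LinearMap.mulRight k (c • x) = c • LinearMap.mulRight k x := by
          ext; simp
        simp [this, LinearMap.lTensor_smul])
      (by intros; simp) (by intros; simp)) h =
    sweedler₂ (LinearMap.mk₂ k
      (fun x y : H => TensorProduct.map (act x) (LinearMap.mulLeft k y) (coact a))
      (by intros; simp [TensorProduct.map_add_left]) (by intros; simp [TensorProduct.map_smul_left])
      (by
        intro x y y'
        have : LinearMap.mulLeft k (y + y') = LinearMap.mulLeft k y + LinearMap.mulLeft k y' := by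
          ext; simp [add_mul]
        simp [this, TensorProduct.map_add_right])
      (by
        intro c x y
        have : LinearMap.mulLeft k (c • y) = c • LinearMap.mulLeft k y := by
          ext; simp
        simp [this, TensorProduct.map_smul_right])) h

end Algebras

/-! ### Equivariant cochains -/

section Cochains

variable (k : Type u) [Field k] (H : Type v) [Ring H] [HopfAlgebra k H]
variable (A : Type w) [Ring A] [Algebra k A]

/-- The space `Cⁿ(A, F(H))` of `(n+1)`-linear maps from `A` to the linear functionals on `H`. -/
abbrev Cochain (n : ℕ) : Type _ :=
  MultilinearMap k (fun _ : Fin (n + 1) => A) ((H →ₗ[k] k))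

variable {k H A}

instance Cochain.instAddCommGroup (n : ℕ) : AddCommGroup (Cochain k H A n) := inferInstance

/-- `f`, as a multilinear map of its last `n` arguments with values in the linear maps of its
first argument: `(headMap f)(a₁, …, aₙ) = (c ↦ f(c, a₁, …, aₙ))`. -/
def headMap {n : ℕ} (f : Cochain k H A n) :
    MultilinearMap k (fun _ : Fin n => A) (A →ₗ[k] (H →ₗ[k] k)) :=
  MultilinearMap.mk'
    (fun r =>
      { toFun := fun c => f (Fin.cons c r)
        map_add' := fun c c' => f.cons_add r c c'
        map_smul' := fun t c => f.cons_smul r t c })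
    (by intro r i x y; ext c : 1; simp [Fin.cons_update])
    (by intro r i x y; ext c : 1; simp [Fin.cons_update])

lemma headMap_add {n : ℕ} (f f' : Cochain k H A n) : headMap (f + f') = headMap f + headMap f' :=
  rfl

lemma headMap_smul {n : ℕ} (c : k) (f : Cochain k H A n) : headMap (c • f) = c • headMap f :=
  rfl

namespace ModuleAlgebra

variable (D : ModuleAlgebra k H A)

/-- For `a ∈ A`, the linear map `h ↦ h · a`. -/
def actOn (a : A) : H →ₗ[k] A := D.act.toLinearMap.flip a

/-- The space `C_H^n(A)` of equivariant cochains: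
`f(h⁽⁰⁾ · a₀, …, h⁽ⁿ⁾ · aₙ)(g) = f(a₀, …, aₙ)(S(h⁽¹⁾) g h⁽⁰⁾)`. -/
def equivariantCochains (n : ℕ) : Submodule k (Cochain k H A n) where
  carrier := {f | ∀ (h g : H) (a : Fin (n + 1) → A),
    sweedler (n + 1) (f.compLinearMap fun i => D.actOn (a i)) h g = f a (twistedAdjointInv k g h)}
  add_mem' := by
    intro f f' hf hf' h g a
    have e : (f + f').compLinearMap (fun i => D.actOn (a i)) =
        f.compLinearMap (fun i => D.actOn (a i)) + f'.compLinearMap (fun i => D.actOn (a i)) := by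
      ext; simp
    rw [e]
    rw [map_add]
    exact congrArg₂ (· + ·) (hf h g a) (hf' h g a)
  zero_mem' := by
    intro h g a
    have e : (0 : Cochain k H A n).compLinearMap (fun i => D.actOn (a i)) = 0 := by
      ext; simp
    rw [e]; simp
  smul_mem' := by
    intro c f hf h g a
    have e : (c • f).compLinearMap (fun i => D.actOn (a i)) =
        c • f.compLinearMap (fun i => D.actOn (a i)) := by
      ext; simp
    rw [e]
    rw [map_smul]
    exact congrArg (c * ·) (hf h g a)

section Cyclic

variable [BijectiveAntipode k H]

/-- The map sending `φ : A → F(H)` to `c ↦ (g ↦ φ(S⁻¹(g⁽⁰⁾) · c)(g⁽¹⁾))`. -/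
def antipodeTwist : (A →ₗ[k] (H →ₗ[k] k)) →ₗ[k] (A →ₗ[k] (H →ₗ[k] k)) where
  toFun φ :=
    { toFun := fun c => sweedler₂ (φ ∘ₗ D.actOn c ∘ₗ antipodeInv k H)
      map_add' := fun c c' => by
        simp only [actOn, map_add, LinearMap.add_comp, LinearMap.comp_add]
      map_smul' := fun r c => by
        simp only [actOn, map_smul, LinearMap.smul_comp, LinearMap.comp_smul, RingHom.id_apply] }
  map_add' φ ψ := by
    ext c : 1
    simp only [LinearMap.coe_mk, AddHom.coe_mk, LinearMap.add_comp, map_add]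
    rfl
  map_smul' r φ := by
    ext c : 1
    simp only [LinearMap.coe_mk, AddHom.coe_mk, LinearMap.smul_comp, RingHom.id_apply, map_smul]
    rfl

/-- The cyclic operator
`(T f)(a₀, …, aₙ)(g) = f(S⁻¹(g⁽⁰⁾) · aₙ, a₀, …, aₙ₋₁)(g⁽¹⁾)`. -/
def cyclicOp (n : ℕ) : Cochain k H A n →ₗ[k] Cochain k H A n where
  toFun f := (D.antipodeTwist.compMultilinearMap (headMap f)).uncurryRight
  map_add' f f' := by ext; simp [headMap_add]
  map_smul' c f := by ext; simp [headMap_smul]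

end Cyclic

end ModuleAlgebra

/-- Contracting two neighbours after changing one entry changes one entry, linearly. -/
lemma contractNth_update {n : ℕ} (j : Fin (n + 2)) (hj : (j : ℕ) < n + 1) (a : Fin (n + 2) → A)
    (l : Fin (n + 2)) : ∃ (t : Fin (n + 1)) (φ : A →ₗ[k] A), ∀ x : A,
      Fin.contractNth j (· * ·) (Function.update a l x) =
        Function.update (Fin.contractNth j (· * ·) a) t (φ x) := by
  rcases lt_trichotomy (l : ℕ) (j : ℕ) with h | h | h
  · refine ⟨⟨l, by omega⟩, LinearMap.id, fun x => ?_⟩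
    funext m
    simp only [Fin.contractNth, Function.update_apply, Fin.ext_iff, Fin.val_castSucc, Fin.val_succ,
      LinearMap.id_apply]
    split_ifs <;> first | rfl | omega
  · refine ⟨⟨l, by omega⟩, LinearMap.mulRight k (a (⟨l + 1, by omega⟩ : Fin (n + 2))),
      fun x => ?_⟩
    funext m
    simp only [Fin.contractNth, Function.update_apply, Fin.ext_iff, Fin.val_castSucc, Fin.val_succ,
      LinearMap.mulRight_apply]
    split_ifs with h1 h2 h3 h4 h5 <;>
      first
      | rfl
      | omega
      | (congr 2; ext; simp; omega)
  · by_cases h' : (l : ℕ) = j + 1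
    · refine ⟨⟨j, by omega⟩, LinearMap.mulLeft k (a j), fun x => ?_⟩
      funext m
      simp only [Fin.contractNth, Function.update_apply, Fin.ext_iff, Fin.val_castSucc,
        Fin.val_succ, LinearMap.mulLeft_apply]
      split_ifs with h1 h2 h3 h4 h5 <;>
        first
        | rfl
        | omega
        | (congr 2; ext; simp; omega)
    · refine ⟨⟨l - 1, by omega⟩, LinearMap.id, fun x => ?_⟩
      funext m
      simp only [Fin.contractNth, Function.update_apply, Fin.ext_iff, Fin.val_castSucc,
        Fin.val_succ, LinearMap.id_apply]
      split_ifs <;> first | rfl | omega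

variable (k H A) in
/-- The coface operators `(∂ⁱ f)(a₀, …, aₙ₊₁) = f(a₀, …, aᵢ aᵢ₊₁, …, aₙ₊₁)` for `0 ≤ i ≤ n`. -/
def coface (n : ℕ) (i : Fin (n + 1)) : Cochain k H A n →ₗ[k] Cochain k H A (n + 1) where
  toFun f := MultilinearMap.mk' (fun a => f (Fin.contractNth i.castSucc (· * ·) a))
    (by
      intro a l x y
      obtain ⟨t, φ, h⟩ := contractNth_update (k := k) i.castSucc i.isLt a l
      simp only [h, map_add, f.map_update_add])
    (by
      intro a l c x
      obtain ⟨t, φ, h⟩ := contractNth_update (k := k) i.castSucc i.isLt a l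
      simp only [h, map_smul, f.map_update_smul])
  map_add' f f' := by ext; simp
  map_smul' c f := by ext; simp

variable (k H A) in
/-- The codegeneracy operators `(σⁱ f)(a₀, …, aₙ) = f(a₀, …, aᵢ, 1, aᵢ₊₁, …, aₙ)`
for `0 ≤ i ≤ n`. -/
def codegeneracy (n : ℕ) (i : Fin (n + 1)) : Cochain k H A (n + 1) →ₗ[k] Cochain k H A n where
  toFun f := f.curryMid i.succ 1
  map_add' f f' := by ext; simp
  map_smul' c f := by ext; simp

variable (k H A) in
/-- The extra codegeneracy `f ↦ ((a₀, …, aₙ) ↦ f(1, a₀, …, aₙ))`. -/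
def extraCodegeneracy (n : ℕ) : Cochain k H A (n + 1) →ₗ[k] Cochain k H A n where
  toFun f := f.curryLeft 1
  map_add' f f' := by ext; simp
  map_smul' c f := by ext; simp

end Cochains

/-! ### Cyclic and periodic cyclic cohomology -/

namespace ModuleAlgebra

variable {k : Type u} [Field k] {H : Type v} [Ring H] [HopfAlgebra k H] [BijectiveAntipode k H]
variable {A : Type w} [Ring A] [Algebra k A] (D : ModuleAlgebra k H A)

/-- The last coface `∂ⁿ⁺¹ = T ∂⁰ : Cⁿ → Cⁿ⁺¹`, that is
`(∂ⁿ⁺¹ f)(a₀, …, aₙ₊₁)(g) = f((S⁻¹(g⁽⁰⁾) · aₙ₊₁) a₀, a₁, …, aₙ)(g⁽¹⁾)`. -/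
def lastCoface (n : ℕ) : Cochain k H A n →ₗ[k] Cochain k H A (n + 1) :=
  D.cyclicOp (n + 1) ∘ₗ coface k H A n 0

/-- The Hochschild coboundary `b = ∑ᵢ (-1)ⁱ ∂ⁱ : Cⁿ → Cⁿ⁺¹`, the sum being over `0 ≤ i ≤ n + 1`. -/
def hochschild (n : ℕ) : Cochain k H A n →ₗ[k] Cochain k H A (n + 1) :=
  (∑ i : Fin (n + 1), (-1 : k) ^ (i : ℕ) • coface k H A n i) + (-1 : k) ^ (n + 1) • D.lastCoface n

/-- The norm operator `N = ∑ᵢ (-1)^(in) Tⁱ`, the sum being over `0 ≤ i ≤ n`. -/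
def normOp (n : ℕ) : Module.End k (Cochain k H A n) :=
  ∑ i ∈ Finset.range (n + 1), (-1 : k) ^ (i * n) • D.cyclicOp n ^ i

/-- The operator `B = N σ (1 - (-1)ⁿ⁺¹ T) : Cⁿ⁺¹ → Cⁿ`, with `σ` the extra codegeneracy. -/
def connesB (n : ℕ) : Cochain k H A (n + 1) →ₗ[k] Cochain k H A n :=
  D.normOp n ∘ₗ extraCodegeneracy k H A n ∘ₗ
    ((LinearMap.id : Cochain k H A (n + 1) →ₗ[k] Cochain k H A (n + 1)) -
      (-1 : k) ^ (n + 1) • D.cyclicOp (n + 1))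

/-- Equivariant cochains that are cyclic: `T f = (-1)ⁿ f`. -/
def cyclicCochains (n : ℕ) : Submodule k (Cochain k H A n) :=
  D.equivariantCochains n ⊓ LinearMap.ker
    (D.cyclicOp n - (-1 : k) ^ n • (LinearMap.id : Cochain k H A n →ₗ[k] Cochain k H A n))

/-- Equivariant cyclic cocycles. -/
def cyclicCocycles (n : ℕ) : Submodule k (Cochain k H A n) :=
  D.cyclicCochains n ⊓ LinearMap.ker (D.hochschild n)

/-- Equivariant cyclic coboundaries: the images under `b` of the cyclic cochains. -/
def cyclicCoboundaries : (n : ℕ) → Submodule k (Cochain k H A n)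
  | 0 => ⊥
  | n + 1 => (D.cyclicCochains n).map (D.hochschild n)

/-- The equivariant cyclic cohomology `HC^n_H(A)`, cyclic cocycles modulo cyclic coboundaries. -/
abbrev HC (n : ℕ) : Type _ :=
  D.cyclicCocycles n ⧸ (D.cyclicCoboundaries n).submoduleOf (D.cyclicCocycles n)

/-- Normalized equivariant cochains: those killed by all codegeneracies. -/
def normalizedCochains : (n : ℕ) → Submodule k (Cochain k H A n)
  | 0 => D.equivariantCochains 0
  | n + 1 => D.equivariantCochains (n + 1) ⊓
      ⨅ i : Fin (n + 1), LinearMap.ker (codegeneracy k H A n i)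

/-- The total differential `b + B`: the component of `d f` in degree `n` is
`b f_{n-1} + B f_{n+1}` (where `f_{-1} = 0`). -/
def totalDifferential : ((n : ℕ) → Cochain k H A n) →ₗ[k] ((n : ℕ) → Cochain k H A n) :=
  LinearMap.pi fun n => match n with
    | 0 => D.connesB 0 ∘ₗ LinearMap.proj 1
    | n + 1 => D.hochschild n ∘ₗ LinearMap.proj n + D.connesB (n + 1) ∘ₗ LinearMap.proj (n + 2)

/-- The finite families of normalized equivariant cochains in the degrees congruent to `p`
modulo `2`. -/
def periodicCochains (p : ℕ) : Submodule k ((n : ℕ) → Cochain k H A n) where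
  carrier := {f | (∀ n, f n ∈ D.normalizedCochains n) ∧ (∀ n, n % 2 ≠ p % 2 → f n = 0) ∧
    ∃ m, ∀ n, m < n → f n = 0}
  add_mem' := by
    rintro f f' ⟨h1, h2, m, h3⟩ ⟨h1', h2', m', h3'⟩
    refine ⟨fun n => add_mem (h1 n) (h1' n), fun n hn => ?_, max m m', fun n hn => ?_⟩
    · rw [Pi.add_apply, h2 n hn, h2' n hn, add_zero]
    · rw [Pi.add_apply, h3 n (lt_of_le_of_lt (le_max_left _ _) hn),
        h3' n (lt_of_le_of_lt (le_max_right _ _) hn), add_zero]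
  zero_mem' := ⟨fun n => zero_mem _, fun _ _ => rfl, 0, fun _ _ => rfl⟩
  smul_mem' := by
    rintro c f ⟨h1, h2, m, h3⟩
    refine ⟨fun n => Submodule.smul_mem _ c (h1 n), fun n hn => ?_, m, fun n hn => ?_⟩
    · rw [Pi.smul_apply, h2 n hn, smul_zero]
    · rw [Pi.smul_apply, h3 n hn, smul_zero]

/-- Equivariant even periodic cyclic cocycles in the normalized `(b, B)`-bicomplex. -/
def evenPeriodicCocycles : Submodule k ((n : ℕ) → Cochain k H A n) :=
  D.periodicCochains 0 ⊓ LinearMap.ker D.totalDifferential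

/-- The even coboundaries `(b + B) f`, for `f` an odd periodic cochain. -/
def evenPeriodicCoboundaries : Submodule k ((n : ℕ) → Cochain k H A n) :=
  (D.periodicCochains 1).map D.totalDifferential

/-- The even equivariant periodic cyclic cohomology `HP^0_H(A)`. -/
abbrev HP0 : Type _ :=
  D.evenPeriodicCocycles ⧸ D.evenPeriodicCoboundaries.submoduleOf D.evenPeriodicCocycles

end ModuleAlgebra

/-! ### Finite-dimensional representations and twisted products -/

/-- A finite-dimensional left `H`-module, given by its structure map `H → End(V)`. -/
structure FinDimRep (k : Type u) [Field k] (H : Type v) [Ring H] [HopfAlgebra k H] where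
  /-- the underlying vector space -/
  V : Type u
  [addCommGroup : AddCommGroup V]
  [module : Module k V]
  [finite : Module.Finite k V]
  /-- the structure map -/
  act : H →ₐ[k] Module.End k V

attribute [instance] FinDimRep.addCommGroup FinDimRep.module FinDimRep.finite

namespace FinDimRep

variable {k : Type u} [Field k] {H : Type v} [Ring H] [HopfAlgebra k H]

/-- The direct sum of two representations. -/
def prod (V W : FinDimRep k H) : FinDimRep k H where
  V := V.V × W.V
  act := AlgHom.ofLinearMap
    (LinearMap.prodMapLinear k V.V W.V V.V W.V k ∘ₗ V.act.toLinearMap.prod W.act.toLinearMap)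
    (by ext <;> simp) (by intros; ext <;> simp)

/-- The zero representation. -/
def zero : FinDimRep k H where
  V := PUnit
  act := AlgHom.ofLinearMap 0 (Subsingleton.elim _ _) (fun _ _ => Subsingleton.elim _ _)

/-- The map `u ↦ p ∘ u ∘ q`, as a bilinear map of `p` and `q`. -/
def sandwich (V W : FinDimRep k H) : Module.End k W.V →ₗ[k] Module.End k V.V →ₗ[k]
    (V.V →ₗ[k] W.V) →ₗ[k] (V.V →ₗ[k] W.V) :=
  LinearMap.mk₂ k (fun p q =>
      { toFun := fun u => p ∘ₗ u ∘ₗ q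
        map_add' := by intros; simp [LinearMap.add_comp, LinearMap.comp_add]
        map_smul' := by intros; simp [LinearMap.smul_comp, LinearMap.comp_smul] })
    (by intros; ext; simp) (by intros; ext; simp) (by intros; ext; simp) (by intros; ext; simp)

/-- The conjugation action on `Hom(V, W)`: `h · u = h⁽⁰⁾ ∘ u ∘ S(h⁽¹⁾)`. -/
def homAct (V W : FinDimRep k H) : H →ₗ[k] (V.V →ₗ[k] W.V) →ₗ[k] (V.V →ₗ[k] W.V) :=
  sweedler₂ ((sandwich V W).compl₁₂ W.act.toLinearMap
    (V.act.toLinearMap ∘ₗ HopfAlgebra.antipode k))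

/-- For `v ∈ Hom(U, V)`, the bilinear map `(u, h) ↦ (h · u) ∘ v`, linearly in `v`. -/
def twistedComp (U V W : FinDimRep k H) :
    (U.V →ₗ[k] V.V) →ₗ[k] (V.V →ₗ[k] W.V) →ₗ[k] H →ₗ[k] (U.V →ₗ[k] W.V) where
  toFun v := (V.homAct W).flip.compr₂ (LinearMap.lcomp k W.V v)
  map_add' v v' := by ext; simp
  map_smul' c v := by ext; simp

lemma twistedComp_apply (U V W : FinDimRep k H) (u : V.V →ₗ[k] W.V) (v : U.V →ₗ[k] V.V) (h : H) :
    twistedComp U V W v u h = V.homAct W h u ∘ₗ v := rfl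

end FinDimRep

namespace ModuleAlgebra

variable {k : Type u} [Field k] {H : Type v} [Ring H] [HopfAlgebra k H]
variable {A : Type w} [Ring A] [Algebra k A] (D : ModuleAlgebra k H A)

/-- The diagonal action on `A ⊗ Hom(V, W)`: `h · (a ⊗ u) = h⁽⁰⁾ · a ⊗ h⁽¹⁾ · u`. -/
def diagAct (V W : FinDimRep k H) :
    H →ₗ[k] (A ⊗[k] (V.V →ₗ[k] W.V)) →ₗ[k] (A ⊗[k] (V.V →ₗ[k] W.V)) :=
  sweedler₂ ((TensorProduct.mapBilinear (RingHom.id k) A (V.V →ₗ[k] W.V) A (V.V →ₗ[k] W.V)).compl₁₂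
    D.act.toLinearMap (V.homAct W))

/-- `x ∈ A ⊗ Hom(V, W)` is `H`-invariant: `h · x = ε(h) x` for all `h`. -/
def IsInvariant {V W : FinDimRep k H} (x : A ⊗[k] (V.V →ₗ[k] W.V)) : Prop :=
  ∀ h : H, D.diagAct V W h x = Coalgebra.counit (R := k) h • x

end ModuleAlgebra

namespace YetterDrinfeldAlgebra

variable {k : Type u} [Field k] {H : Type v} [Ring H] [HopfAlgebra k H]
variable {A : Type w} [Ring A] [Algebra k A] (D : YetterDrinfeldAlgebra k H A)

/-- The twisted product `A ⊗ Hom(V, W) × A ⊗ Hom(U, V) → A ⊗ Hom(U, W)`,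
`(a ⊗ u)(c ⊗ v) = a c₍₀₎ ⊗ (c₍₁₎ · u) v`. For `U = V = W` it is the product of the algebra
`A ⊗ End(V)`. -/
def tmul (U V W : FinDimRep k H) : (A ⊗[k] (V.V →ₗ[k] W.V)) →ₗ[k] (A ⊗[k] (U.V →ₗ[k] V.V)) →ₗ[k]
    (A ⊗[k] (U.V →ₗ[k] W.V)) :=
  (TensorProduct.lift (LinearMap.mk₂ k
    (fun (c : A) (v : U.V →ₗ[k] V.V) =>
      (TensorProduct.map₂ (LinearMap.mul k A) (FinDimRep.twistedComp U V W v)).flip (D.coact c))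
    (by intros; simp) (by intros; simp)
    (by intro c v v'; ext x; induction D.coact c <;> simp_all [TensorProduct.tmul_add]; abel)
    (by intro r c v; ext x; induction D.coact c <;> simp_all))).flip

lemma tmul_tmul (U V W : FinDimRep k H) (x : A ⊗[k] (V.V →ₗ[k] W.V)) (c : A)
    (v : U.V →ₗ[k] V.V) : D.tmul U V W x (c ⊗ₜ v) =
      TensorProduct.map₂ (LinearMap.mul k A) (FinDimRep.twistedComp U V W v) x (D.coact c) := rfl

end YetterDrinfeldAlgebra

/-! ### Properties of the twisted product -/

section SweedlerLemmas

variable {k : Type u} [Field k] {H : Type v} [Ring H] [HopfAlgebra k H]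
variable {E : Type*} [AddCommMonoid E] [Module k E]

open Coalgebra

lemma sweedler₂_eq (B : H →ₗ[k] H →ₗ[k] E) (h : H) :
    sweedler₂ B h = ∑ i ∈ (ℛ k h).index, B ((ℛ k h).left i) ((ℛ k h).right i) := by
  change TensorProduct.lift B (comul h) = _
  rw [← (ℛ k h).eq, map_sum]
  simp

lemma sum_coassoc (T : H →ₗ[k] H →ₗ[k] H →ₗ[k] E) (h : H) :
    ∑ i ∈ (ℛ k h).index, ∑ j ∈ (ℛ k ((ℛ k h).left i)).index,
      T ((ℛ k ((ℛ k h).left i)).left j) ((ℛ k ((ℛ k h).left i)).right j) ((ℛ k h).right i) =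
    ∑ i ∈ (ℛ k h).index, ∑ j ∈ (ℛ k ((ℛ k h).right i)).index,
      T ((ℛ k h).left i) ((ℛ k ((ℛ k h).right i)).left j) ((ℛ k ((ℛ k h).right i)).right j) := by
  have := sum_tmul_tmul_eq (ℛ k h) (fun i => ℛ k ((ℛ k h).left i))
    (fun i => ℛ k ((ℛ k h).right i))
  have := congrArg (TensorProduct.lift (TensorProduct.uncurry (RingHom.id k) H H E ∘ₗ T)) this
  simpa [map_sum] using this

lemma sum_sweedler₂_mul {X Y : Type*} [AddCommMonoid X] [Module k X] [AddCommMonoid Y] [Module k Y]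
    (N : X →ₗ[k] Y →ₗ[k] E) (P : H →ₗ[k] H →ₗ[k] X) (Q : H →ₗ[k] H →ₗ[k] Y) (h : H) :
    ∑ i ∈ (ℛ k h).index, N (sweedler₂ P ((ℛ k h).left i)) (sweedler₂ Q ((ℛ k h).right i)) =
    ∑ i ∈ (ℛ k h).index, ∑ j ∈ (ℛ k ((ℛ k h).right i)).index,
      ∑ m ∈ (ℛ k ((ℛ k ((ℛ k h).right i)).left j)).index,
        N (P ((ℛ k h).left i) ((ℛ k ((ℛ k ((ℛ k h).right i)).left j)).left m))
          (Q ((ℛ k ((ℛ k ((ℛ k h).right i)).left j)).right m)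
            ((ℛ k ((ℛ k h).right i)).right j)) := by
  have h1 := sum_coassoc (LinearMap.mk₂ k (fun x y : H => N (P x y) ∘ₗ sweedler₂ Q)
    (by intros; ext; simp) (by intros; ext; simp) (by intros; ext; simp) (by intros; ext; simp)) h
  have h2 : ∀ x r : H, ∑ j ∈ (ℛ k r).index, N (P x ((ℛ k r).left j))
      (sweedler₂ Q ((ℛ k r).right j)) = ∑ j ∈ (ℛ k r).index,
        ∑ m ∈ (ℛ k ((ℛ k r).left j)).index, N (P x ((ℛ k ((ℛ k r).left j)).left m))
          (Q ((ℛ k ((ℛ k r).left j)).right m) ((ℛ k r).right j)) := by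
    intro x r
    have h3 := sum_coassoc (LinearMap.mk₂ k (fun y z : H => N (P x y) ∘ₗ Q z)
      (by intros; ext; simp) (by intros; ext; simp) (by intros; ext; simp)
      (by intros; ext; simp)) r
    simp only [LinearMap.mk₂_apply, LinearMap.comp_apply] at h3
    rw [h3]
    refine Finset.sum_congr rfl fun j _ => ?_
    rw [sweedler₂_eq, map_sum]
  simp only [LinearMap.mk₂_apply, LinearMap.comp_apply, h2] at h1
  rw [← h1]
  refine Finset.sum_congr rfl fun i _ => ?_
  rw [sweedler₂_eq P, map_sum, LinearMap.sum_apply]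

end SweedlerLemmas

namespace FinDimRep

variable {k : Type u} [Field k] {H : Type v} [Ring H] [HopfAlgebra k H]

open Coalgebra

lemma map₂_tmul_tmul {M N P Q X Y : Type*} [AddCommMonoid M] [AddCommMonoid N] [AddCommMonoid P]
    [AddCommMonoid Q] [AddCommMonoid X] [AddCommMonoid Y] [Module k M] [Module k N] [Module k P]
    [Module k Q] [Module k X] [Module k Y] (f : M →ₗ[k] P →ₗ[k] X) (g : N →ₗ[k] Q →ₗ[k] Y)
    (m : M) (n : N) (p : P) (q : Q) :
    TensorProduct.map₂ f g (m ⊗ₜ n) (p ⊗ₜ q) = f m p ⊗ₜ g n q := rfl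

lemma sum_comp {ι : Type*} {U V W : FinDimRep k H} (s : Finset ι) (f : ι → (V.V →ₗ[k] W.V))
    (w : U.V →ₗ[k] V.V) : (∑ i ∈ s, f i) ∘ₗ w = ∑ i ∈ s, f i ∘ₗ w := by
  ext; simp

lemma homAct_eq (V W : FinDimRep k H) (h : H) (u : V.V →ₗ[k] W.V) :
    V.homAct W h u = ∑ i ∈ (ℛ k h).index,
      W.act ((ℛ k h).left i) ∘ₗ u ∘ₗ V.act (HopfAlgebra.antipode k ((ℛ k h).right i)) := by
  rw [homAct, sweedler₂_eq, LinearMap.sum_apply]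
  rfl

/-- The map `x ⊗ y ↦ x ∘ u ∘ S(y)`. -/
def conj (V W : FinDimRep k H) (u : V.V →ₗ[k] W.V) : H →ₗ[k] H →ₗ[k] (V.V →ₗ[k] W.V) :=
  ((sandwich V W).compl₁₂ W.act.toLinearMap
    (V.act.toLinearMap ∘ₗ HopfAlgebra.antipode k)).compr₂ (LinearMap.applyₗ u)

lemma conj_apply (V W : FinDimRep k H) (u : V.V →ₗ[k] W.V) (x y : H) :
    conj V W u x y = W.act x ∘ₗ u ∘ₗ V.act (HopfAlgebra.antipode k y) := rfl

lemma homAct_eq' (V W : FinDimRep k H) (h : H) (u : V.V →ₗ[k] W.V) :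
    V.homAct W h u = sweedler₂ (conj V W u) h := by
  rw [homAct_eq, sweedler₂_eq]; rfl

/-- Composition of linear maps as a bilinear map. -/
def compBil (U V W : FinDimRep k H) :
    (V.V →ₗ[k] W.V) →ₗ[k] (U.V →ₗ[k] V.V) →ₗ[k] (U.V →ₗ[k] W.V) :=
  LinearMap.llcomp k U.V V.V W.V

lemma compBil_apply (U V W : FinDimRep k H) (u : V.V →ₗ[k] W.V) (v : U.V →ₗ[k] V.V) :
    compBil U V W u v = u ∘ₗ v := rfl

lemma homAct_comp (U V W : FinDimRep k H) (h : H) (u : V.V →ₗ[k] W.V) (v : U.V →ₗ[k] V.V) :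
    U.homAct W h (u ∘ₗ v) =
      sweedler₂ ((compBil U V W).compl₁₂ ((V.homAct W).flip u) ((U.homAct V).flip v)) h := by
  rw [sweedler₂_eq, homAct_eq]
  have := sum_sweedler₂_mul (compBil U V W) (conj V W u) (conj U V v) h
  simp only [LinearMap.compl₁₂_apply, LinearMap.flip_apply, homAct_eq']
  rw [this]
  refine Finset.sum_congr rfl fun i _ => ?_
  set r := (ℛ k h).right i
  set l := (ℛ k h).left i
  have e1 : ∀ s : H, ∑ m ∈ (ℛ k s).index,
      V.act (HopfAlgebra.antipode k ((ℛ k s).left m)) ∘ₗ V.act ((ℛ k s).right m) =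
      counit (R := k) s • LinearMap.id := by
    intro s
    have := congrArg V.act (HopfAlgebra.sum_antipode_mul_eq_smul (ℛ k s))
    simpa [map_sum, Module.End.mul_eq_comp, Module.End.one_eq_id] using this
  have e2 : ∑ j ∈ (ℛ k r).index, counit (R := k) ((ℛ k r).left j) •
      HopfAlgebra.antipode k ((ℛ k r).right j) = HopfAlgebra.antipode k r := by
    have := congrArg (HopfAlgebra.antipode k) (sum_counit_smul (ℛ k r))
    simpa [map_sum] using this
  have e3 : ∀ s t : H, ∑ m ∈ (ℛ k s).index, compBil U V W (conj V W u l ((ℛ k s).left m))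
      (conj U V v ((ℛ k s).right m) t) =
      counit (R := k) s • (W.act l ∘ₗ (u ∘ₗ v) ∘ₗ U.act (HopfAlgebra.antipode k t)) := by
    intro s t
    have := congrArg (fun q => W.act l ∘ₗ u ∘ₗ q ∘ₗ v ∘ₗ U.act (HopfAlgebra.antipode k t)) (e1 s)
    ext x
    have := congrArg (fun q => q x) this
    simpa [compBil_apply, conj_apply, LinearMap.sum_apply, map_sum] using this
  simp only [e3]
  conv_lhs => rw [← e2]
  ext x
  simp [map_sum, LinearMap.sum_apply]

lemma homAct_mul (V W : FinDimRep k H) (x y : H) (u : V.V →ₗ[k] W.V) :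
    V.homAct W (x * y) u = V.homAct W x (V.homAct W y u) := by
  rw [homAct_eq', homAct_eq', homAct_eq']
  change TensorProduct.lift _ (comul (x * y)) = _
  rw [Bialgebra.comul_mul, ← (ℛ k x).eq, ← (ℛ k y).eq, sweedler₂_eq, sweedler₂_eq]
  simp only [Finset.sum_mul_sum, Algebra.TensorProduct.tmul_mul_tmul, map_sum,
    TensorProduct.lift.tmul, conj_apply]
  refine Finset.sum_congr rfl fun i _ => ?_
  ext z
  simp [LinearMap.sum_apply, map_sum, HopfAlgebra.antipode_mul_antidistrib, Module.End.mul_apply]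

end FinDimRep

namespace YetterDrinfeldAlgebra

variable {k : Type u} [Field k] {H : Type v} [Ring H] [HopfAlgebra k H]
variable {A : Type w} [Ring A] [Algebra k A] (D : YetterDrinfeldAlgebra k H A)

open Coalgebra

/-- The map `t ↦ (β ↦ x · (β ⊗ (t · v) w))` used to compare the two triple products. -/
def assocAux (T U V W : FinDimRep k H) (x : A ⊗[k] (V.V →ₗ[k] W.V)) (v : U.V →ₗ[k] V.V)
    (w : T.V →ₗ[k] U.V) : A ⊗[k] H →ₗ[k] H →ₗ[k] (A ⊗[k] (T.V →ₗ[k] W.V)) :=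
  LinearMap.mk₂ k (fun β t => TensorProduct.map₂ (LinearMap.mul k A)
      (FinDimRep.twistedComp T V W (U.homAct V t v ∘ₗ w)) x β)
    (by intros; simp) (by intros; simp)
    (by
      intro β t t'
      rw [map_add, LinearMap.add_apply, LinearMap.add_comp, map_add]
      simp [TensorProduct.map₂, TensorProduct.map_add_right, LinearMap.comp_add])
    (by
      intro r β t
      rw [map_smul, LinearMap.smul_apply, LinearMap.smul_comp, map_smul]
      simp [TensorProduct.map₂, TensorProduct.map_smul_right, LinearMap.comp_smul])

lemma assocAux_left (T U V W : FinDimRep k H) (a : A) (u : V.V →ₗ[k] W.V) (v : U.V →ₗ[k] V.V)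
    (w : T.V →ₗ[k] U.V) (ζ δ : A ⊗[k] H) :
    TensorProduct.map₂ (LinearMap.mul k A) (FinDimRep.twistedComp T U W w)
      (TensorProduct.map₂ (LinearMap.mul k A) (FinDimRep.twistedComp U V W v) (a ⊗ₜ u) ζ) δ =
    TensorProduct.uncurry (RingHom.id k) _ _ _ (assocAux T U V W (a ⊗ₜ[k] u) v w ∘ₗ
      TensorProduct.map₂ (LinearMap.mul k A) (LinearMap.mul k H).flip ζ)
        ((TensorProduct.assoc k A H H).symm (comul.lTensor A δ)) := by
  induction ζ with
  | zero => simp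
  | add x x' hx hx' => simp only [map_add, LinearMap.add_apply, LinearMap.comp_add, hx, hx']
  | tmul c s =>
  induction δ with
  | zero => simp
  | add x x' hx hx' => simp only [map_add, hx, hx']
  | tmul d t =>
    rw [FinDimRep.map₂_tmul_tmul, FinDimRep.map₂_tmul_tmul,
      FinDimRep.twistedComp_apply, FinDimRep.twistedComp_apply, FinDimRep.homAct_comp,
      sweedler₂_eq, LinearMap.lTensor_tmul, ← (ℛ k t).eq, TensorProduct.tmul_sum, map_sum, map_sum,
      FinDimRep.sum_comp, TensorProduct.tmul_sum]
    refine Finset.sum_congr rfl fun i _ => ?_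
    simp only [TensorProduct.assoc_symm_tmul, TensorProduct.uncurry_apply, LinearMap.comp_apply,
      assocAux, LinearMap.mk₂_apply, FinDimRep.map₂_tmul_tmul, FinDimRep.twistedComp_apply,
      LinearMap.compl₁₂_apply, FinDimRep.compBil_apply, LinearMap.flip_apply,
      LinearMap.mul_apply', FinDimRep.homAct_mul, mul_assoc]
    rfl

lemma assocAux_right (T U V W : FinDimRep k H) (a c : A) (u : V.V →ₗ[k] W.V) (v : U.V →ₗ[k] V.V)
    (w : T.V →ₗ[k] U.V) (δ : A ⊗[k] H) :
    D.tmul T V W (a ⊗ₜ u)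
      (TensorProduct.map₂ (LinearMap.mul k A) (FinDimRep.twistedComp T U V w) (c ⊗ₜ v) δ) =
    TensorProduct.uncurry (RingHom.id k) _ _ _ (assocAux T U V W (a ⊗ₜ[k] u) v w ∘ₗ
      TensorProduct.map₂ (LinearMap.mul k A) (LinearMap.mul k H).flip (D.coact c))
        (D.coact.rTensor H δ) := by
  induction δ with
  | zero => simp
  | add x x' hx hx' => simp only [map_add, hx, hx']
  | tmul d t =>
    rw [FinDimRep.map₂_tmul_tmul, tmul_tmul, LinearMap.mul_apply', D.coact_mul]
    rfl

/-- The twisted products are associative. -/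
lemma tmul_assoc (T U V W : FinDimRep k H) (x : A ⊗[k] (V.V →ₗ[k] W.V))
    (y : A ⊗[k] (U.V →ₗ[k] V.V)) (z : A ⊗[k] (T.V →ₗ[k] U.V)) :
    D.tmul T U W (D.tmul U V W x y) z = D.tmul T V W x (D.tmul T U V y z) := by
  induction x with
  | zero => simp
  | add x x' hx hx' => simp only [map_add, LinearMap.add_apply, hx, hx']
  | tmul a u =>
  induction y with
  | zero => simp
  | add x x' hx hx' => simp only [map_add, LinearMap.add_apply, hx, hx']
  | tmul c v =>
  induction z with
  | zero => simp
  | add x x' hx hx' => simp only [map_add, hx, hx']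
  | tmul d w =>
    rw [tmul_tmul, tmul_tmul, tmul_tmul, assocAux_left, assocAux_right, ← D.coact_coassoc,
      LinearEquiv.symm_apply_apply]

lemma tmul_homAct (U V W : FinDimRep k H) (p c : A) (x : H) (u : V.V →ₗ[k] W.V)
    (q : U.V →ₗ[k] V.V) :
    D.tmul U V W (p ⊗ₜ V.homAct W x u) (c ⊗ₜ q) =
      TensorProduct.map₂ (LinearMap.mul k A) (FinDimRep.twistedComp U V W q) (p ⊗ₜ u)
        ((LinearMap.mulRight k x).lTensor A (D.coact c)) := by
  rw [tmul_tmul]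
  induction D.coact c with
  | zero => simp
  | add x x' hx hx' => simp only [map_add, hx, hx']
  | tmul d t => simp [FinDimRep.twistedComp_apply, FinDimRep.homAct_mul]

/-- The map `x ⊗ y ↦ x · a ⊗ y · u`. -/
def pairAct (V W : FinDimRep k H) (a : A) (u : V.V →ₗ[k] W.V) :
    H →ₗ[k] H →ₗ[k] A ⊗[k] (V.V →ₗ[k] W.V) :=
  (TensorProduct.mk k A (V.V →ₗ[k] W.V)).compl₁₂ (D.actOn a) ((V.homAct W).flip u)

lemma pairAct_apply (V W : FinDimRep k H) (a : A) (u : V.V →ₗ[k] W.V) (x y : H) :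
    D.pairAct V W a u x y = D.act x a ⊗ₜ V.homAct W y u := rfl

lemma diagAct_tmul (V W : FinDimRep k H) (h : H) (a : A) (u : V.V →ₗ[k] W.V) :
    D.diagAct V W h (a ⊗ₜ u) = sweedler₂ (D.pairAct V W a u) h := by
  rw [ModuleAlgebra.diagAct, sweedler₂_eq, sweedler₂_eq, LinearMap.sum_apply]
  rfl

lemma sum_yetterDrinfeld (h : H) (a : A) :
    ∑ i ∈ (ℛ k h).index, (LinearMap.mulRight k ((ℛ k h).left i)).lTensor A
      (D.coact (D.act ((ℛ k h).right i) a)) =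
    ∑ i ∈ (ℛ k h).index, TensorProduct.map (D.act ((ℛ k h).left i))
      (LinearMap.mulLeft k ((ℛ k h).right i)) (D.coact a) := by
  have := D.yetterDrinfeld h a
  rwa [sweedler₂_eq, sweedler₂_eq] at this

lemma sum_act_mul (h : H) (a b : A) :
    D.act h (a * b) = sweedler₂ ((LinearMap.mul k A).compl₁₂ (D.actOn a) (D.actOn b)) h :=
  D.act_mul h a b

lemma diagAct_aux (U V W : FinDimRep k H) (h : H) (a : A) (u : V.V →ₗ[k] W.V)
    (v : U.V →ₗ[k] V.V) (ζ : A ⊗[k] H) :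
    D.diagAct U W h (TensorProduct.map₂ (LinearMap.mul k A) (FinDimRep.twistedComp U V W v)
      (a ⊗ₜ u) ζ) =
    ∑ i ∈ (ℛ k h).index, ∑ j ∈ (ℛ k ((ℛ k h).right i)).index,
      ∑ m ∈ (ℛ k ((ℛ k ((ℛ k h).right i)).left j)).index,
        TensorProduct.map₂ (LinearMap.mul k A)
          (FinDimRep.twistedComp U V W (U.homAct V ((ℛ k ((ℛ k h).right i)).right j) v))
          (D.act ((ℛ k h).left i) a ⊗ₜ u)
          (TensorProduct.map (D.act ((ℛ k ((ℛ k ((ℛ k h).right i)).left j)).left m))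
            (LinearMap.mulLeft k ((ℛ k ((ℛ k ((ℛ k h).right i)).left j)).right m)) ζ) := by
  induction ζ with
  | zero => simp
  | add x x' hx hx' => simp only [map_add, hx, hx', Finset.sum_add_distrib]
  | tmul c t =>
    rw [FinDimRep.map₂_tmul_tmul, diagAct_tmul, sweedler₂_eq]
    have := sum_sweedler₂_mul (TensorProduct.mk k A (U.V →ₗ[k] W.V))
      ((LinearMap.mul k A).compl₁₂ (D.actOn a) (D.actOn c))
      ((FinDimRep.compBil U V W).compl₁₂ ((V.homAct W).flip (V.homAct W t u))
        ((U.homAct V).flip v)) h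
    simp only [← FinDimRep.homAct_comp, ← D.sum_act_mul] at this
    refine this.trans ?_
    refine Finset.sum_congr rfl fun i _ => Finset.sum_congr rfl fun j _ =>
      Finset.sum_congr rfl fun m _ => ?_
    rw [TensorProduct.map_tmul, FinDimRep.map₂_tmul_tmul, FinDimRep.twistedComp_apply,
      LinearMap.mulLeft_apply, FinDimRep.homAct_mul]
    rfl

/-- The twisted product is compatible with the diagonal actions. -/
lemma diagAct_mul (U V W : FinDimRep k H) (h : H) (x : A ⊗[k] (V.V →ₗ[k] W.V))
    (y : A ⊗[k] (U.V →ₗ[k] V.V)) :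
    D.diagAct U W h (D.tmul U V W x y) =
      sweedler₂ ((D.tmul U V W).compl₁₂ ((D.diagAct V W).flip x) ((D.diagAct U V).flip y)) h := by
  rw [sweedler₂_eq]
  simp only [LinearMap.compl₁₂_apply, LinearMap.flip_apply]
  induction x with
  | zero => simp
  | add x x' hx hx' => simp only [map_add, LinearMap.add_apply, hx, hx', Finset.sum_add_distrib]
  | tmul a u =>
  induction y with
  | zero => simp
  | add x x' hx hx' => simp only [map_add, hx, hx', Finset.sum_add_distrib]
  | tmul c v =>
    simp only [diagAct_tmul]
    rw [sum_sweedler₂_mul, tmul_tmul, diagAct_aux]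
    refine Finset.sum_congr rfl fun i _ => Finset.sum_congr rfl fun j _ => ?_
    simp only [pairAct_apply, tmul_homAct]
    rw [← map_sum, ← map_sum, sum_yetterDrinfeld]

/-- Products of invariant elements are invariant. -/
lemma isInvariant_tmul {U V W : FinDimRep k H} {x : A ⊗[k] (V.V →ₗ[k] W.V)}
    {y : A ⊗[k] (U.V →ₗ[k] V.V)} (hx : D.IsInvariant x) (hy : D.IsInvariant y) :
    D.IsInvariant (D.tmul U V W x y) := by
  intro h
  rw [diagAct_mul, sweedler₂_eq]
  simp only [LinearMap.compl₁₂_apply, LinearMap.flip_apply]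
  have h1 : ∀ s, D.diagAct V W s x = counit (R := k) s • x := hx
  have h2 : ∀ s, D.diagAct U V s y = counit (R := k) s • y := hy
  simp only [h1, h2, map_smul, LinearMap.smul_apply]
  simp only [smul_smul, ← Finset.sum_smul]
  congr 1
  have := congrArg (counit (R := k)) (sum_counit_smul (ℛ k h))
  simpa [map_sum, mul_comm] using this

end YetterDrinfeldAlgebra

/-! ### Functoriality in the representation -/

namespace FinDimRep

variable {k : Type u} [Field k] {H : Type v} [Ring H] [HopfAlgebra k H]

/-- `φ` is `H`-linear. -/
def IsIntertwiner (V W : FinDimRep k H) (φ : V.V →ₗ[k] W.V) : Prop :=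
  ∀ h : H, φ ∘ₗ V.act h = W.act h ∘ₗ φ

/-- The first inclusion. -/
def inl (V W : FinDimRep k H) : V.V →ₗ[k] (V.prod W).V := LinearMap.inl k V.V W.V

/-- The second inclusion. -/
def inr (V W : FinDimRep k H) : W.V →ₗ[k] (V.prod W).V := LinearMap.inr k V.V W.V

/-- The first projection. -/
def fst (V W : FinDimRep k H) : (V.prod W).V →ₗ[k] V.V := LinearMap.fst k V.V W.V

/-- The second projection. -/
def snd (V W : FinDimRep k H) : (V.prod W).V →ₗ[k] W.V := LinearMap.snd k V.V W.V

lemma fst_inl (V W : FinDimRep k H) : fst V W ∘ₗ inl V W = LinearMap.id := rfl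

lemma snd_inr (V W : FinDimRep k H) : snd V W ∘ₗ inr V W = LinearMap.id := rfl

lemma fst_inr (V W : FinDimRep k H) : fst V W ∘ₗ inr V W = 0 := rfl

lemma snd_inl (V W : FinDimRep k H) : snd V W ∘ₗ inl V W = 0 := rfl

lemma inl_fst_add (V W : FinDimRep k H) :
    inl V W ∘ₗ fst V W + inr V W ∘ₗ snd V W = LinearMap.id := by
  apply LinearMap.ext
  rintro ⟨x, y⟩
  exact Prod.ext (add_zero x) (zero_add y)

lemma fst_inl' {U : FinDimRep k H} (V W : FinDimRep k H) (f : U.V →ₗ[k] V.V) :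
    fst V W ∘ₗ inl V W ∘ₗ f = f := rfl

lemma snd_inr' {U : FinDimRep k H} (V W : FinDimRep k H) (f : U.V →ₗ[k] W.V) :
    snd V W ∘ₗ inr V W ∘ₗ f = f := rfl

lemma fst_inr' {U : FinDimRep k H} (V W : FinDimRep k H) (f : U.V →ₗ[k] W.V) :
    fst V W ∘ₗ inr V W ∘ₗ f = 0 := rfl

lemma snd_inl' {U : FinDimRep k H} (V W : FinDimRep k H) (f : U.V →ₗ[k] V.V) :
    snd V W ∘ₗ inl V W ∘ₗ f = 0 := rfl

lemma isIntertwiner_inl (V W : FinDimRep k H) : IsIntertwiner V (V.prod W) (inl V W) := by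
  intro h
  apply LinearMap.ext
  intro x
  exact Prod.ext rfl (map_zero (W.act h)).symm

lemma isIntertwiner_inr (V W : FinDimRep k H) : IsIntertwiner W (V.prod W) (inr V W) := by
  intro h
  apply LinearMap.ext
  intro x
  exact Prod.ext (map_zero (V.act h)).symm rfl

lemma isIntertwiner_fst (V W : FinDimRep k H) : IsIntertwiner (V.prod W) V (fst V W) :=
  fun _ => rfl

lemma isIntertwiner_snd (V W : FinDimRep k H) : IsIntertwiner (V.prod W) W (snd V W) :=
  fun _ => rfl

lemma IsIntertwiner.comp {U V W : FinDimRep k H} {φ : V.V →ₗ[k] W.V} {ψ : U.V →ₗ[k] V.V}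
    (hφ : IsIntertwiner V W φ) (hψ : IsIntertwiner U V ψ) : IsIntertwiner U W (φ ∘ₗ ψ) := by
  intro h
  rw [LinearMap.comp_assoc, hψ h, ← LinearMap.comp_assoc, hφ h, LinearMap.comp_assoc]

lemma IsIntertwiner.add {V W : FinDimRep k H} {φ ψ : V.V →ₗ[k] W.V}
    (hφ : IsIntertwiner V W φ) (hψ : IsIntertwiner V W ψ) : IsIntertwiner V W (φ + ψ) := by
  intro h
  rw [LinearMap.add_comp, LinearMap.comp_add, hφ h, hψ h]

lemma homAct_sandwich {V W V' W' : FinDimRep k H} {φ : W.V →ₗ[k] W'.V} {ψ : V'.V →ₗ[k] V.V}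
    (hφ : IsIntertwiner W W' φ) (hψ : IsIntertwiner V' V ψ) (h : H) (u : V.V →ₗ[k] W.V) :
    V'.homAct W' h (φ ∘ₗ u ∘ₗ ψ) = φ ∘ₗ V.homAct W h u ∘ₗ ψ := by
  rw [homAct_eq, homAct_eq]
  ext x
  simp only [LinearMap.comp_apply, LinearMap.sum_apply, map_sum]
  refine Finset.sum_congr rfl fun i _ => ?_
  have h1 := LinearMap.congr_fun (hψ (HopfAlgebra.antipode k ((Coalgebra.Repr.arbitrary k h).right i))) x
  have h2 := fun y => LinearMap.congr_fun (hφ ((Coalgebra.Repr.arbitrary k h).left i)) y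
  simp only [LinearMap.comp_apply] at h1 h2
  rw [h1, h2]

lemma swap_comp (V W : FinDimRep k H) :
    (inr V W ∘ₗ fst W V + inl V W ∘ₗ snd W V) ∘ₗ (inr W V ∘ₗ fst V W + inl W V ∘ₗ snd V W) =
      LinearMap.id := by
  simp only [LinearMap.add_comp, LinearMap.comp_add, LinearMap.comp_assoc, fst_inl', snd_inr',
    fst_inr', snd_inl', LinearMap.comp_zero, add_zero, zero_add]
  exact inl_fst_add V W

/-- The isomorphism `(P ⊕ Q) ⊕ R ≃ P ⊕ (Q ⊕ R)`. -/
def assocMap (P Q R : FinDimRep k H) : ((P.prod Q).prod R).V →ₗ[k] (P.prod (Q.prod R)).V :=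
  P.inl (Q.prod R) ∘ₗ P.fst Q ∘ₗ (P.prod Q).fst R +
    (P.inr (Q.prod R) ∘ₗ Q.inl R ∘ₗ P.snd Q ∘ₗ (P.prod Q).fst R +
      P.inr (Q.prod R) ∘ₗ Q.inr R ∘ₗ (P.prod Q).snd R)

/-- The inverse of `assocMap`. -/
def assocInv (P Q R : FinDimRep k H) : (P.prod (Q.prod R)).V →ₗ[k] ((P.prod Q).prod R).V :=
  (P.prod Q).inl R ∘ₗ P.inl Q ∘ₗ P.fst (Q.prod R) +
    ((P.prod Q).inl R ∘ₗ P.inr Q ∘ₗ Q.fst R ∘ₗ P.snd (Q.prod R) +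
      (P.prod Q).inr R ∘ₗ Q.snd R ∘ₗ P.snd (Q.prod R))

lemma assocInv_comp (P Q R : FinDimRep k H) : assocInv P Q R ∘ₗ assocMap P Q R = LinearMap.id := by
  rw [assocInv, assocMap]
  simp only [LinearMap.add_comp, LinearMap.comp_add, LinearMap.comp_assoc, fst_inl', snd_inr',
    fst_inr', snd_inl', LinearMap.comp_zero, add_zero, zero_add]
  rw [← inl_fst_add (P.prod Q) R, ← add_assoc]
  congr 1
  conv_rhs => rw [← LinearMap.id_comp (fst (P.prod Q) R), ← inl_fst_add P Q]
  simp only [LinearMap.add_comp, LinearMap.comp_add, LinearMap.comp_assoc]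

end FinDimRep

/-- The map `A ⊗ Hom(V, W) → A ⊗ Hom(V', W')`, `a ⊗ u ↦ a ⊗ φ u ψ`. -/
def transport {k : Type u} [Field k] {H : Type v} [Ring H] [HopfAlgebra k H]
    (A : Type w) [Ring A] [Algebra k A] {V W V' W' : FinDimRep k H}
    (φ : W.V →ₗ[k] W'.V) (ψ : V'.V →ₗ[k] V.V) :
    (A ⊗[k] (V.V →ₗ[k] W.V)) →ₗ[k] (A ⊗[k] (V'.V →ₗ[k] W'.V)) :=
  LinearMap.lTensor A (LinearMap.lcomp k W'.V ψ ∘ₗ LinearMap.llcomp k V.V W.V W'.V φ)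

lemma transport_tmul {k : Type u} [Field k] {H : Type v} [Ring H] [HopfAlgebra k H]
    (A : Type w) [Ring A] [Algebra k A] {V W V' W' : FinDimRep k H}
    (φ : W.V →ₗ[k] W'.V) (ψ : V'.V →ₗ[k] V.V) (a : A) (u : V.V →ₗ[k] W.V) :
    transport A φ ψ (a ⊗ₜ u) = a ⊗ₜ (φ ∘ₗ u ∘ₗ ψ) := rfl

lemma transport_transport {k : Type u} [Field k] {H : Type v} [Ring H] [HopfAlgebra k H]
    (A : Type w) [Ring A] [Algebra k A] {V W V' W' V'' W'' : FinDimRep k H}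
    (φ : W.V →ₗ[k] W'.V) (ψ : V'.V →ₗ[k] V.V) (φ' : W'.V →ₗ[k] W''.V) (ψ' : V''.V →ₗ[k] V'.V)
    (x : A ⊗[k] (V.V →ₗ[k] W.V)) :
    transport A φ' ψ' (transport A φ ψ x) = transport A (φ' ∘ₗ φ) (ψ ∘ₗ ψ') x := by
  induction x with
  | zero => simp
  | add x x' hx hx' => simp only [map_add, hx, hx']
  | tmul a u => simp only [transport_tmul, LinearMap.comp_assoc]

/-- The block-diagonal sum `x ⊕ y ∈ A ⊗ Hom(V ⊕ V', W ⊕ W')` of `x ∈ A ⊗ Hom(V, W)` and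
`y ∈ A ⊗ Hom(V', W')`. -/
def blockDiag {k : Type u} [Field k] {H : Type v} [Ring H] [HopfAlgebra k H]
    {A : Type w} [Ring A] [Algebra k A] {V W V' W' : FinDimRep k H}
    (x : A ⊗[k] (V.V →ₗ[k] W.V)) (y : A ⊗[k] (V'.V →ₗ[k] W'.V)) :
    A ⊗[k] ((V.prod V').V →ₗ[k] (W.prod W').V) :=
  transport A (W.inl W') (V.fst V') x + transport A (W.inr W') (V.snd V') y

lemma blockDiag_assoc {k : Type u} [Field k] {H : Type v} [Ring H] [HopfAlgebra k H]
    {A : Type w} [Ring A] [Algebra k A] {P Q R : FinDimRep k H}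
    (x : A ⊗[k] (P.V →ₗ[k] P.V)) (y : A ⊗[k] (Q.V →ₗ[k] Q.V)) (z : A ⊗[k] (R.V →ₗ[k] R.V)) :
    blockDiag (V := P) (W := P) x (blockDiag (V := Q) (W := Q) (V' := R) (W' := R) y z) =
      transport A (P.assocMap Q R) (P.assocInv Q R)
        (blockDiag (V' := R) (W' := R)
          (blockDiag (V := P) (W := P) (V' := Q) (W' := Q) x y) z) := by
  rw [FinDimRep.assocInv, FinDimRep.assocMap]
  simp only [blockDiag, map_add, transport_transport]
  simp only [LinearMap.add_comp, LinearMap.comp_add, LinearMap.comp_assoc, FinDimRep.fst_inl,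
    FinDimRep.snd_inr, FinDimRep.fst_inr, FinDimRep.snd_inl, FinDimRep.fst_inl',
    FinDimRep.snd_inr', FinDimRep.fst_inr', FinDimRep.snd_inl', LinearMap.comp_id,
    LinearMap.comp_zero, add_zero, zero_add, add_assoc]


namespace YetterDrinfeldAlgebra

variable {k : Type u} [Field k] {H : Type v} [Ring H] [HopfAlgebra k H]
variable {A : Type w} [Ring A] [Algebra k A] (D : YetterDrinfeldAlgebra k H A)

open FinDimRep

lemma isInvariant_transport {V W V' W' : FinDimRep k H} {φ : W.V →ₗ[k] W'.V} {ψ : V'.V →ₗ[k] V.V}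
    (hφ : IsIntertwiner W W' φ) (hψ : IsIntertwiner V' V ψ) {x : A ⊗[k] (V.V →ₗ[k] W.V)}
    (hx : D.IsInvariant x) : D.IsInvariant (V := V') (W := W') (transport A φ ψ x) := by
  intro h
  have key : ∀ y : A ⊗[k] (V.V →ₗ[k] W.V), D.diagAct V' W' h (transport A φ ψ y) =
      transport A φ ψ (D.diagAct V W h y) := by
    intro y
    induction y with
    | zero => simp
    | add x x' hx hx' => simp only [map_add, hx, hx']
    | tmul a u =>
      rw [transport_tmul, diagAct_tmul, diagAct_tmul, sweedler₂_eq, sweedler₂_eq, map_sum]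
      refine Finset.sum_congr rfl fun i _ => ?_
      rw [pairAct_apply, pairAct_apply, transport_tmul, homAct_sandwich hφ hψ]
  rw [key, hx h, map_smul]

lemma isInvariant_add {V W : FinDimRep k H} {x y : A ⊗[k] (V.V →ₗ[k] W.V)}
    (hx : D.IsInvariant x) (hy : D.IsInvariant y) : D.IsInvariant (x + y) := by
  intro h
  rw [map_add, hx h, hy h, smul_add]

lemma isInvariant_blockDiag {V W V' W' : FinDimRep k H} {x : A ⊗[k] (V.V →ₗ[k] W.V)}
    {y : A ⊗[k] (V'.V →ₗ[k] W'.V)} (hx : D.IsInvariant x) (hy : D.IsInvariant y) :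
    D.IsInvariant (V := V.prod V') (W := W.prod W') (blockDiag x y) :=
  D.isInvariant_add
    (D.isInvariant_transport (isIntertwiner_inl W W') (isIntertwiner_fst V V') hx)
    (D.isInvariant_transport (isIntertwiner_inr W W') (isIntertwiner_snd V V') hy)

/-- Moving maps of representations through a twisted product. -/
lemma tmul_transport {U V V' W U' W' : FinDimRep k H} {φ : W.V →ₗ[k] W'.V} {ψ : U'.V →ₗ[k] U.V}
    {α : V'.V →ₗ[k] V.V} {β : V.V →ₗ[k] V'.V}
    (hφ : IsIntertwiner W W' φ) (hα : IsIntertwiner V' V α)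
    (x : A ⊗[k] (V.V →ₗ[k] W.V)) (y : A ⊗[k] (U.V →ₗ[k] V.V)) :
    D.tmul U' V' W' (transport A φ α x) (transport A β ψ y) =
      transport A φ ψ (D.tmul U V W x (transport A (α ∘ₗ β) LinearMap.id y)) := by
  induction y with
  | zero => simp
  | add x x' hx hx' => simp only [map_add, hx, hx']
  | tmul c v =>
  induction x with
  | zero => simp
  | add x x' hx hx' => simp only [map_add, LinearMap.add_apply, hx, hx']
  | tmul a u =>
    rw [transport_tmul, transport_tmul, transport_tmul, tmul_tmul, tmul_tmul]
    induction D.coact c with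
    | zero => simp
    | add x x' hx hx' => simp only [map_add, hx, hx']
    | tmul d t =>
      rw [map₂_tmul_tmul, map₂_tmul_tmul, transport_tmul, twistedComp_apply, twistedComp_apply,
        homAct_sandwich hφ hα]
      simp only [LinearMap.comp_assoc, LinearMap.comp_id]

lemma tmul_transport_id {U V V' W U' W' : FinDimRep k H} {φ : W.V →ₗ[k] W'.V}
    {ψ : U'.V →ₗ[k] U.V} {α : V'.V →ₗ[k] V.V} {β : V.V →ₗ[k] V'.V}
    (hφ : IsIntertwiner W W' φ) (hα : IsIntertwiner V' V α) (hβα : α ∘ₗ β = LinearMap.id)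
    (x : A ⊗[k] (V.V →ₗ[k] W.V)) (y : A ⊗[k] (U.V →ₗ[k] V.V)) :
    D.tmul U' V' W' (transport A φ α x) (transport A β ψ y) =
      transport A φ ψ (D.tmul U V W x y) := by
  rw [D.tmul_transport hφ hα, hβα]
  congr 2
  induction y with
  | zero => simp
  | add x x' hx hx' => simp only [map_add, hx, hx']
  | tmul c v => rfl

lemma tmul_transport_zero {U V₁ V₂ V' W U' W' : FinDimRep k H} {φ : W.V →ₗ[k] W'.V}
    {ψ : U'.V →ₗ[k] U.V} {α : V'.V →ₗ[k] V₁.V} {β : V₂.V →ₗ[k] V'.V}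
    (hφ : IsIntertwiner W W' φ) (hα : IsIntertwiner V' V₁ α) (hβα : α ∘ₗ β = 0)
    (x : A ⊗[k] (V₁.V →ₗ[k] W.V)) (y : A ⊗[k] (U.V →ₗ[k] V₂.V)) :
    D.tmul U' V' W' (transport A φ α x) (transport A β ψ y) = 0 := by
  induction y with
  | zero => simp
  | add x x' hx hx' => simp only [map_add, hx, hx', add_zero]
  | tmul c v =>
  induction x with
  | zero => simp
  | add x x' hx hx' => simp only [map_add, LinearMap.add_apply, hx, hx', add_zero]
  | tmul a u =>
    rw [transport_tmul, transport_tmul, tmul_tmul]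
    induction D.coact c with
    | zero => simp
    | add x x' hx hx' => simp only [map_add, hx, hx', add_zero]
    | tmul d t =>
      rw [map₂_tmul_tmul, twistedComp_apply, homAct_sandwich hφ hα]
      have : (φ ∘ₗ V₁.homAct W t u ∘ₗ α) ∘ₗ β ∘ₗ v ∘ₗ ψ =
          φ ∘ₗ V₁.homAct W t u ∘ₗ (α ∘ₗ β) ∘ₗ v ∘ₗ ψ := by
        simp only [LinearMap.comp_assoc]
      rw [this, hβα]
      simp

lemma tmul_blockDiag {U V W U' V' W' : FinDimRep k H}
    (x : A ⊗[k] (V.V →ₗ[k] W.V)) (y : A ⊗[k] (U.V →ₗ[k] V.V))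
    (x' : A ⊗[k] (V'.V →ₗ[k] W'.V)) (y' : A ⊗[k] (U'.V →ₗ[k] V'.V)) :
    D.tmul (U.prod U') (V.prod V') (W.prod W') (blockDiag x x') (blockDiag y y') =
      blockDiag (D.tmul U V W x y) (D.tmul U' V' W' x' y') := by
  rw [blockDiag, blockDiag, blockDiag, map_add, map_add, LinearMap.add_apply, LinearMap.add_apply,
    D.tmul_transport_id (isIntertwiner_inl W W') (isIntertwiner_fst V V') (fst_inl V V'),
    D.tmul_transport_id (isIntertwiner_inr W W') (isIntertwiner_snd V V') (snd_inr V V'),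
    D.tmul_transport_zero (isIntertwiner_inl W W') (isIntertwiner_fst V V') (fst_inr V V'),
    D.tmul_transport_zero (isIntertwiner_inr W W') (isIntertwiner_snd V V') (snd_inl V V'),
    add_zero, zero_add]

/-! ### Equivariant K-theory -/

/-- The set `P_H(A)` of `H`-invariant idempotents in the algebras `A ⊗ End(V)`, where `V` runs over
the finite-dimensional representations of `H`. -/
structure InvIdem where
  /-- the representation -/
  rep : FinDimRep k H
  /-- the idempotent -/
  val : A ⊗[k] (rep.V →ₗ[k] rep.V)
  idem_inv : D.tmul rep rep rep val val = val ∧ D.IsInvariant (V := rep) (W := rep) val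

namespace InvIdem

variable {D}

lemma idem (e : D.InvIdem) : D.tmul e.rep e.rep e.rep e.val e.val = e.val := e.idem_inv.1

lemma inv (e : D.InvIdem) : D.IsInvariant (V := e.rep) (W := e.rep) e.val := e.idem_inv.2

/-- Murray–von Neumann equivalence. -/
def MvN (e e' : D.InvIdem) : Prop :=
  ∃ (γ₁ : A ⊗[k] (e.rep.V →ₗ[k] e'.rep.V)) (γ₂ : A ⊗[k] (e'.rep.V →ₗ[k] e.rep.V)),
    D.IsInvariant γ₁ ∧ D.IsInvariant γ₂ ∧
    D.tmul e.rep e'.rep e.rep γ₂ γ₁ = e.val ∧ D.tmul e'.rep e.rep e'.rep γ₁ γ₂ = e'.val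

lemma MvN.refl (e : D.InvIdem) : MvN e e := ⟨e.val, e.val, e.inv, e.inv, e.idem, e.idem⟩

lemma MvN.symm {e e' : D.InvIdem} : MvN e e' → MvN e' e
  | ⟨γ₁, γ₂, h₁, h₂, h, h'⟩ => ⟨γ₂, γ₁, h₂, h₁, h', h⟩

lemma MvN.trans {e e' e'' : D.InvIdem} : MvN e e' → MvN e' e'' → MvN e e'' := by
  rintro ⟨γ₁, γ₂, h₁, h₂, h, h'⟩ ⟨δ₁, δ₂, g₁, g₂, g, g'⟩
  refine ⟨D.tmul _ _ _ δ₁ γ₁, D.tmul _ _ _ γ₂ δ₂, D.isInvariant_tmul g₁ h₁,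
    D.isInvariant_tmul h₂ g₂, ?_, ?_⟩
  · rw [tmul_assoc, ← D.tmul_assoc _ _ _ _ δ₂, g, ← h', D.tmul_assoc _ _ _ _ γ₁,
      ← D.tmul_assoc _ _ _ _ γ₂, h]
    exact e.idem
  · rw [tmul_assoc, ← D.tmul_assoc _ _ _ _ γ₁, h', ← g, D.tmul_assoc _ _ _ _ δ₂,
      ← D.tmul_assoc _ _ _ _ δ₁, g']
    exact e''.idem

/-- Conjugating by maps of representations gives an equivalent idempotent. -/
lemma MvN.of_transport {e e' : D.InvIdem} {φ : e.rep.V →ₗ[k] e'.rep.V}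
    {ψ : e'.rep.V →ₗ[k] e.rep.V} (hφ : IsIntertwiner e.rep e'.rep φ)
    (hψ : IsIntertwiner e'.rep e.rep ψ) (hψφ : ψ ∘ₗ φ = LinearMap.id)
    (h : e'.val = transport A (V := e.rep) (W := e.rep) (V' := e'.rep) (W' := e'.rep)
      φ ψ e.val) : MvN e e' := by
  have hid : IsIntertwiner e.rep e.rep LinearMap.id := fun _ => rfl
  have tid : ∀ x : A ⊗[k] (e.rep.V →ₗ[k] e.rep.V), transport A (V := e.rep) (W := e.rep)
      (V' := e.rep) (W' := e.rep) LinearMap.id LinearMap.id x = x := by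
    intro x
    induction x with
    | zero => simp
    | add x x' hx hx' => rw [map_add, hx, hx']
    | tmul c v => rfl
  refine ⟨transport A (V := e.rep) (W := e.rep) φ LinearMap.id e.val,
    transport A (V := e.rep) (W := e.rep) LinearMap.id ψ e.val,
    D.isInvariant_transport hφ hid e.inv, D.isInvariant_transport hid hψ e.inv, ?_, ?_⟩
  · rw [D.tmul_transport_id hid hψ hψφ, tid]; exact e.idem
  · rw [D.tmul_transport_id hφ hid (LinearMap.id_comp _), h]
    exact congrArg _ e.idem

/-- Murray–von Neumann equivalence as an equivalence relation. -/
instance setoid (D : YetterDrinfeldAlgebra k H A) : Setoid D.InvIdem :=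
  ⟨MvN, MvN.refl, MvN.symm, MvN.trans⟩

/-- The direct sum of invariant idempotents. -/
def add (e e' : D.InvIdem) : D.InvIdem where
  rep := e.rep.prod e'.rep
  val := blockDiag e.val e'.val
  idem_inv := by
    refine ⟨?_, D.isInvariant_blockDiag e.inv e'.inv⟩
    refine (D.tmul_blockDiag (U := e.rep) (V := e.rep) (W := e.rep) (U' := e'.rep) (V' := e'.rep)
      (W' := e'.rep) e.val e.val e'.val e'.val).trans ?_
    rw [e.idem, e'.idem]

/-- The zero idempotent on the zero representation. -/
def zero : D.InvIdem where
  rep := FinDimRep.zero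
  val := 0
  idem_inv := ⟨map_zero _, fun h => by rw [map_zero, smul_zero]⟩

lemma MvN.add {e e' f f' : D.InvIdem} : MvN e e' → MvN f f' → MvN (e.add f) (e'.add f') := by
  rintro ⟨γ₁, γ₂, h₁, h₂, h, h'⟩ ⟨δ₁, δ₂, g₁, g₂, g, g'⟩
  refine ⟨blockDiag γ₁ δ₁, blockDiag γ₂ δ₂, D.isInvariant_blockDiag h₁ g₁,
    D.isInvariant_blockDiag h₂ g₂, ?_, ?_⟩
  · refine (D.tmul_blockDiag _ _ _ _).trans ?_
    rw [h, g]; rfl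
  · refine (D.tmul_blockDiag _ _ _ _).trans ?_
    rw [h', g']; rfl

lemma add_comm_equiv (e e' : D.InvIdem) : MvN (e.add e') (e'.add e) := by
  refine MvN.of_transport (e := e.add e') (e' := e'.add e)
    (((isIntertwiner_inr e'.rep e.rep).comp (isIntertwiner_fst e.rep e'.rep)).add
      ((isIntertwiner_inl e'.rep e.rep).comp (isIntertwiner_snd e.rep e'.rep)))
    (((isIntertwiner_inr e.rep e'.rep).comp (isIntertwiner_fst e'.rep e.rep)).add
      ((isIntertwiner_inl e.rep e'.rep).comp (isIntertwiner_snd e'.rep e.rep))) ?_ ?_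
  · exact swap_comp e.rep e'.rep
  · change blockDiag e'.val e.val = transport A _ _ (blockDiag e.val e'.val)
    rw [blockDiag, blockDiag, map_add, transport_transport, transport_transport, add_comm]
    simp only [LinearMap.add_comp, LinearMap.comp_add, LinearMap.comp_assoc, fst_inl, snd_inr,
      fst_inr, snd_inl, fst_inl', snd_inr', fst_inr', snd_inl', LinearMap.comp_id,
      LinearMap.comp_zero, add_zero, zero_add]

lemma zero_add_equiv (e : D.InvIdem) : MvN e (zero.add e) := by
  refine MvN.of_transport (e := e) (e' := zero.add e) (isIntertwiner_inr FinDimRep.zero e.rep)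
    (isIntertwiner_snd FinDimRep.zero e.rep) (snd_inr _ _) ?_
  change blockDiag (V := FinDimRep.zero) (W := FinDimRep.zero) 0 e.val = _
  rw [blockDiag, map_zero, zero_add]
  rfl

lemma add_assoc_equiv (e f g : D.InvIdem) : MvN ((e.add f).add g) (e.add (f.add g)) := by
  refine MvN.of_transport (e := (e.add f).add g) (e' := e.add (f.add g))
    (φ := assocMap e.rep f.rep g.rep) (ψ := assocInv e.rep f.rep g.rep) ?_ ?_ ?_ ?_
  · exact ((isIntertwiner_inl _ _).comp ((isIntertwiner_fst _ _).comp (isIntertwiner_fst _ _))).add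
      (((isIntertwiner_inr _ _).comp ((isIntertwiner_inl _ _).comp ((isIntertwiner_snd _ _).comp
        (isIntertwiner_fst _ _)))).add
        ((isIntertwiner_inr _ _).comp ((isIntertwiner_inr _ _).comp (isIntertwiner_snd _ _))))
  · exact ((isIntertwiner_inl _ _).comp ((isIntertwiner_inl _ _).comp (isIntertwiner_fst _ _))).add
      (((isIntertwiner_inl _ _).comp ((isIntertwiner_inr _ _).comp ((isIntertwiner_fst _ _).comp
        (isIntertwiner_snd _ _)))).add
        ((isIntertwiner_inr _ _).comp ((isIntertwiner_snd _ _).comp (isIntertwiner_snd _ _))))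
  · exact assocInv_comp e.rep f.rep g.rep
  · exact blockDiag_assoc e.val f.val g.val

end InvIdem

/-- The set `S_H(A)` of Murray–von Neumann classes of invariant idempotents. -/
def IdemClass : Type _ := Quotient (InvIdem.setoid D)

/-- `S_H(A)` is a commutative monoid under the direct sum of idempotents. -/
instance : AddCommMonoid D.IdemClass where
  add := Quotient.map₂ InvIdem.add (fun _ _ h _ _ h' => InvIdem.MvN.add h h')
  zero := Quotient.mk _ InvIdem.zero
  nsmul := @nsmulRec _ ⟨Quotient.mk _ InvIdem.zero⟩
    ⟨Quotient.map₂ InvIdem.add (fun _ _ h _ _ h' => InvIdem.MvN.add h h')⟩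
  add_assoc := by
    rintro ⟨e⟩ ⟨f⟩ ⟨g⟩
    exact Quotient.sound (InvIdem.add_assoc_equiv e f g)
  zero_add := by
    rintro ⟨e⟩
    exact Quotient.sound (InvIdem.zero_add_equiv e).symm
  add_zero := by
    rintro ⟨e⟩
    exact Quotient.sound ((InvIdem.add_comm_equiv _ _).trans (InvIdem.zero_add_equiv e).symm)
  add_comm := by
    rintro ⟨e⟩ ⟨f⟩
    exact Quotient.sound (InvIdem.add_comm_equiv e f)

/-- The equivariant K-group `K₀^H(A)`, the Grothendieck group of `S_H(A)`. -/
abbrev K0 : Type _ := Algebra.GrothendieckAddGroup D.IdemClass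

/-- The class `[e] ∈ K₀^H(A)` of an invariant idempotent. -/
def K0.mk (e : D.InvIdem) : D.K0 :=
  Algebra.GrothendieckAddGroup.of (Quotient.mk _ e : D.IdemClass)

end YetterDrinfeldAlgebra

/-! ### The generalized trace -/

section Trace

variable {k : Type u} [Field k]

/-- For `G : A → Mult(A ⊗ B, …; X ⊗ B)`, the map `a ⊗ u ↦ (x ↦ u · G(a)(x))`, where `u` acts on
`X ⊗ B` by left multiplication on `B`. -/
def amplifyStep {A : Type w} [AddCommGroup A] [Module k A] {B : Type*} [Ring B] [Algebra k B]
    {X : Type*} [AddCommGroup X] [Module k X] {m : ℕ}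
    (G : A →ₗ[k] MultilinearMap k (fun _ : Fin m => A ⊗[k] B) (X ⊗[k] B)) :
    A ⊗[k] B →ₗ[k] MultilinearMap k (fun _ : Fin m => A ⊗[k] B) (X ⊗[k] B) :=
  TensorProduct.lift (LinearMap.mk₂ k
    (fun (a : A) (u : B) => ((LinearMap.mulLeft k u).lTensor X).compMultilinearMap (G a))
    (by intros; ext; simp) (by intros; ext; simp)
    (by
      intro a u u'
      have : LinearMap.mulLeft k (u + u') = LinearMap.mulLeft k u + LinearMap.mulLeft k u' := by
        ext; simp [add_mul]
      ext; simp [this, LinearMap.lTensor_add])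
    (by
      intro c a u
      have : LinearMap.mulLeft k (c • u) = c • LinearMap.mulLeft k u := by
        ext; simp
      ext; simp [this, LinearMap.lTensor_smul]))

/-- For an `m`-linear map `F : A^m → X` and an algebra `B`, the `m`-linear map
`(a₁ ⊗ u₁, …, a_m ⊗ u_m) ↦ F(a₁, …, a_m) ⊗ u₁ ⋯ u_m`. -/
def amplify (A : Type w) [AddCommGroup A] [Module k A] (B : Type*) [Ring B] [Algebra k B]
    {X : Type*} [AddCommGroup X] [Module k X] : (m : ℕ) →
    MultilinearMap k (fun _ : Fin m => A) X →ₗ[k]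
      MultilinearMap k (fun _ : Fin m => A ⊗[k] B) (X ⊗[k] B)
  | 0 =>
    { toFun := fun F => MultilinearMap.constOfIsEmpty k _ (F Fin.elim0 ⊗ₜ[k] (1 : B))
      map_add' := by intro F F'; ext x; simp [TensorProduct.add_tmul]
      map_smul' := by intro c F; ext x; simp [TensorProduct.smul_tmul'] }
  | m + 1 =>
    { toFun := fun F => (amplifyStep (amplify A B m ∘ₗ F.curryLeft)).uncurryLeft
      map_add' := by
        intro F F'
        have h : (F + F').curryLeft = F.curryLeft + F'.curryLeft := by ext; simp
        have h' : amplifyStep (amplify A B m ∘ₗ (F + F').curryLeft) =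
            amplifyStep (amplify A B m ∘ₗ F.curryLeft) +
              amplifyStep (amplify A B m ∘ₗ F'.curryLeft) := by
          rw [h]
          refine TensorProduct.ext' fun a u => ?_
          ext x
          simp [amplifyStep]
        ext x
        simp [h']
      map_smul' := by
        intro c F
        have h : (c • F).curryLeft = c • F.curryLeft := by ext; simp
        have h' : amplifyStep (amplify A B m ∘ₗ (c • F).curryLeft) =
            c • amplifyStep (amplify A B m ∘ₗ F.curryLeft) := by
          rw [h]
          refine TensorProduct.ext' fun a u => ?_
          ext x
          simp [amplifyStep]
        ext x
        simp [h'] }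

lemma amplify_tmul (A : Type w) [AddCommGroup A] [Module k A] (B : Type*) [Ring B] [Algebra k B]
    {X : Type*} [AddCommGroup X] [Module k X] (m : ℕ)
    (F : MultilinearMap k (fun _ : Fin m => A) X) (a : Fin m → A) (u : Fin m → B) :
    amplify A B m F (fun i => a i ⊗ₜ u i) = F a ⊗ₜ (List.ofFn u).prod := by
  induction m with
  | zero => simp [amplify, Subsingleton.elim a Fin.elim0]
  | succ m ih =>
    have h := congrArg ((LinearMap.mulLeft k (u 0)).lTensor X)
      (ih (F.curryLeft (a 0)) (Fin.tail a) (Fin.tail u))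
    refine (h : amplify A B (m + 1) F (fun i => a i ⊗ₜ u i) = _).trans ?_
    rw [LinearMap.lTensor_tmul, LinearMap.mulLeft_apply, MultilinearMap.curryLeft_apply,
      Fin.cons_self_tail, List.ofFn_succ, List.prod_cons]
    rfl

end Trace

namespace YetterDrinfeldAlgebra

variable {k : Type u} [Field k] {H : Type v} [Ring H] [HopfAlgebra k H]
variable {A : Type w} [Ring A] [Algebra k A] (D : YetterDrinfeldAlgebra k H A)

/-- The linear map `a ⊗ u ↦ a₍₀₎ ⊗ S(a₍₁₎) u` of `A ⊗ End(V)`, where `H` acts on `V`. -/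
def untwist (V : FinDimRep k H) : (A ⊗[k] Module.End k V.V) →ₗ[k] (A ⊗[k] Module.End k V.V) :=
  (LinearMap.mul' k (Module.End k V.V) ∘ₗ
      (V.act.toLinearMap ∘ₗ HopfAlgebra.antipode k).rTensor (Module.End k V.V)).lTensor A ∘ₗ
    (TensorProduct.assoc k A H (Module.End k V.V)).toLinearMap ∘ₗ
    D.coact.rTensor (Module.End k V.V)

lemma untwist_tmul (V : FinDimRep k H) (a : A) (u : Module.End k V.V) :
    D.untwist V (a ⊗ₜ u) = (LinearMap.mulRight k u ∘ₗ V.act.toLinearMap ∘ₗ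
      HopfAlgebra.antipode k).lTensor A (D.coact a) := by
  simp only [untwist, LinearMap.comp_apply, LinearMap.rTensor_tmul, LinearEquiv.coe_coe]
  induction D.coact a with
  | zero => simp
  | add x y hx hy => simp only [map_add, TensorProduct.add_tmul, hx, hy]
  | tmul b h => simp

/-- The bilinear map `(φ, u) ↦ (g ↦ φ(g⁽¹⁾) tr(u g⁽⁰⁾))` from `F(H) × End(V)` to `F(H)`, where
`H` acts on `V`, as a linear map on the tensor product. -/
def contractTrace (V : FinDimRep k H) : ((H →ₗ[k] k) ⊗[k] Module.End k V.V) →ₗ[k] (H →ₗ[k] k) :=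
  TensorProduct.lift (LinearMap.mk₂ k
    (fun φ u => sweedler₂ (LinearMap.mk₂ k
      (fun x y : H => φ y * LinearMap.trace k V.V (u * V.act x))
      (by intros; simp [mul_add]) (by intros; simp [mul_left_comm])
      (by intros; simp [add_mul]) (by intros; simp [mul_assoc])))
    (by intro φ φ' u; rw [← map_add]; congr 1; ext; simp [add_mul])
    (by intro c φ u; rw [← map_smul]; congr 1; ext; simp [mul_assoc])
    (by intro φ u u'; rw [← map_add]; congr 1; ext; simp [add_mul, mul_add])
    (by intro c φ u; rw [← map_smul]; congr 1; ext; simp [mul_left_comm]))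

/-- The generalized trace `Ψⁿ f : (A ⊗ End(V))^(n+1) → F(H)`,
`(Ψⁿ f)(a₀ ⊗ u₀, …, aₙ ⊗ uₙ)(g)
  = f(a₀₍₀₎, …, aₙ₍₀₎)(g⁽¹⁾) tr(S(a₀₍₁₎) u₀ S(a₁₍₁₎) u₁ ⋯ S(aₙ₍₁₎) uₙ g⁽⁰⁾)`. -/
def traceMap (V : FinDimRep k H) (n : ℕ) (f : Cochain k H A n) :
    MultilinearMap k (fun _ : Fin (n + 1) => A ⊗[k] Module.End k V.V) (H →ₗ[k] k) :=
  (contractTrace V).compMultilinearMap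
    ((amplify A (Module.End k V.V) (n + 1) f).compLinearMap fun _ => D.untwist V)

end YetterDrinfeldAlgebra

end

end EquivariantCyclic

open EquivariantCyclic
open scoped TensorProduct

namespace EquivariantCyclic
noncomputable section

/-! ### Convolution of linear maps on a Hopf algebra -/

section Convolution

open Coalgebra WithConv

variable {k : Type u} [Field k] {H : Type v} [Ring H] [HopfAlgebra k H]
variable {M : Type*} [Ring M] [Algebra k M]

/-! The twisted product is an ordinary product in disguise. The map a ⊗ u ↦ a₍₀₎ ⊗ S(a₍₁₎)u
(`untwist`) carries it to the componentwise product of A ⊗ End(V) (`untwist_tmul_eq_mul`). It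
carries invariant elements into the subalgebra I of all y with h⁽⁰⁾(h⁽¹⁾ · y) = y h, where the dot
acts on A and the other products are taken in End(V) (`untwist_mem_invariantSubalgebra`). So Ψⁿf is
the untwisted trace f(a₀, …, aₙ)(g⁽¹⁾) tr(u₀ ⋯ uₙ g⁽⁰⁾) (`ampTrace`) of the untwisted arguments.

This trace commutes with cofaces and codegeneracies for formal reasons. If the last argument lies in
I, the factor S⁻¹(g⁽⁰⁾) in T is absorbed by the relation defining I and by tr(uv) = tr(vu)
(`ampTrace_cyclicOp`). Restriction to I therefore turns equivariant cochains on A into F(H)-valued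
cochains on I with trivial action, compatibly with b and B, and what is left is Connes' pairing for
an ordinary algebra, read at each g separately. Equivariance of f enters only to show that the
values lie in R(H) (`ampTrace_mem_invariantFunctionals`).

For an ordinary algebra the main point is invariance under e ↦ e_t = (1 + tγ) e (1 - tγ) with γ² =
0. The pairing is polynomial in t, so in characteristic 0 it suffices that its first-order term
vanishes at every t (`eq_of_second_order`). The homotopy formula `sum_hochschild_word` writes the
derivative of f(z_t, e_t, …, e_t), for z commuting with e, as minus an alternating sum of values of
bf on words with one letter γ, plus an alternating sum of values of f on words with one letter γ and
first letter z - 2ze. For a cyclic cocycle take z = e: bf = 0, and the other values agree by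
cyclicity and cancel in pairs (`cyclicCocycle_shear`). For a periodic cocycle take z = e - 1/2: then
z - 2ze = -1/2, while bf = -Bf yields the same kind of sum one even degree higher
(`sum_connesB_word`). The weights (-1)ⁿ(2n)!/n! are exactly those for which these sums telescope
(`chernPairing_shear`), and they also annihilate coboundaries (`chernPairing_coboundary`).

Finally, if e and e' are equivalent, then e ⊕ 0 and 0 ⊕ e' over V ⊕ W are linked by three unipotent
conjugations (`apply_eq_of_shear`), and the trace adds over direct sums (`ampTrace_blockSum`), so e
and e' pair equally. Uniqueness holds because the classes [e] generate the Grothendieck group. -/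

variable (k) in
lemma sum_right_counit_smul (h : H) :
    ∑ i ∈ (ℛ k h).index, counit (R := k) ((ℛ k h).right i) • (ℛ k h).left i = h := by
  have := congrArg (TensorProduct.rid k H) (sum_tmul_counit_eq (R := k) (ℛ k h))
  simpa only [map_sum, TensorProduct.rid_tmul, one_smul] using this

/-- The map `h ↦ ε(h) y`, as an element of the convolution algebra. -/
def convConst (y : M) : WithConv (H →ₗ[k] M) := toConv ((counit (R := k) (A := H)).smulRight y)

/-- Sweedler sums are handled as products in the convolution ring of maps H → M. There a fixed
element y becomes `convConst y`, and multiplying by it on either side multiplies values by y on that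
side. -/
lemma convConst_mul_apply (y : M) (f : WithConv (H →ₗ[k] M)) (h : H) :
    (convConst y * f).ofConv h = y * f.ofConv h := by
  rw [(ℛ k h).convMul_apply]
  have := congrArg (fun t => y * f.ofConv t) (sum_counit_smul (ℛ k h))
  simpa [convConst, map_sum, Finset.mul_sum] using this

lemma mul_convConst_apply (y : M) (f : WithConv (H →ₗ[k] M)) (h : H) :
    (f * convConst y).ofConv h = f.ofConv h * y := by
  rw [(ℛ k h).convMul_apply]
  have := congrArg (fun t => f.ofConv t * y) (sum_right_counit_smul k h)
  simpa [convConst, map_sum, Finset.sum_mul] using this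

lemma convConst_mul (y z : M) :
    (convConst (y * z) : WithConv (H →ₗ[k] M)) = convConst y * convConst z := by
  ext h
  rw [convConst_mul_apply]
  simp [convConst]

/-- Composition with the antipode inverts an algebra map in the convolution ring. With this, a
cancellation of S(h⁽⁰⁾)h⁽¹⁾ inside a longer Sweedler expression is plain associativity. -/
lemma conv_antipode_mul (j : H →ₐ[k] M) :
    toConv (j.toLinearMap ∘ₗ HopfAlgebra.antipode k) * toConv j.toLinearMap = 1 := by
  ext h
  rw [(ℛ k h).convMul_apply]
  have := congrArg j (HopfAlgebra.sum_antipode_mul_eq_algebraMap_counit (ℛ k h))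
  simpa [map_sum] using this

lemma conv_mul_antipode (j : H →ₐ[k] M) :
    toConv j.toLinearMap * toConv (j.toLinearMap ∘ₗ HopfAlgebra.antipode k) = 1 := by
  ext h
  rw [(ℛ k h).convMul_apply]
  have := congrArg j (HopfAlgebra.sum_mul_antipode_eq_algebraMap_counit (ℛ k h))
  simpa [map_sum] using this

variable (k) in
/-- `Δ(S(h)) = S(h⁽¹⁾) ⊗ S(h⁽⁰⁾)`. -/
lemma comul_antipode (h : H) : comul (R := k) (HopfAlgebra.antipode k h) =
    ∑ i ∈ (ℛ k h).index, HopfAlgebra.antipode k ((ℛ k h).right i) ⊗ₜ[k]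
      HopfAlgebra.antipode k ((ℛ k h).left i) := by
  let L : H →ₐ[k] H ⊗[k] H := Algebra.TensorProduct.includeLeft
  let R : H →ₐ[k] H ⊗[k] H := Algebra.TensorProduct.includeRight
  have hΔ : toConv (comul (R := k) (A := H)) = toConv L.toLinearMap * toConv R.toLinearMap := by
    ext h
    rw [(ℛ k h).convMul_apply]
    simp [L, R, (ℛ k h).eq]
  have h1 : (toConv (R.toLinearMap ∘ₗ HopfAlgebra.antipode k) *
      toConv (L.toLinearMap ∘ₗ HopfAlgebra.antipode k)) * toConv (comul (R := k) (A := H)) = 1 := by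
    rw [hΔ, mul_assoc, ← mul_assoc (toConv (L.toLinearMap ∘ₗ _)), conv_antipode_mul, one_mul,
      conv_antipode_mul]
  -- Both sides of the claim are convolution inverses of Δ in Hom(H, H ⊗ H). Factoring Δ as the
  -- product of the two inclusions gives the explicit left inverse; Δ ∘ S is a right inverse.
  have h2 := left_inv_eq_right_inv h1 LinearMap.comul_right_inv
  have h3 := congrArg (fun f => f.ofConv h) h2
  refine Eq.trans h3.symm ?_
  refine ((ℛ k h).convMul_apply _ _).trans ?_
  simp [L, R]

end Convolution

/-! ### Invariant elements of the untwisted algebra -/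

namespace YetterDrinfeldAlgebra

open Coalgebra WithConv

variable {k : Type u} [Field k] {H : Type v} [Ring H] [HopfAlgebra k H]
variable {A : Type w} [Ring A] [Algebra k A] (D : YetterDrinfeldAlgebra k H A) (V : FinDimRep k H)

variable (A) in
/-- The map `h ↦ 1 ⊗ h` from `H` to `A ⊗ End(V)`. -/
def repHom : H →ₐ[k] A ⊗[k] Module.End k V.V :=
  Algebra.TensorProduct.includeRight.comp V.act

lemma repHom_apply (h : H) : repHom A V h = 1 ⊗ₜ V.act h := rfl

/-- The action of `H` on the first factor of `A ⊗ End(V)`. -/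
def leftAct : H →ₗ[k] (A ⊗[k] Module.End k V.V) →ₗ[k] (A ⊗[k] Module.End k V.V) :=
  LinearMap.rTensorHom (Module.End k V.V) ∘ₗ D.act.toLinearMap

lemma leftAct_tmul (h : H) (a : A) (u : Module.End k V.V) :
    D.leftAct V h (a ⊗ₜ u) = D.act h a ⊗ₜ u := rfl

lemma leftAct_leftAct (s t : H) (y : A ⊗[k] Module.End k V.V) :
    D.leftAct V s (D.leftAct V t y) = D.leftAct V (s * t) y :=
  congrArg (fun f => f y) (show D.leftAct V s ∘ₗ D.leftAct V t = D.leftAct V (s * t) by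
    ext; simp [leftAct_tmul])

lemma leftAct_one (y : A ⊗[k] Module.End k V.V) : D.leftAct V 1 y = y :=
  congrArg (fun f => f y) (show D.leftAct V 1 = LinearMap.id by ext; simp [leftAct_tmul])

/-- The map `h ↦ h · y`, for the action on the first factor. -/
def leftOrbit (y : A ⊗[k] Module.End k V.V) : WithConv (H →ₗ[k] (A ⊗[k] Module.End k V.V)) :=
  toConv ((D.leftAct V).flip y)

lemma leftOrbit_apply (y : A ⊗[k] Module.End k V.V) (h : H) :
    (D.leftOrbit V y).ofConv h = D.leftAct V h y := rfl

lemma leftOrbit_add (y z : A ⊗[k] Module.End k V.V) :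
    D.leftOrbit V (y + z) = D.leftOrbit V y + D.leftOrbit V z := by
  ext h; simp [leftOrbit]

lemma leftAct_mul_tmul (h : H) (y : A ⊗[k] Module.End k V.V) (u : Module.End k V.V) :
    D.leftAct V h (y * 1 ⊗ₜ u) = D.leftAct V h y * 1 ⊗ₜ u := by
  induction y with
  | zero => simp
  | add x y hx hy => simp only [map_add, add_mul, hx, hy]
  | tmul a v => simp [leftAct_tmul]

lemma leftAct_tmul_mul (h : H) (y : A ⊗[k] Module.End k V.V) (u : Module.End k V.V) :
    D.leftAct V h (1 ⊗ₜ u * y) = 1 ⊗ₜ u * D.leftAct V h y := by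
  induction y with
  | zero => simp
  | add x y hx hy => simp only [map_add, mul_add, hx, hy]
  | tmul a v => simp [leftAct_tmul]

/-- The module algebra axiom says that y ↦ (h ↦ h · y) is multiplicative into the convolution ring.
This makes the relation in `invariantSubalgebra` stable under products. -/
lemma leftOrbit_mul (y z : A ⊗[k] Module.End k V.V) :
    D.leftOrbit V (y * z) = D.leftOrbit V y * D.leftOrbit V z := by
  ext h
  rw [(ℛ k h).convMul_apply]
  simp only [leftOrbit_apply]
  induction y with
  | zero => simp
  | add x y hx hy => simp only [map_add, add_mul, hx, hy, Finset.sum_add_distrib]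
  | tmul a u =>
  induction z with
  | zero => simp
  | add x y hx hy => simp only [map_add, mul_add, hx, hy, Finset.sum_add_distrib]
  | tmul c v =>
    simp only [leftAct_tmul, Algebra.TensorProduct.tmul_mul_tmul]
    rw [sum_act_mul, sweedler₂_eq, TensorProduct.sum_tmul]
    rfl

lemma leftOrbit_one : D.leftOrbit V 1 = 1 := by
  ext h
  rw [leftOrbit_apply, Algebra.TensorProduct.one_def, leftAct_tmul, D.act_one]
  simp [Algebra.algebraMap_eq_smul_one, TensorProduct.smul_tmul', Algebra.TensorProduct.one_def]

/-- The elements `a ⊗ u` of the algebra `A ⊗ End(V)` with `h⁽¹⁾ · a ⊗ h⁽⁰⁾ u = a ⊗ u h` for all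
`h`. -/
def invariantSubalgebra : Subalgebra k (A ⊗[k] Module.End k V.V) where
  carrier := {y | toConv (repHom A V).toLinearMap * D.leftOrbit V y =
    convConst y * toConv (repHom A V).toLinearMap}
  mul_mem' := by
    intro y z hy hz
    simp only [Set.mem_ofPred_eq] at hy hz ⊢
    -- With ρ for `repHom` and o for `leftOrbit`, the computation is ρ o(y) o(z) = y ρ o(z) = y z ρ.
    rw [leftOrbit_mul, ← mul_assoc, hy, mul_assoc, hz, ← mul_assoc, convConst_mul]
  add_mem' := by
    intro y z hy hz
    simp only [Set.mem_ofPred_eq] at hy hz ⊢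
    rw [leftOrbit_add, mul_add, hy, hz]
    ext h
    simp only [convConst_mul_apply, add_mul, ofConv_add, LinearMap.add_apply]
  algebraMap_mem' := by
    intro r
    simp only [Set.mem_ofPred_eq]
    have : D.leftOrbit V (algebraMap k _ r) = convConst (algebraMap k _ r) := by
      ext h
      rw [Algebra.algebraMap_eq_smul_one]
      have h1 := congrArg (fun f => r • f.ofConv h) (D.leftOrbit_one V)
      simpa [leftOrbit, convConst, Algebra.algebraMap_eq_smul_one, smul_comm r] using h1
    rw [this]
    ext h
    rw [convConst_mul_apply, mul_convConst_apply, Algebra.commutes]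

lemma mem_invariantSubalgebra {y : A ⊗[k] Module.End k V.V} :
    y ∈ D.invariantSubalgebra V ↔ ∀ h : H, ∑ i ∈ (ℛ k h).index,
      repHom A V ((ℛ k h).left i) * D.leftAct V ((ℛ k h).right i) y = y * repHom A V h := by
  refine Iff.trans (WithConv.ext_iff.trans LinearMap.ext_iff) (forall_congr' fun h => ?_)
  have h1 := (ℛ k h).convMul_apply (toConv (repHom A V).toLinearMap) (D.leftOrbit V y)
  have h2 := convConst_mul_apply y (toConv (repHom A V).toLinearMap) h
  exact (Eq.congr h1 h2)

/-- The map `a ↦ a₍₀₎ ⊗ S(a₍₁₎)`. -/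
def untwistLeft : A →ₗ[k] A ⊗[k] Module.End k V.V :=
  (V.act.toLinearMap ∘ₗ HopfAlgebra.antipode k).lTensor A ∘ₗ D.coact

lemma untwistLeft_apply (a : A) : D.untwistLeft V a =
    (V.act.toLinearMap ∘ₗ HopfAlgebra.antipode k).lTensor A (D.coact a) := rfl

lemma untwist_eq (a : A) (u : Module.End k V.V) :
    D.untwist V (a ⊗ₜ u) = D.untwistLeft V a * 1 ⊗ₜ u := by
  rw [untwist_tmul, untwistLeft_apply]
  induction D.coact a with
  | zero => simp
  | add x y hx hy => simp only [map_add, add_mul, hx, hy]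
  | tmul b t => simp

lemma untwist_one : D.untwist V (1 ⊗ₜ 1) = 1 := by
  rw [untwist_tmul, D.coact_one]
  simp [Algebra.TensorProduct.one_def]

/-- The coaction reverses the order of the H-factors and the antipode reverses it back, so a ↦ a₍₀₎
⊗ S(a₍₁₎) respects the ordinary product. -/
lemma untwistLeft_mul (a b : A) :
    D.untwistLeft V (a * b) = D.untwistLeft V a * D.untwistLeft V b := by
  rw [untwistLeft_apply, untwistLeft_apply, untwistLeft_apply, D.coact_mul]
  induction D.coact a with
  | zero => simp
  | add x y hx hy => simp only [map_add, add_mul, hx, hy, LinearMap.add_apply]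
  | tmul c s =>
  induction D.coact b with
  | zero => simp
  | add x y hx hy => simp only [map_add, mul_add, hx, hy]
  | tmul d t =>
    simp [HopfAlgebra.antipode_mul_antidistrib]

/-- `S(t⁽⁰⁾) (t⁽¹⁾ · u) = u S(t)` -/
lemma sum_antipode_mul_homAct (t : H) (u : Module.End k V.V) :
    ∑ i ∈ (ℛ k t).index, V.act (HopfAlgebra.antipode k ((ℛ k t).left i)) *
      V.homAct V ((ℛ k t).right i) u = u * V.act (HopfAlgebra.antipode k t) := by
  -- The conjugation action is the convolution product ρ · u · (ρ ∘ S), with ρ the structure map of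
  -- V and u constant; multiplying by ρ ∘ S on the left cancels the first factor.
  have h1 : ∀ t, V.homAct V t u = (toConv V.act.toLinearMap * (convConst u *
      toConv (V.act.toLinearMap ∘ₗ HopfAlgebra.antipode k))).ofConv t := by
    intro t
    rw [(ℛ k t).convMul_apply, FinDimRep.homAct_eq]
    simp only [convConst_mul_apply]
    rfl
  have h2 := congrArg (fun f => f.ofConv t) (congrArg (· * (convConst u *
    toConv (V.act.toLinearMap ∘ₗ HopfAlgebra.antipode k))) (conv_antipode_mul V.act))
  simp only [one_mul, mul_assoc] at h2
  rw [(ℛ k t).convMul_apply, convConst_mul_apply] at h2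
  simp only [h1]
  exact h2

/-- `(h⁽⁰⁾ · u) h⁽¹⁾ = h u` -/
lemma sum_homAct_mul (h : H) (u : Module.End k V.V) :
    ∑ i ∈ (ℛ k h).index, V.homAct V ((ℛ k h).left i) u * V.act ((ℛ k h).right i) =
      V.act h * u := by
  have h1 : ∀ t, V.homAct V t u = (toConv V.act.toLinearMap * (convConst u *
      toConv (V.act.toLinearMap ∘ₗ HopfAlgebra.antipode k))).ofConv t := by
    intro t
    rw [(ℛ k t).convMul_apply, FinDimRep.homAct_eq]
    simp only [convConst_mul_apply]
    rfl
  have h2 : (toConv V.act.toLinearMap * (convConst u *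
      toConv (V.act.toLinearMap ∘ₗ HopfAlgebra.antipode k))) * toConv V.act.toLinearMap =
      toConv V.act.toLinearMap * convConst u := by
    rw [mul_assoc, mul_assoc, conv_antipode_mul, mul_one]
  have h3 := congrArg (fun f => f.ofConv h) h2
  rw [(ℛ k h).convMul_apply, mul_convConst_apply] at h3
  simp only [h1]
  exact h3

end YetterDrinfeldAlgebra
end
end EquivariantCyclic

/-! ### Untwisting: from the twisted product and the diagonal action to the ordinary algebra -/

namespace EquivariantCyclic
noncomputable section
namespace YetterDrinfeldAlgebra

open Coalgebra WithConv

variable {k : Type u} [Field k] {H : Type v} [Ring H] [HopfAlgebra k H]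
variable {A : Type w} [Ring A] [Algebra k A] (D : YetterDrinfeldAlgebra k H A) (V : FinDimRep k H)

/-- By coassociativity the left side is c₍₀₎ ⊗ S(t⁽⁰⁾)(t⁽¹⁾ · u) with t = c₍₁₎, which
`sum_antipode_mul_homAct` collapses to c₍₀₎ ⊗ u S(t). This exchange relation undoes the twist in the
product. -/
lemma untwistLeft_comm (c : A) (u : Module.End k V.V) :
    D.untwist V (TensorProduct.map LinearMap.id ((V.homAct V).flip u) (D.coact c)) =
      1 ⊗ₜ u * D.untwistLeft V c := by
  let G : H →ₗ[k] H →ₗ[k] Module.End k V.V :=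
    (LinearMap.mul k (Module.End k V.V)).compl₁₂
      (V.act.toLinearMap ∘ₗ HopfAlgebra.antipode k) ((V.homAct V).flip u)
  have h1 : ∀ ζ : A ⊗[k] H, D.untwist V (TensorProduct.map LinearMap.id ((V.homAct V).flip u) ζ) =
      (TensorProduct.lift G).lTensor A (TensorProduct.assoc k A H H (D.coact.rTensor H ζ)) := by
    intro ζ
    induction ζ with
    | zero => simp
    | add x y hx hy => simp only [map_add, hx, hy]
    | tmul a t =>
      rw [TensorProduct.map_tmul, untwist_tmul, LinearMap.rTensor_tmul]
      simp only [LinearMap.id_apply]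
      induction D.coact a with
      | zero => simp
      | add x y hx hy => simp only [map_add, TensorProduct.add_tmul, hx, hy]
      | tmul b s => simp [G]
  rw [h1, D.coact_coassoc, untwistLeft_apply]
  induction D.coact c with
  | zero => simp
  | add x y hx hy => simp only [map_add, mul_add, hx, hy]
  | tmul b t =>
    have h2 : TensorProduct.lift G (comul t) = u * V.act (HopfAlgebra.antipode k t) := by
      rw [← sum_antipode_mul_homAct, ← (ℛ k t).eq, map_sum]
      simp [G]
    simp [h2]

/-- `untwist` turns the twisted product into the usual product of `A ⊗ End(V)`. -/
lemma untwist_tmul_eq_mul (x y : A ⊗[k] Module.End k V.V) :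
    D.untwist V (D.tmul V V V x y) = D.untwist V x * D.untwist V y := by
  induction y with
  | zero => simp
  | add x y hx hy => simp only [map_add, mul_add, hx, hy]
  | tmul c v =>
  induction x with
  | zero => simp
  | add x y hx hy => simp only [map_add, add_mul, LinearMap.add_apply, hx, hy]
  | tmul a u =>
    have h1 : ∀ ζ : A ⊗[k] H, D.untwist V (TensorProduct.map₂ (LinearMap.mul k A)
        (FinDimRep.twistedComp V V V v) (a ⊗ₜ u) ζ) = D.untwistLeft V a *
          D.untwist V (TensorProduct.map LinearMap.id ((V.homAct V).flip u) ζ) * 1 ⊗ₜ v := by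
      intro ζ
      induction ζ with
      | zero => simp
      | add x y hx hy => simp only [map_add, mul_add, add_mul, hx, hy]
      | tmul b t =>
        rw [FinDimRep.map₂_tmul_tmul, FinDimRep.twistedComp_apply, LinearMap.mul_apply',
          TensorProduct.map_tmul]
        change D.untwist V ((a * b) ⊗ₜ (V.homAct V t u * v)) = _
        rw [untwist_eq, untwist_eq, untwistLeft_mul]
        simp [mul_assoc]
    rw [tmul_tmul, h1, untwistLeft_comm, untwist_eq, untwist_eq]
    simp only [mul_assoc]

/-- The map `h ↦ (h · a)₍₀₎ ⊗ S((h · a)₍₁₎)`. -/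
def untwistOrbit (a : A) : WithConv (H →ₗ[k] (A ⊗[k] Module.End k V.V)) :=
  toConv (D.untwistLeft V ∘ₗ D.actOn a)

/-- This is the Yetter–Drinfeld condition with S applied to the H-factor. Since S reverses products,
S(h⁽⁰⁾) comes out on the left of one side and S(h⁽¹⁾) on the right of the other. -/
lemma antipode_conv_untwistOrbit (a : A) :
    toConv ((repHom A V).toLinearMap ∘ₗ HopfAlgebra.antipode k) * D.untwistOrbit V a =
      D.leftOrbit V (D.untwistLeft V a) *
        toConv ((repHom A V).toLinearMap ∘ₗ HopfAlgebra.antipode k) := by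
  ext h
  rw [(ℛ k h).convMul_apply, (ℛ k h).convMul_apply]
  have h1 := congrArg ((V.act.toLinearMap ∘ₗ HopfAlgebra.antipode k).lTensor A)
    (D.sum_yetterDrinfeld h a)
  rw [map_sum, map_sum] at h1
  have h2 : ∀ (x : H) (ζ : A ⊗[k] H), (V.act.toLinearMap ∘ₗ HopfAlgebra.antipode k).lTensor A
      ((LinearMap.mulRight k x).lTensor A ζ) = repHom A V (HopfAlgebra.antipode k x) *
        (V.act.toLinearMap ∘ₗ HopfAlgebra.antipode k).lTensor A ζ := by
    intro x ζ
    induction ζ with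
    | zero => simp
    | add x y hx hy => simp only [map_add, mul_add, hx, hy]
    | tmul b t => simp [repHom_apply, HopfAlgebra.antipode_mul_antidistrib]
  have h3 : ∀ (x y : H) (ζ : A ⊗[k] H), (V.act.toLinearMap ∘ₗ HopfAlgebra.antipode k).lTensor A
      (TensorProduct.map (D.act x) (LinearMap.mulLeft k y) ζ) =
        D.leftAct V x ((V.act.toLinearMap ∘ₗ HopfAlgebra.antipode k).lTensor A ζ) *
          repHom A V (HopfAlgebra.antipode k y) := by
    intro x y ζ
    induction ζ with
    | zero => simp
    | add x y hx hy => simp only [map_add, add_mul, hx, hy]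
    | tmul b t => simp [repHom_apply, leftAct_tmul, HopfAlgebra.antipode_mul_antidistrib]
  simp only [h2, h3] at h1
  exact h1

/-- Multiply `antipode_conv_untwistOrbit` on both sides by the convolution inverse of the antipode
factor. -/
lemma untwistOrbit_conv (a : A) :
    D.untwistOrbit V a * toConv (repHom A V).toLinearMap =
      toConv (repHom A V).toLinearMap * D.leftOrbit V (D.untwistLeft V a) := by
  have := congrArg (fun t => toConv (repHom A V).toLinearMap * t *
    toConv (repHom A V).toLinearMap) (D.antipode_conv_untwistOrbit V a)
  simp only [← mul_assoc, conv_mul_antipode, one_mul] at this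
  rw [this, mul_assoc, conv_antipode_mul, mul_one]

/-- `untwist` intertwines the diagonal action with the action
`h · (a ⊗ u) = h⁽¹⁾ · a ⊗ h⁽⁰⁾ u S(h⁽²⁾)`. -/
lemma sum_untwist_diagAct (h : H) (x : A ⊗[k] Module.End k V.V) :
    ∑ i ∈ (ℛ k h).index, D.untwist V (D.diagAct V V ((ℛ k h).left i) x) *
      repHom A V ((ℛ k h).right i) =
    ∑ i ∈ (ℛ k h).index, repHom A V ((ℛ k h).left i) *
      D.leftAct V ((ℛ k h).right i) (D.untwist V x) := by
  induction x with
  | zero => simp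
  | add x y hx hy => simp only [map_add, mul_add, add_mul, hx, hy, Finset.sum_add_distrib]
  | tmul a u =>
    have h1 := congrArg (fun f => f.ofConv h * 1 ⊗ₜ u) (D.untwistOrbit_conv V a)
    rw [(ℛ k h).convMul_apply, (ℛ k h).convMul_apply, Finset.sum_mul, Finset.sum_mul] at h1
    simp only [untwist_eq, leftAct_mul_tmul, ← mul_assoc]
    refine Eq.trans ?_ h1
    simp only [diagAct_tmul, sweedler₂_eq, map_sum, pairAct_apply, untwist_eq]
    let T : H →ₗ[k] H →ₗ[k] H →ₗ[k] A ⊗[k] Module.End k V.V :=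
      LinearMap.mk₂ k (fun x y => LinearMap.mulLeft k (D.untwistLeft V (D.act x a) *
          1 ⊗ₜ V.homAct V y u) ∘ₗ (repHom A V).toLinearMap)
        (by intros; ext; simp [add_mul, mul_assoc]) (by intros; ext; simp [smul_mul_assoc, mul_assoc])
        (by intros; ext; simp [mul_add, add_mul, TensorProduct.tmul_add, mul_assoc])
        (by intros; ext; simp [smul_mul_assoc])
    -- Coassociativity brings the action on u and the trailing factor of H together, so that
    -- `sum_homAct_mul` applies to the pair.
    have h2 := sum_coassoc T h
    simp only [T, LinearMap.mk₂_apply, LinearMap.comp_apply, LinearMap.mulLeft_apply] at h2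
    simp only [Finset.sum_mul]
    refine h2.trans (Finset.sum_congr rfl fun i _ => ?_)
    simp only [mul_assoc, ← Finset.mul_sum]
    congr 1
    have h3 := congrArg (fun w => (1 : A) ⊗ₜ[k] w) (sum_homAct_mul V ((ℛ k h).right i) u)
    simp only [TensorProduct.tmul_sum] at h3
    simpa [repHom_apply] using h3

/-- For invariant x the left side of `sum_untwist_diagAct` collapses, by counitality, to the
untwisted element times h, which is the relation defining the subalgebra. -/
lemma untwist_mem_invariantSubalgebra {x : A ⊗[k] Module.End k V.V}
    (hx : D.IsInvariant (V := V) (W := V) x) : D.untwist V x ∈ D.invariantSubalgebra V := by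
  rw [mem_invariantSubalgebra]
  intro h
  rw [← sum_untwist_diagAct]
  have hx' : ∀ h, D.diagAct V V h x = counit (R := k) h • x := hx
  simp only [hx', map_smul, smul_mul_assoc]
  have := congrArg (fun t => D.untwist V x * repHom A V t) (sum_counit_smul (ℛ k h))
  simpa [map_sum, Finset.mul_sum, mul_smul_comm] using this

section Bijective

variable [BijectiveAntipode k H]

lemma antipode_antipodeInv (h : H) : HopfAlgebra.antipode k (antipodeInv k H h) = h :=
  (LinearEquiv.ofBijective (HopfAlgebra.antipode k : H →ₗ[k] H)
    BijectiveAntipode.bijective).apply_symm_apply h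

lemma sum_antipodeInv_mul (h : H) : ∑ i ∈ (ℛ k h).index,
    antipodeInv k H ((ℛ k h).right i) * (ℛ k h).left i = counit (R := k) h • 1 := by
  apply (BijectiveAntipode.bijective (k := k) (H := H)).injective
  simp only [map_sum, HopfAlgebra.antipode_mul_antidistrib, antipode_antipodeInv, map_smul,
    HopfAlgebra.antipode_one]
  exact HopfAlgebra.sum_antipode_mul_eq_smul (ℛ k h)

/-- `S⁻¹(h⁽¹⁾) · (y h⁽⁰⁾) = h y` for invariant `y`. -/
lemma sum_leftAct_antipodeInv {y : A ⊗[k] Module.End k V.V} (hy : y ∈ D.invariantSubalgebra V)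
    (h : H) : ∑ i ∈ (ℛ k h).index, D.leftAct V (antipodeInv k H ((ℛ k h).right i))
      (y * repHom A V ((ℛ k h).left i)) = repHom A V h * y := by
  rw [mem_invariantSubalgebra] at hy
  -- Replacing y h⁽⁰⁾ by h⁽⁰⁾(h⁽¹⁾ · y) produces h⁽⁰⁾(S⁻¹(h⁽²⁾)h⁽¹⁾ · y), in which the inner product
  -- collapses to a counit.
  simp only [← hy, map_sum]
  let T : H →ₗ[k] H →ₗ[k] H →ₗ[k] A ⊗[k] Module.End k V.V :=
    LinearMap.mk₂ k (fun x z => LinearMap.mulLeft k (repHom A V x) ∘ₗ (D.leftAct V).flip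
        (D.leftAct V z y) ∘ₗ antipodeInv k H)
      (by intros; ext; simp [add_mul]) (by intros; ext; simp [smul_mul_assoc])
      (by intros; ext; simp [mul_add]) (by intros; ext; simp)
  have h2 := sum_coassoc T h
  simp only [T, LinearMap.mk₂_apply, LinearMap.comp_apply, LinearMap.mulLeft_apply,
    LinearMap.flip_apply] at h2
  simp only [repHom_apply, leftAct_tmul_mul] at h2 ⊢
  refine h2.trans ?_
  have h4 : ∀ t, ∑ i ∈ (ℛ k t).index, D.leftAct V (antipodeInv k H ((ℛ k t).right i) *
      (ℛ k t).left i) y = counit (R := k) t • y := by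
    intro t
    have := congrArg (fun s => D.leftAct V s y) (sum_antipodeInv_mul (k := k) t)
    simpa [map_sum, leftAct_one] using this
  simp only [leftAct_leftAct, ← Finset.mul_sum, h4]
  have := congrArg (fun t => repHom A V t * y) (sum_right_counit_smul k h)
  simpa [map_sum, Finset.sum_mul, repHom_apply, mul_smul_comm, smul_mul_assoc] using this

end Bijective

end YetterDrinfeldAlgebra
end
end EquivariantCyclic

/-! ### The untwisted trace and its compatibility with the cocyclic operators -/

namespace EquivariantCyclic
noncomputable section

section Amplify

variable {k : Type u} [Field k]

lemma multilinear_ext_tmul {A : Type*} [AddCommGroup A] [Module k A] {B : Type*} [AddCommGroup B]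
    [Module k B] {X : Type*} [AddCommGroup X] [Module k X] {m : ℕ}
    {F G : MultilinearMap k (fun _ : Fin m => A ⊗[k] B) X}
    (h : ∀ (a : Fin m → A) (u : Fin m → B), F (fun i => a i ⊗ₜ u i) = G (fun i => a i ⊗ₜ u i)) :
    F = G := by
  induction m with
  | zero =>
    ext x
    rw [Subsingleton.elim x (fun i => (0 : A) ⊗ₜ (0 : B))]
    exact h 0 0
  | succ m ih =>
    have : F.curryLeft = G.curryLeft := by
      refine TensorProduct.ext' fun a u => ih fun a' u' => ?_
      have := h (Fin.cons a a') (Fin.cons u u')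
      have e : (fun i => (Fin.cons a a' : Fin (m + 1) → A) i ⊗ₜ[k]
          (Fin.cons u u' : Fin (m + 1) → B) i) = Fin.cons (a ⊗ₜ[k] u) fun i => a' i ⊗ₜ u' i := by
        funext i
        refine Fin.cases ?_ (fun i => ?_) i <;> simp
      rw [e] at this
      simpa using this
    rw [← MultilinearMap.uncurry_curryLeft F, this, MultilinearMap.uncurry_curryLeft]

lemma prod_ofFn_contractNth {B : Type*} [Monoid B] {n : ℕ} (i : Fin (n + 1)) (u : Fin (n + 2) → B) :
    (List.ofFn (Fin.contractNth i.castSucc (· * ·) u)).prod = (List.ofFn u).prod := by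
  induction n with
  | zero =>
    obtain rfl : i = 0 := Fin.fin_one_eq_zero i
    simp [List.ofFn_succ, Fin.contractNth]
  | succ n ih =>
    refine Fin.cases ?_ (fun i => ?_) i
    · rw [List.ofFn_succ, List.ofFn_succ (f := u), List.ofFn_succ (f := fun i => u i.succ),
        List.prod_cons, List.prod_cons, List.prod_cons, ← mul_assoc]
      rfl
    · rw [List.ofFn_succ, List.ofFn_succ (f := u), List.prod_cons, List.prod_cons, ← ih i]
      congr 2
      congr 1
      funext j
      simp only [Fin.contractNth]
      simp

lemma prod_ofFn_insertNth_one {B : Type*} [Monoid B] {n : ℕ} (i : Fin (n + 1)) (u : Fin n → B) :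
    (List.ofFn (i.insertNth (α := fun _ => B) 1 u)).prod = (List.ofFn u).prod := by
  induction n with
  | zero =>
    obtain rfl : i = 0 := Fin.fin_one_eq_zero i
    simp
  | succ n ih =>
    refine Fin.cases ?_ (fun i => ?_) i
    · rw [Fin.insertNth_zero', List.ofFn_cons, List.prod_cons, one_mul]
    · rw [List.ofFn_succ, List.ofFn_succ (f := u), List.prod_cons, List.prod_cons,
        ← ih i fun j => u j.succ]
      refine congrArg₂ (· * ·) ?_ (congrArg (fun w => (List.ofFn w).prod) ?_)
      · conv_lhs => rw [← Fin.succ_succAbove_zero i]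
        rw [Fin.insertNth_apply_succAbove]
      · funext j
        refine Fin.succAboveCases i ?_ (fun j => ?_) j
        · simp
        · rw [Fin.insertNth_apply_succAbove, ← Fin.succ_succAbove_succ,
            Fin.insertNth_apply_succAbove]

lemma contractNth_tmul {A : Type*} [Ring A] [Algebra k A] {B : Type*} [Ring B] [Algebra k B]
    {n : ℕ} (i : Fin (n + 1)) (a : Fin (n + 1) → A) (u : Fin (n + 1) → B) :
    Fin.contractNth i (· * ·) (fun j => a j ⊗ₜ[k] u j) = fun j =>
      Fin.contractNth i (· * ·) a j ⊗ₜ[k] Fin.contractNth i (· * ·) u j := by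
  funext j
  simp only [Fin.contractNth]
  split_ifs <;> simp

lemma insertNth_tmul {A : Type*} [Ring A] [Algebra k A] {B : Type*} [Ring B] [Algebra k B]
    {n : ℕ} (i : Fin (n + 1)) (a : Fin n → A) (u : Fin n → B) :
    i.insertNth (α := fun _ => A ⊗[k] B) 1 (fun j => a j ⊗ₜ[k] u j) = fun j =>
      i.insertNth (α := fun _ => A) 1 a j ⊗ₜ[k] i.insertNth (α := fun _ => B) 1 u j := by
  funext j
  refine Fin.succAboveCases i ?_ (fun j => ?_) j <;> simp [Algebra.TensorProduct.one_def]

end Amplify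

namespace YetterDrinfeldAlgebra

open Coalgebra WithConv

variable {k : Type u} [Field k] {H : Type v} [Ring H] [HopfAlgebra k H]
variable {A : Type w} [Ring A] [Algebra k A] (D : YetterDrinfeldAlgebra k H A) (V : FinDimRep k H)

lemma contractTrace_tmul (φ : H →ₗ[k] k) (u : Module.End k V.V) (g : H) :
    contractTrace V (φ ⊗ₜ u) g = ∑ i ∈ (ℛ k g).index, φ ((ℛ k g).right i) *
      LinearMap.trace k V.V (u * V.act ((ℛ k g).left i)) := by
  change sweedler₂ _ g = _
  rw [sweedler₂_eq]
  rfl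

variable (A) in
/-- The map `(a₀ ⊗ u₀, …, aₙ ⊗ uₙ) ↦ f(a₀, …, aₙ)(g⁽¹⁾) tr(u₀ ⋯ uₙ g⁽⁰⁾)`. -/
def ampTrace (n : ℕ) : Cochain k H A n →ₗ[k] Cochain k H (A ⊗[k] Module.End k V.V) n :=
  { toFun := fun f => (contractTrace V).compMultilinearMap (amplify A (Module.End k V.V) (n + 1) f)
    map_add' := fun f f' => by ext; simp
    map_smul' := fun c f => by ext; simp }

lemma ampTrace_apply (n : ℕ) (f : Cochain k H A n) (x : Fin (n + 1) → A ⊗[k] Module.End k V.V) :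
    ampTrace A V n f x = contractTrace V (amplify A (Module.End k V.V) (n + 1) f x) := rfl

lemma traceMap_eq (n : ℕ) (f : Cochain k H A n) (x : Fin (n + 1) → A ⊗[k] Module.End k V.V) :
    D.traceMap V n f x = ampTrace A V n f fun i => D.untwist V (x i) := rfl

lemma ampTrace_tmul (n : ℕ) (f : Cochain k H A n) (a : Fin (n + 1) → A)
    (u : Fin (n + 1) → Module.End k V.V) : ampTrace A V n f (fun i => a i ⊗ₜ u i) =
      contractTrace V (f a ⊗ₜ (List.ofFn u).prod) := by
  rw [ampTrace_apply, amplify_tmul]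

lemma ampTrace_coface (n : ℕ) (i : Fin (n + 1)) (f : Cochain k H A n) :
    ampTrace A V (n + 1) (coface k H A n i f) =
      coface k H (A ⊗[k] Module.End k V.V) n i (ampTrace A V n f) := by
  refine multilinear_ext_tmul fun a u => ?_
  rw [ampTrace_tmul]
  change _ = ampTrace A V n f (Fin.contractNth i.castSucc (· * ·) fun i => a i ⊗ₜ u i)
  rw [contractNth_tmul, ampTrace_tmul, prod_ofFn_contractNth]
  rfl

lemma ampTrace_codegeneracy (n : ℕ) (i : Fin (n + 1)) (f : Cochain k H A (n + 1)) :
    ampTrace A V n (codegeneracy k H A n i f) =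
      codegeneracy k H (A ⊗[k] Module.End k V.V) n i (ampTrace A V (n + 1) f) := by
  refine multilinear_ext_tmul fun a u => ?_
  rw [ampTrace_tmul]
  change _ = ampTrace A V (n + 1) f (i.succ.insertNth 1 fun i => a i ⊗ₜ u i)
  rw [insertNth_tmul, ampTrace_tmul, prod_ofFn_insertNth_one]
  rfl

lemma ampTrace_extraCodegeneracy (n : ℕ) (f : Cochain k H A (n + 1)) :
    ampTrace A V n (extraCodegeneracy k H A n f) =
      extraCodegeneracy k H (A ⊗[k] Module.End k V.V) n (ampTrace A V (n + 1) f) := by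
  refine multilinear_ext_tmul fun a u => ?_
  rw [ampTrace_tmul]
  change _ = ampTrace A V (n + 1) f (Fin.cons 1 fun i => a i ⊗ₜ u i)
  rw [← Fin.insertNth_zero', insertNth_tmul, ampTrace_tmul, prod_ofFn_insertNth_one,
    Fin.insertNth_zero']
  rfl

section Bijective

variable [BijectiveAntipode k H]

/-- For y = a ⊗ u the left side is the sum of φ(S⁻¹(g⁽¹⁾) · a)(g⁽²⁾) tr(w u g⁽⁰⁾). It depends on y
only through S⁻¹(g⁽¹⁾) · (y g⁽⁰⁾), which `sum_leftAct_antipodeInv` contracts to a left multiple of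
y; the trace property then moves w to the right of u. -/
lemma contractTrace_antipodeTwist {y : A ⊗[k] Module.End k V.V} (hy : y ∈ D.invariantSubalgebra V)
    (φ : A →ₗ[k] (H →ₗ[k] k)) (w : Module.End k V.V) :
    contractTrace V (TensorProduct.map (D.antipodeTwist φ) (LinearMap.mulLeft k w) y) =
      contractTrace V (TensorProduct.map φ (LinearMap.mulRight k w) y) := by
  ext g
  let L : H →ₗ[k] (A ⊗[k] Module.End k V.V) →ₗ[k] k := LinearMap.flip
    (TensorProduct.lift ((LinearMap.llcomp k H k k).flip.compl₁₂ φ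
      ((LinearMap.mul k k).flip ∘ₗ LinearMap.trace k V.V ∘ₗ LinearMap.mulLeft k w)))
  have hL : ∀ t a u, L t (a ⊗ₜ u) = φ a t * LinearMap.trace k V.V (w * u) := by
    intro t a u; simp [L, mul_comm]
  have h1 : ∀ z, contractTrace V (TensorProduct.map (D.antipodeTwist φ) (LinearMap.mulLeft k w) z) g
      = ∑ i ∈ (ℛ k g).index, ∑ j ∈ (ℛ k ((ℛ k g).right i)).index,
        L ((ℛ k ((ℛ k g).right i)).right j) (D.leftAct V
          (antipodeInv k H ((ℛ k ((ℛ k g).right i)).left j)) (z * repHom A V ((ℛ k g).left i))) := by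
    intro z
    induction z with
    | zero => simp
    | add x y hx hy => simp only [map_add, LinearMap.add_apply, hx, hy, add_mul,
        Finset.sum_add_distrib]
    | tmul a u =>
      rw [TensorProduct.map_tmul, contractTrace_tmul]
      refine Finset.sum_congr rfl fun i _ => ?_
      have : D.antipodeTwist φ a ((ℛ k g).right i) = _ := sweedler₂_eq _ _
      rw [this, Finset.sum_mul]
      refine Finset.sum_congr rfl fun j _ => ?_
      simp only [repHom_apply, Algebra.TensorProduct.tmul_mul_tmul, leftAct_tmul, hL, mul_one,
        LinearMap.mulLeft_apply, mul_assoc]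
      rfl
  let T : H →ₗ[k] H →ₗ[k] H →ₗ[k] k := LinearMap.mk₂ k
      (fun x s => L.flip (D.leftAct V (antipodeInv k H s) (y * repHom A V x)))
      (by intros; ext; simp [mul_add]) (by intros; ext; simp [mul_smul_comm])
      (by intros; ext; simp) (by intros; ext; simp)
  have h2 := sum_coassoc T g
  simp only [T, LinearMap.mk₂_apply, LinearMap.flip_apply] at h2
  rw [h1, ← h2]
  simp only [← map_sum, D.sum_leftAct_antipodeInv V hy]
  -- Invariance has been used up. The remaining identity is linear in y and holds for every y, so it
  -- may be checked on pure tensors.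
  clear h1 h2 T hy
  induction y with
  | zero => simp
  | add x y hx hy => simp only [map_add, LinearMap.add_apply, ← hx, ← hy, mul_add,
      Finset.sum_add_distrib]
  | tmul a u =>
    rw [TensorProduct.map_tmul, contractTrace_tmul]
    refine Finset.sum_congr rfl fun i _ => ?_
    simp only [repHom_apply, Algebra.TensorProduct.tmul_mul_tmul, hL, one_mul,
      LinearMap.mulRight_apply]
    rw [← mul_assoc, LinearMap.trace_mul_comm k (w * _), ← mul_assoc]

/-- Only the argument that T moves to the front has to be invariant. The others can be decomposed
into pure tensors, and `contractTrace_antipodeTwist` applies with w the product of their matrix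
parts. -/
lemma ampTrace_cyclicOp (n : ℕ) (f : Cochain k H A n) (x : Fin n → A ⊗[k] Module.End k V.V)
    {y : A ⊗[k] Module.End k V.V} (hy : y ∈ D.invariantSubalgebra V) :
    ampTrace A V n (D.cyclicOp n f) (Fin.snoc x y) = ampTrace A V n f (Fin.cons y x) := by
  have key : (LinearMap.applyₗ y).compMultilinearMap
      ((ampTrace A V n (D.cyclicOp n f)).curryRight) =
        (ampTrace A V n f).curryLeft y := by
    refine multilinear_ext_tmul fun a u => ?_
    have h1 : ∀ z, ampTrace A V n (D.cyclicOp n f) (Fin.snoc (fun i => a i ⊗ₜ u i) z) =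
        contractTrace V (TensorProduct.map (D.antipodeTwist (headMap f a))
          (LinearMap.mulLeft k (List.ofFn u).prod) z) := by
      intro z
      induction z with
      | zero => simpa using ((ampTrace A V n (D.cyclicOp n f)).curryRight _).map_zero
      | add x y hx hy => rw [MultilinearMap.snoc_add, hx, hy, map_add, map_add]
      | tmul c v =>
        have e : (Fin.snoc (α := fun _ => A ⊗[k] Module.End k V.V) (fun i => a i ⊗ₜ u i)
            (c ⊗ₜ[k] v)) = fun i => (Fin.snoc a c : Fin (n + 1) → A) i ⊗ₜ[k]
              (Fin.snoc u v : Fin (n + 1) → Module.End k V.V) i := by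
          funext i
          refine Fin.lastCases ?_ (fun i => ?_) i <;> simp
        rw [e, ampTrace_tmul, TensorProduct.map_tmul, List.ofFn_succ_last]
        simp [ModuleAlgebra.cyclicOp, MultilinearMap.uncurryRight_apply]
    have h2 : ∀ z, ampTrace A V n f (Fin.cons z (fun i => a i ⊗ₜ u i)) =
        contractTrace V (TensorProduct.map (headMap f a)
          (LinearMap.mulRight k (List.ofFn u).prod) z) := by
      intro z
      induction z with
      | zero =>
        rw [map_zero, map_zero]
        exact congrArg (fun F : MultilinearMap k
          (fun _ : Fin n => A ⊗[k] Module.End k V.V) (H →ₗ[k] k) => F (fun i => a i ⊗ₜ u i))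
          ((ampTrace A V n f).curryLeft.map_zero)
      | add x y hx hy => rw [MultilinearMap.cons_add, hx, hy, map_add, map_add]
      | tmul c v =>
        have e : (Fin.cons (c ⊗ₜ[k] v) (fun i => a i ⊗ₜ u i) :
            Fin (n + 1) → A ⊗[k] Module.End k V.V) = fun i => (Fin.cons c a : Fin (n + 1) → A) i ⊗ₜ[k]
              (Fin.cons v u : Fin (n + 1) → Module.End k V.V) i := by
          funext i
          refine Fin.cases ?_ (fun i => ?_) i <;> simp
        rw [e, ampTrace_tmul, TensorProduct.map_tmul, List.ofFn_succ]
        simp [headMap]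
    change ampTrace A V n (D.cyclicOp n f) (Fin.snoc (fun i => a i ⊗ₜ u i) y) =
      ampTrace A V n f (Fin.cons y (fun i => a i ⊗ₜ u i))
    rw [h1, h2, D.contractTrace_antipodeTwist V hy]
  exact congrArg (fun F => F x) key

end Bijective

end YetterDrinfeldAlgebra
end
end EquivariantCyclic

/-! ### Equivariance of the cochain: values of the trace are invariant functionals -/

namespace EquivariantCyclic
noncomputable section

section Amplify

variable {k : Type u} [Field k]

lemma amplify_compMultilinearMap (A : Type w) [AddCommGroup A] [Module k A] (B : Type*) [Ring B]
    [Algebra k B] {X Y : Type*} [AddCommGroup X] [Module k X] [AddCommGroup Y] [Module k Y] (m : ℕ)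
    (θ : X →ₗ[k] Y) (F : MultilinearMap k (fun _ : Fin m => A) X) (y : Fin m → A ⊗[k] B) :
    amplify A B m (θ.compMultilinearMap F) y = θ.rTensor B (amplify A B m F y) := by
  have : amplify A B m (θ.compMultilinearMap F) =
      (θ.rTensor B).compMultilinearMap (amplify A B m F) := by
    refine multilinear_ext_tmul fun a u => ?_
    rw [LinearMap.compMultilinearMap_apply, amplify_tmul, amplify_tmul]
    rfl
  rw [this]
  rfl

lemma amplifyStep_tmul {A : Type w} [AddCommGroup A] [Module k A] {B : Type*} [Ring B] [Algebra k B]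
    {X : Type*} [AddCommGroup X] [Module k X] {m : ℕ}
    (G : A →ₗ[k] MultilinearMap k (fun _ : Fin m => A ⊗[k] B) (X ⊗[k] B)) (a : A) (u : B)
    (y : Fin m → A ⊗[k] B) :
    amplifyStep G (a ⊗ₜ u) y = (LinearMap.mulLeft k u).lTensor X (G a y) := rfl

lemma amplify_succ (A : Type w) [AddCommGroup A] [Module k A] (B : Type*) [Ring B] [Algebra k B]
    {X : Type*} [AddCommGroup X] [Module k X] (m : ℕ)
    (F : MultilinearMap k (fun _ : Fin (m + 1) => A) X) (y : Fin (m + 1) → A ⊗[k] B) :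
    amplify A B (m + 1) F y = amplifyStep (amplify A B m ∘ₗ F.curryLeft) (y 0) (Fin.tail y) := rfl

end Amplify

namespace ModuleAlgebra

open Coalgebra

variable {k : Type u} [Field k] {H : Type v} [Ring H] [HopfAlgebra k H]
variable {A : Type w} [Ring A] [Algebra k A] (D : ModuleAlgebra k H A)
variable {X : Type*} [AddCommGroup X] [Module k X]

/-- The map `(a₁, …, a_m) ↦ (h ↦ F(h⁽⁰⁾ · a₁, …, h⁽ᵐ⁻¹⁾ · a_m))`. -/
def orbitMap (m : ℕ) : MultilinearMap k (fun _ : Fin m => A) X →ₗ[k]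
    MultilinearMap k (fun _ : Fin m => A) (H →ₗ[k] X) where
  toFun F := (sweedler m).compMultilinearMap
    ((MultilinearMap.piLinearMap F).compLinearMap fun _ => D.act.toLinearMap.flip)
  map_add' F F' := by
    ext a : 1
    simp only [LinearMap.compMultilinearMap_apply, add_apply, map_add,
      MultilinearMap.compLinearMap_apply]
  map_smul' c F := by
    ext a : 1
    simp only [LinearMap.compMultilinearMap_apply, smul_apply, map_smul,
      MultilinearMap.compLinearMap_apply, RingHom.id_apply]

lemma orbitMap_apply (m : ℕ) (F : MultilinearMap k (fun _ : Fin m => A) X) (a : Fin m → A) :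
    D.orbitMap m F a = sweedler m (F.compLinearMap fun i => D.actOn (a i)) := rfl

lemma orbitMap_zero_apply (F : MultilinearMap k (fun _ : Fin 0 => A) X) (a : Fin 0 → A) (h : H) :
    D.orbitMap 0 F a h = counit (R := k) h • F Fin.elim0 := by
  rw [orbitMap_apply]
  change counit (R := k) h • (F.compLinearMap fun i => D.actOn (a i)) Fin.elim0 = _
  congr 1
  exact congrArg F (Subsingleton.elim _ _)

lemma orbitMap_succ_apply (m : ℕ) (F : MultilinearMap k (fun _ : Fin (m + 1) => A) X)
    (a : A) (b : Fin m → A) (h : H) : D.orbitMap (m + 1) F (Fin.cons a b) h =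
      ∑ i ∈ (ℛ k h).index, D.orbitMap m (F.curryLeft (D.act ((ℛ k h).left i) a)) b
        ((ℛ k h).right i) := by
  rw [orbitMap_apply]
  refine (sweedler₂_eq _ h).trans (Finset.sum_congr rfl fun i _ => ?_)
  rw [orbitMap_apply]
  change sweedler m _ _ = sweedler m _ _
  congr 2
  ext t
  simp only [MultilinearMap.curryLeft_apply, MultilinearMap.compLinearMap_apply]
  congr 1
  funext j
  refine Fin.cases ?_ (fun j => ?_) j <;> simp [actOn]

end ModuleAlgebra

namespace YetterDrinfeldAlgebra

open Coalgebra

variable {k : Type u} [Field k] {H : Type v} [Ring H] [HopfAlgebra k H]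
variable {A : Type w} [Ring A] [Algebra k A] (D : YetterDrinfeldAlgebra k H A) (V : FinDimRep k H)

/-- The action of `H` on `X ⊗ End(V)` by left multiplication on the second factor. -/
def leftMul (X : Type*) [AddCommGroup X] [Module k X] :
    H →ₗ[k] X ⊗[k] Module.End k V.V →ₗ[k] X ⊗[k] Module.End k V.V :=
  LinearMap.lTensorHom X ∘ₗ LinearMap.mul k (Module.End k V.V) ∘ₗ V.act.toLinearMap

lemma leftMul_apply (X : Type*) [AddCommGroup X] [Module k X] (h : H)
    (ζ : X ⊗[k] Module.End k V.V) :
    leftMul V X h ζ = (LinearMap.mulLeft k (V.act h)).lTensor X ζ := rfl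

/-- The evaluation of the first factor of `Hom(H, X) ⊗ End(V)`. -/
def evalAt (X : Type*) [AddCommGroup X] [Module k X] :
    H →ₗ[k] (H →ₗ[k] X) ⊗[k] Module.End k V.V →ₗ[k] X ⊗[k] Module.End k V.V :=
  LinearMap.rTensorHom (Module.End k V.V) ∘ₗ LinearMap.applyₗ

lemma evalAt_apply (X : Type*) [AddCommGroup X] [Module k X] (h : H)
    (ζ : (H →ₗ[k] X) ⊗[k] Module.End k V.V) :
    evalAt V X h ζ = (LinearMap.applyₗ h).rTensor (Module.End k V.V) ζ := rfl

/-- This is the relation h⁽⁰⁾(h⁽¹⁾ · y) = y h for m factors at once: as h is pushed through u₁ ⋯ u_m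
from left to right, each invariant factor absorbs one leg of the iterated coproduct. The induction
passes one factor at a time. -/
lemma sum_amplify_orbitMap {X : Type*} [AddCommGroup X] [Module k X] (m : ℕ)
    (F : MultilinearMap k (fun _ : Fin m => A) X) (y : Fin m → A ⊗[k] Module.End k V.V)
    (hy : ∀ i, y i ∈ D.invariantSubalgebra V) (h : H) :
    ∑ i ∈ (ℛ k h).index, (LinearMap.mulLeft k (V.act ((ℛ k h).left i))).lTensor X
      ((LinearMap.applyₗ ((ℛ k h).right i)).rTensor (Module.End k V.V)
        (amplify A (Module.End k V.V) m (D.orbitMap m F) y)) =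
    (LinearMap.mulRight k (V.act h)).lTensor X (amplify A (Module.End k V.V) m F y) := by
  induction m generalizing h with
  | zero =>
    have h1 : ∀ t, (LinearMap.applyₗ t).rTensor (Module.End k V.V)
        (amplify A (Module.End k V.V) 0 (D.orbitMap 0 F) y) =
          counit (R := k) t • (F Fin.elim0 ⊗ₜ 1) := by
      intro t
      change (D.orbitMap 0 F Fin.elim0 t) ⊗ₜ[k] (1 : Module.End k V.V) = _
      rw [D.orbitMap_zero_apply, TensorProduct.smul_tmul']
    have h2 : amplify A (Module.End k V.V) 0 F y = F Fin.elim0 ⊗ₜ 1 := rfl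
    simp only [h1, h2, map_smul, LinearMap.lTensor_tmul, LinearMap.mulLeft_apply, mul_one,
      LinearMap.mulRight_apply, one_mul]
    have := congrArg (fun t => F Fin.elim0 ⊗ₜ[k] V.act t) (sum_right_counit_smul k h)
    simpa [map_sum, TensorProduct.tmul_sum] using this
  | succ m ih =>
    -- Here z enters the first slot without being acted on; the orbit is taken in the remaining
    -- slots only.
    let Q : (A ⊗[k] Module.End k V.V) →ₗ[k] (H →ₗ[k] X) ⊗[k] Module.End k V.V :=
      { toFun := fun z => amplifyStep (amplify A (Module.End k V.V) m ∘ₗ D.orbitMap m ∘ₗ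
          F.curryLeft) z (Fin.tail y)
        map_add' := fun z z' => by simp
        map_smul' := fun c z => by simp }
    have hQ : ∀ a u, Q (a ⊗ₜ u) = (LinearMap.mulLeft k u).lTensor _
      (amplify A (Module.End k V.V) m (D.orbitMap m (F.curryLeft a)) (Fin.tail y)) :=
      fun _ _ => rfl
    have hQ' : ∀ x z, leftMul V _ x (Q z) = Q (repHom A V x * z) := by
      intro x z
      induction z with
      | zero => simp
      | add a b ha hb => simp only [map_add, mul_add, ha, hb]
      | tmul a u =>
        rw [repHom_apply, Algebra.TensorProduct.tmul_mul_tmul, one_mul, hQ, hQ, leftMul_apply,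
          LinearMap.mulLeft_mul, LinearMap.lTensor_comp_apply]
    have hcomm : ∀ x t ζ, leftMul V X x (evalAt V X t ζ) =
        evalAt V X t (leftMul V _ x ζ) := by
      intro x t ζ
      induction ζ with
      | zero => simp
      | add a b ha hb => simp only [map_add, ha, hb]
      | tmul ψ w => rfl
    have hW : ∀ t z, evalAt V X t (amplify A (Module.End k V.V) (m + 1) (D.orbitMap (m + 1) F)
        (Fin.cons z (Fin.tail y))) = ∑ i ∈ (ℛ k t).index,
          evalAt V X ((ℛ k t).right i) (Q (D.leftAct V ((ℛ k t).left i) z)) := by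
      intro t z
      rw [amplify_succ, Fin.cons_zero, Fin.tail_cons]
      induction z with
      | zero => simp
      | add a b ha hb => simp only [map_add, add_apply, ha, hb, Finset.sum_add_distrib]
      | tmul a u =>
        have h1 : (LinearMap.applyₗ t).compMultilinearMap ((D.orbitMap (m + 1) F).curryLeft a) =
            ∑ i ∈ (ℛ k t).index, (LinearMap.applyₗ ((ℛ k t).right i)).compMultilinearMap
              (D.orbitMap m (F.curryLeft (D.act ((ℛ k t).left i) a))) := by
          ext b
          simpa using D.orbitMap_succ_apply m F a b t
        have h2 : ∀ (s : H) (v : Module.End k V.V) (ζ : (H →ₗ[k] X) ⊗[k] Module.End k V.V),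
            evalAt V X s ((LinearMap.mulLeft k v).lTensor _ ζ) =
              (LinearMap.mulLeft k v).lTensor _ (evalAt V X s ζ) := by
          intro s v ζ
          induction ζ with
          | zero => simp
          | add a b ha hb => simp only [map_add, ha, hb]
          | tmul ψ w => rfl
        simp only [amplifyStep_tmul, LinearMap.comp_apply, leftAct_tmul, hQ, h2, evalAt_apply,
          ← amplify_compMultilinearMap]
        rw [h1, map_sum, sum_apply, map_sum]
    let T : H →ₗ[k] H →ₗ[k] H →ₗ[k] X ⊗[k] Module.End k V.V := LinearMap.mk₂ k
      (fun x z => leftMul V X x ∘ₗ (evalAt V X).flip (Q (D.leftAct V z (y 0))))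
      (by intros; ext; simp) (by intros; ext; simp)
      (by intros; ext; simp) (by intros; ext; simp)
    have h1 := sum_coassoc T h
    simp only [T, LinearMap.mk₂_apply, LinearMap.comp_apply, LinearMap.flip_apply] at h1
    have hW' := fun t => hW t (y 0)
    rw [Fin.cons_self_tail] at hW'
    change ∑ i ∈ (ℛ k h).index, leftMul V X ((ℛ k h).left i) (evalAt V X ((ℛ k h).right i)
      (amplify A (Module.End k V.V) (m + 1) (D.orbitMap (m + 1) F) y)) = _
    simp only [hW', map_sum]
    rw [← h1]
    simp only [hcomm, hQ']
    -- The invariance of the first argument replaces h⁽⁰⁾(h⁽¹⁾ · y₀) by y₀ h⁽⁰⁾; the induction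
    -- hypothesis then carries h through the tail.
    simp only [← map_sum, (D.mem_invariantSubalgebra V).1 (hy 0)]
    rw [amplify_succ]
    have hy' : ∀ i, Fin.tail y i ∈ D.invariantSubalgebra V := fun i => hy i.succ
    generalize y 0 = z
    induction z with
    | zero => simp
    | add a b ha hb => simp only [map_add, add_apply, add_mul, ← ha, ← hb, Finset.sum_add_distrib]
    | tmul a u =>
      have h2 := congrArg ((LinearMap.mulLeft k u).lTensor X) (ih (F.curryLeft a) (Fin.tail y) hy' h)
      rw [amplifyStep_tmul]
      have h3 : ∀ ζ : X ⊗[k] Module.End k V.V, (LinearMap.mulLeft k u).lTensor X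
          ((LinearMap.mulRight k (V.act h)).lTensor X ζ) =
          (LinearMap.mulRight k (V.act h)).lTensor X ((LinearMap.mulLeft k u).lTensor X ζ) := by
        intro ζ
        induction ζ with
        | zero => simp
        | add a b ha hb => simp only [map_add, ha, hb]
        | tmul ψ w => simp [mul_assoc]
      rw [LinearMap.comp_apply, ← h3, ← h2, map_sum]
      refine Finset.sum_congr rfl fun i _ => ?_
      rw [repHom_apply, Algebra.TensorProduct.tmul_mul_tmul, mul_one, hQ, LinearMap.mulLeft_mul,
        LinearMap.lTensor_comp_apply]
      generalize amplify A (Module.End k V.V) m (D.orbitMap m (F.curryLeft a)) (Fin.tail y) = ζ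
      induction ζ with
      | zero => simp
      | add a b ha hb => simp only [map_add, ha, hb]
      | tmul ψ w => rfl

/-- The bilinear form of `twistedAdjointInv`. -/
def coadjoint : (H →ₗ[k] k) →ₗ[k] (H →ₗ[k] (H →ₗ[k] k)) where
  toFun ψ := LinearMap.mk₂ k (fun h g => ψ (twistedAdjointInv k g h))
    (by intros; simp) (by intros; simp)
    (by intro h g g'; simp [twistedAdjointInv, sweedler₂_eq, mul_add, add_mul,
          Finset.sum_add_distrib])
    (by intro h c g; simp [twistedAdjointInv, sweedler₂_eq, Finset.mul_sum])
  map_add' ψ ψ' := by ext; simp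
  map_smul' c ψ := by ext; simp

lemma coadjoint_apply (ψ : H →ₗ[k] k) (h g : H) :
    coadjoint ψ h g = ψ (twistedAdjointInv k g h) := rfl

lemma twistedAdjointInv_eq (g h : H) : twistedAdjointInv k g h = ∑ i ∈ (ℛ k h).index,
    HopfAlgebra.antipode k ((ℛ k h).right i) * g * (ℛ k h).left i := by
  rw [twistedAdjointInv, sweedler₂_eq]
  rfl

lemma twistedAdjointInv_antipode (g h : H) :
    twistedAdjointInv k g (HopfAlgebra.antipode k h) = twistedAdjoint k g h := by
  rw [twistedAdjoint, sweedler₂_eq]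
  change TensorProduct.lift _ (comul _) = _
  rw [comul_antipode, map_sum]
  rfl

/-- Expanding Δ(S(h⁽¹⁾) g h⁽⁰⁾) by multiplicativity and `comul_antipode`, the two inner legs of h
act on the functional and the two outer legs end up in the trace, where cyclicity turns w into h⁽⁰⁾
w S(h⁽³⁾). -/
lemma contractTrace_twistedAdjointInv (ζ : (H →ₗ[k] k) ⊗[k] Module.End k V.V) (g h : H) :
    contractTrace V ζ (twistedAdjointInv k g h) =
      ∑ i ∈ (ℛ k h).index, ∑ j ∈ (ℛ k ((ℛ k h).right i)).index,
        contractTrace V ((LinearMap.mulRight k (V.act (HopfAlgebra.antipode k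
            ((ℛ k ((ℛ k h).right i)).right j)))).lTensor _
          ((LinearMap.mulLeft k (V.act ((ℛ k h).left i))).lTensor _
            ((LinearMap.applyₗ ((ℛ k ((ℛ k h).right i)).left j)).rTensor (Module.End k V.V)
              (coadjoint.rTensor (Module.End k V.V) ζ)))) g := by
  induction ζ with
  | zero => simp
  | add x y hx hy => simp only [map_add, LinearMap.add_apply, hx, hy, Finset.sum_add_distrib]
  | tmul ψ w =>
    let Λ : H ⊗[k] H →ₗ[k] k := TensorProduct.lift ((LinearMap.mul k k).flip.compl₁₂
      (LinearMap.trace k V.V ∘ₗ LinearMap.mulLeft k w ∘ₗ V.act.toLinearMap) ψ)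
    have hΛ : ∀ x y, Λ (x ⊗ₜ y) = ψ y * LinearMap.trace k V.V (w * V.act x) := fun x y => by
      simp [Λ, mul_comm]
    have hc : ∀ r, contractTrace V (ψ ⊗ₜ w) r = Λ (comul r) := by
      intro r
      rw [contractTrace_tmul, ← (ℛ k r).eq, map_sum]
      simp only [hΛ]
    let N : H ⊗[k] H →ₗ[k] H ⊗[k] H →ₗ[k] k := LinearMap.mk₂ k
      (fun x y => Λ (y * comul g * x)) (by intros; simp [mul_add]) (by intros; simp)
      (by intros; simp [add_mul]) (by intros; simp)
    let Q : H →ₗ[k] H →ₗ[k] H ⊗[k] H := ((TensorProduct.mk k H H).compl₁₂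
      (HopfAlgebra.antipode k) (HopfAlgebra.antipode k)).flip
    have h1 := sum_sweedler₂_mul N (TensorProduct.mk k H H) Q h
    have h2 : ∀ t : H, sweedler₂ (TensorProduct.mk k H H) t = comul t := by
      intro t
      rw [sweedler₂_eq]
      exact (ℛ k t).eq
    have h3 : ∀ t : H, sweedler₂ Q t = comul (HopfAlgebra.antipode k t) := by
      intro t
      rw [sweedler₂_eq, comul_antipode]
      rfl
    rw [hc, twistedAdjointInv_eq]
    simp only [h2, h3] at h1
    simp only [map_sum, Bialgebra.comul_mul]
    refine h1.trans (Finset.sum_congr rfl fun i _ => Finset.sum_congr rfl fun j _ => ?_)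
    simp only [LinearMap.rTensor_tmul, LinearMap.lTensor_tmul, contractTrace_tmul,
      LinearMap.applyₗ_apply_apply, coadjoint_apply, twistedAdjointInv_eq, map_sum, Finset.sum_mul]
    rw [Finset.sum_comm]
    refine Finset.sum_congr rfl fun m _ => ?_
    simp only [N, LinearMap.mk₂_apply]
    conv_lhs => rw [← (ℛ k g).eq]
    rw [Finset.mul_sum, Finset.sum_mul, map_sum]
    refine Finset.sum_congr rfl fun l _ => ?_
    simp only [Q, LinearMap.flip_apply, LinearMap.compl₁₂_apply, TensorProduct.mk_apply,
      Algebra.TensorProduct.tmul_mul_tmul, hΛ, LinearMap.mulLeft_apply, LinearMap.mulRight_apply,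
      map_mul]
    congr 1
    rw [← mul_assoc, LinearMap.trace_mul_comm]
    simp only [mul_assoc]

end YetterDrinfeldAlgebra
end
end EquivariantCyclic

namespace EquivariantCyclic
noncomputable section
namespace YetterDrinfeldAlgebra
open Coalgebra
variable {k : Type u} [Field k] {H : Type v} [Ring H] [HopfAlgebra k H]
variable {A : Type w} [Ring A] [Algebra k A] (D : YetterDrinfeldAlgebra k H A) (V : FinDimRep k H)
-- Equivariance says that acting on all arguments equals the coadjoint action on the value; here
-- that equality is carried through the amplification.
lemma rTensor_coadjoint (n : ℕ) {f : Cochain k H A n} (hf : f ∈ D.equivariantCochains n)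
    (y : Fin (n + 1) → A ⊗[k] Module.End k V.V) :
    coadjoint.rTensor (Module.End k V.V) (amplify A (Module.End k V.V) (n + 1) f y) =
        amplify A (Module.End k V.V) (n + 1) (D.orbitMap (n + 1) f) y := by
  have h1 : D.orbitMap (n + 1) f = coadjoint.compMultilinearMap f := by
    ext a h g
    exact hf h g a
  rw [h1]
  have := amplify_compMultilinearMap A (Module.End k V.V) (X := H →ₗ[k] k) (Y := H →ₗ[k] H →ₗ[k] k) (n + 1) coadjoint f y
  exact this.symm

/-- The expansion of the trace at S(h⁽¹⁾) g h⁽⁰⁾ multiplies the matrix part by h⁽⁰⁾ on the left and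
S(h⁽²⁾) on the right, with h⁽¹⁾ acting on the arguments. Invariance of the arguments trades the
first two for right multiplication, and h⁽⁰⁾S(h⁽¹⁾) cancels. The condition defining R(H) is this
statement for S(h) in place of h. -/
lemma ampTrace_mem_invariantFunctionals (n : ℕ) {f : Cochain k H A n}
    (hf : f ∈ D.equivariantCochains n) (y : Fin (n + 1) → A ⊗[k] Module.End k V.V)
    (hy : ∀ i, y i ∈ D.invariantSubalgebra V) :
    ampTrace A V n f y ∈ invariantFunctionals k H := by
  have key : ∀ h g, ampTrace A V n f y (twistedAdjointInv k g h) =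
      counit (R := k) h * ampTrace A V n f y g := by
    intro h g
    rw [ampTrace_apply, contractTrace_twistedAdjointInv]
    rw [D.rTensor_coadjoint V n hf]
    set ξ := amplify A (Module.End k V.V) (n + 1) (D.orbitMap (n + 1) f) y with hξ
    let R : H →ₗ[k] (H →ₗ[k] k) ⊗[k] Module.End k V.V →ₗ[k] (H →ₗ[k] k) ⊗[k] Module.End k V.V :=
      LinearMap.lTensorHom _ ∘ₗ (LinearMap.mul k (Module.End k V.V)).flip ∘ₗ
        V.act.toLinearMap ∘ₗ HopfAlgebra.antipode k
    let T : H →ₗ[k] H →ₗ[k] H →ₗ[k] k := LinearMap.mk₂ k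
      (fun x q => LinearMap.applyₗ g ∘ₗ contractTrace V ∘ₗ
        R.flip (leftMul V (H →ₗ[k] k) x (evalAt V (H →ₗ[k] k) q ξ)))
      (by intros; ext; simp) (by intros; ext; simp)
      (by intros; ext; simp) (by intros; ext; simp)
    have hT : ∀ x q t, T x q t = contractTrace V ((LinearMap.mulRight k (V.act
      (HopfAlgebra.antipode k t))).lTensor _ ((LinearMap.mulLeft k (V.act x)).lTensor _
        ((LinearMap.applyₗ q).rTensor (Module.End k V.V) ξ))) g := fun _ _ _ => rfl
    have h2 := sum_coassoc T h
    simp only [hT] at h2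
    rw [← h2]
    have h5 : ∀ s t : H, ∑ j ∈ (ℛ k s).index, contractTrace V ((LinearMap.mulRight k (V.act
        (HopfAlgebra.antipode k t))).lTensor _ ((LinearMap.mulLeft k
          (V.act ((ℛ k s).left j))).lTensor _ ((LinearMap.applyₗ ((ℛ k s).right j)).rTensor
            (Module.End k V.V) ξ))) g = contractTrace V ((LinearMap.mulRight k (V.act
        (HopfAlgebra.antipode k t))).lTensor _ ((LinearMap.mulRight k (V.act s)).lTensor _
          (amplify A (Module.End k V.V) (n + 1) f y))) g := by
      intro s t
      rw [← D.sum_amplify_orbitMap V (n + 1) f y hy, map_sum, map_sum, LinearMap.sum_apply]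

    simp only [h5]
    rw [← LinearMap.sum_apply, ← map_sum]
    have h3 : ∀ ζ : (H →ₗ[k] k) ⊗[k] Module.End k V.V, ∑ i ∈ (ℛ k h).index,
        (LinearMap.mulRight k (V.act (HopfAlgebra.antipode k ((ℛ k h).right i)))).lTensor _
          ((LinearMap.mulRight k (V.act ((ℛ k h).left i))).lTensor _ ζ) =
        counit (R := k) h • ζ := by
      intro ζ
      induction ζ with
      | zero => simp
      | add a b ha hb => simp only [map_add, ha, hb, Finset.sum_add_distrib, smul_add]
      | tmul ψ w =>
        have h4 := congrArg (fun r => ψ ⊗ₜ[k] (w * V.act r))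
          (HopfAlgebra.sum_mul_antipode_eq_smul (ℛ k h))
        simpa [map_sum, Finset.mul_sum, TensorProduct.tmul_sum, mul_assoc] using h4
    rw [h3, map_smul]
    rfl
  intro h g
  rw [← twistedAdjointInv_antipode, key, HopfAlgebra.counit_antipode]

end YetterDrinfeldAlgebra
end
end EquivariantCyclic

namespace EquivariantCyclic
noncomputable section

/-! ### Cochains on an algebra with the trivial action -/

section Trivial

open Coalgebra

variable (k : Type u) [Field k] (H : Type v) [Ring H] [HopfAlgebra k H]
variable (R : Type*) [Ring R] [Algebra k R]

/-- The trivial action of `H` on an algebra. -/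
def trivialModuleAlgebra : ModuleAlgebra k H R where
  act := (Algebra.ofId k (Module.End k R)).comp (Bialgebra.counitAlgHom k H)
  act_mul := by
    intro h a b
    rw [sweedler₂_eq]
    have := congrArg (fun t => counit (R := k) t • (a * b)) (sum_counit_smul (ℛ k h))
    simp only [map_sum, map_smul, Finset.sum_smul] at this
    simpa [Algebra.ofId_apply, Module.algebraMap_end_apply, smul_smul, mul_comm] using this.symm
  act_one := by
    intro h
    simp [Algebra.ofId_apply, Module.algebraMap_end_apply]

variable {k H R}

/-- Since ε ∘ S⁻¹ = ε, the twist in T disappears by counitality and the operator becomes plain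
rotation. The trivial action thus gives the classical b and B from the equivariant definitions. -/
lemma trivialModuleAlgebra_cyclicOp [BijectiveAntipode k H] (n : ℕ) (f : Cochain k H R n)
    (a : Fin n → R) (c : R) :
    (trivialModuleAlgebra k H R).cyclicOp n f (Fin.snoc a c) = f (Fin.cons c a) := by
  ext g
  have h0 : ∀ h : H, counit (R := k) (antipodeInv k H h) = counit (R := k) h := by
    intro h
    rw [← HopfAlgebra.counit_antipode, YetterDrinfeldAlgebra.antipode_antipodeInv]
  have h1 : (trivialModuleAlgebra k H R).cyclicOp n f (Fin.snoc a c) g = sweedler₂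
      (headMap f a ∘ₗ (trivialModuleAlgebra k H R).actOn c ∘ₗ antipodeInv k H) g := by
    simp [ModuleAlgebra.cyclicOp, MultilinearMap.uncurryRight_apply]
    rfl
  have h2 : ∀ h : H, (trivialModuleAlgebra k H R).actOn c h = counit (R := k) h • c := by
    intro h
    simp [ModuleAlgebra.actOn, trivialModuleAlgebra, Algebra.ofId_apply,
      Module.algebraMap_end_apply]
  rw [h1, sweedler₂_eq]
  have : headMap f a c (∑ i ∈ (ℛ k g).index, counit (R := k) ((ℛ k g).left i) • (ℛ k g).right i) =
      f (Fin.cons c a) g := by rw [sum_counit_smul]; rfl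
  simpa [h2, h0, map_sum] using this

/-- Subtraction in `Fin (n + 1)` is cyclic, so `0 - 1` is the last index. -/
lemma trivialModuleAlgebra_cyclicOp_apply [BijectiveAntipode k H] (n : ℕ) (f : Cochain k H R n)
    (a : Fin (n + 1) → R) :
    (trivialModuleAlgebra k H R).cyclicOp n f a = f fun i => a (i - 1) := by
  rw [← Fin.snoc_init_self a, trivialModuleAlgebra_cyclicOp, Fin.snoc_init_self]
  congr 1
  funext i
  refine Fin.cases ?_ (fun i => ?_) i
  · simp [eq_neg_of_add_eq_zero_left (Fin.last_add_one n)]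
  · rw [Fin.cons_succ, ← eq_sub_of_add_eq (Fin.coeSucc_eq_succ (a := i))]
    rfl

lemma trivialModuleAlgebra_cyclicOp_pow_apply [BijectiveAntipode k H] (n : ℕ)
    (f : Cochain k H R n) (r : ℕ) (a : Fin (n + 1) → R) :
    ((trivialModuleAlgebra k H R).cyclicOp n ^ r) f a = f fun i => a (i - r • 1) := by
  induction r generalizing a with
  | zero => simp
  | succ r ih =>
    rw [pow_succ', Module.End.mul_apply, trivialModuleAlgebra_cyclicOp_apply, ih]
    congr 1
    funext i
    congr 1
    rw [succ_nsmul, sub_sub]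

end Trivial

/-! ### Restriction to the invariant subalgebra: a map of cocyclic structures -/

namespace YetterDrinfeldAlgebra

variable {k : Type u} [Field k] {H : Type v} [Ring H] [HopfAlgebra k H]
variable {A : Type w} [Ring A] [Algebra k A] (D : YetterDrinfeldAlgebra k H A) (V : FinDimRep k H)

/-- The restriction of `ampTrace` to the invariant subalgebra. -/
def invTrace (n : ℕ) : Cochain k H A n →ₗ[k] Cochain k H (D.invariantSubalgebra V) n where
  toFun f := (ampTrace A V n f).compLinearMap fun _ => (D.invariantSubalgebra V).val.toLinearMap
  map_add' f f' := by ext; simp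
  map_smul' c f := by ext; simp

lemma invTrace_apply (n : ℕ) (f : Cochain k H A n) (x : Fin (n + 1) → D.invariantSubalgebra V) :
    D.invTrace V n f x = ampTrace A V n f fun i => (x i : A ⊗[k] Module.End k V.V) := rfl

lemma invTrace_coface (n : ℕ) (i : Fin (n + 1)) (f : Cochain k H A n) :
    D.invTrace V (n + 1) (coface k H A n i f) =
      coface k H (D.invariantSubalgebra V) n i (D.invTrace V n f) := by
  ext x : 1
  rw [invTrace_apply, ampTrace_coface]
  change ampTrace A V n f _ = ampTrace A V n f _
  congr 1
  funext j
  simp only [Fin.contractNth]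
  split_ifs <;> rfl

lemma invTrace_codegeneracy (n : ℕ) (i : Fin (n + 1)) (f : Cochain k H A (n + 1)) :
    D.invTrace V n (codegeneracy k H A n i f) =
      codegeneracy k H (D.invariantSubalgebra V) n i (D.invTrace V (n + 1) f) := by
  ext x : 1
  rw [invTrace_apply, ampTrace_codegeneracy]
  change ampTrace A V (n + 1) f _ = ampTrace A V (n + 1) f _
  congr 1
  funext j
  refine Fin.succAboveCases i.succ ?_ (fun j => ?_) j <;> simp

lemma invTrace_extraCodegeneracy (n : ℕ) (f : Cochain k H A (n + 1)) :
    D.invTrace V n (extraCodegeneracy k H A n f) =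
      extraCodegeneracy k H (D.invariantSubalgebra V) n (D.invTrace V (n + 1) f) := by
  ext x : 1
  rw [invTrace_apply, ampTrace_extraCodegeneracy]
  change ampTrace A V (n + 1) f _ = ampTrace A V (n + 1) f _
  congr 1
  funext j
  refine Fin.cases ?_ (fun j => ?_) j <;> simp

variable [BijectiveAntipode k H]

/-- This is the operator for which the restriction to invariant elements is needed; cofaces and
codegeneracies commute with the trace on all of A ⊗ End(V). -/
lemma invTrace_cyclicOp (n : ℕ) (f : Cochain k H A n) :
    D.invTrace V n (D.cyclicOp n f) =
      (trivialModuleAlgebra k H (D.invariantSubalgebra V)).cyclicOp n (D.invTrace V n f) := by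
  ext x : 1
  rw [← Fin.snoc_init_self x, trivialModuleAlgebra_cyclicOp, invTrace_apply, invTrace_apply]
  have := D.ampTrace_cyclicOp V n f (fun i => (Fin.init x i : A ⊗[k] Module.End k V.V))
    (x (Fin.last n)).2
  refine Eq.trans (congrArg _ ?_) (this.trans (congrArg _ ?_))
  · funext j
    refine Fin.lastCases ?_ (fun j => ?_) j <;> simp
  · funext j
    refine Fin.cases ?_ (fun j => ?_) j <;> simp

lemma invTrace_hochschild (n : ℕ) (f : Cochain k H A n) :
    D.invTrace V (n + 1) (D.hochschild n f) =
      (trivialModuleAlgebra k H (D.invariantSubalgebra V)).hochschild n (D.invTrace V n f) := by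
  simp only [ModuleAlgebra.hochschild, ModuleAlgebra.lastCoface, LinearMap.add_apply,
    LinearMap.sum_apply, LinearMap.smul_apply, LinearMap.comp_apply, map_add, map_sum, map_smul,
    invTrace_coface, invTrace_cyclicOp]

lemma invTrace_normOp (n : ℕ) (f : Cochain k H A n) :
    D.invTrace V n (D.normOp n f) =
      (trivialModuleAlgebra k H (D.invariantSubalgebra V)).normOp n (D.invTrace V n f) := by
  have h : ∀ r, D.invTrace V n ((D.cyclicOp n ^ r) f) =
      ((trivialModuleAlgebra k H (D.invariantSubalgebra V)).cyclicOp n ^ r)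
        (D.invTrace V n f) := by
    intro r
    induction r with
    | zero => simp
    | succ r ih => simp only [pow_succ', Module.End.mul_apply, invTrace_cyclicOp, ih]
  simp only [ModuleAlgebra.normOp, LinearMap.sum_apply, LinearMap.smul_apply, map_sum, map_smul, h]

lemma invTrace_connesB (n : ℕ) (f : Cochain k H A (n + 1)) :
    D.invTrace V n (D.connesB n f) =
      (trivialModuleAlgebra k H (D.invariantSubalgebra V)).connesB n (D.invTrace V (n + 1) f) := by
  simp only [ModuleAlgebra.connesB, LinearMap.comp_apply, LinearMap.sub_apply, LinearMap.id_apply,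
    LinearMap.smul_apply, invTrace_normOp, invTrace_extraCodegeneracy, map_sub, map_smul,
    invTrace_cyclicOp]

end YetterDrinfeldAlgebra
end
end EquivariantCyclic

namespace EquivariantCyclic
noncomputable section

/-! ### Polynomial families -/

section Polynomial

open Polynomial

variable {k : Type u} [Field k]

/-- The conjugates of an idempotent vary quadratically in the parameter. This isolates the
coefficient of s, the Leibniz sum, and leaves the rest as s² times a polynomial. -/
lemma multilinear_expand {M : Type*} [AddCommGroup M] [Module k M] {m : ℕ}
    (F : MultilinearMap k (fun _ : Fin m => M) k) (a b c : Fin m → M) :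
    ∃ Q : k[X], ∀ s : k, F (fun i => a i + s • b i + s ^ 2 • c i) =
      F a + s * ∑ i, F (Function.update a i (b i)) + s ^ 2 * Q.eval s := by
  induction m with
  | zero =>
    refine ⟨0, fun s => ?_⟩
    simp [Subsingleton.elim (fun i => a i + s • b i + s ^ 2 • c i) a]
  | succ m ih =>
    obtain ⟨Q₀, h₀⟩ := ih (F.curryLeft (a 0)) (Fin.tail a) (Fin.tail b) (Fin.tail c)
    obtain ⟨Q₁, h₁⟩ := ih (F.curryLeft (b 0)) (Fin.tail a) (Fin.tail b) (Fin.tail c)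
    obtain ⟨Q₂, h₂⟩ := ih (F.curryLeft (c 0)) (Fin.tail a) (Fin.tail b) (Fin.tail c)
    -- Everything of order at least two, when the first argument and the tail are expanded
    -- separately and multiplied out.
    refine ⟨Q₀ + C (∑ i, F.curryLeft (b 0) (Function.update (Fin.tail a) i (Fin.tail b i))) +
      X * Q₁ + C (F.curryLeft (c 0) (Fin.tail a)) + X * C (∑ i, F.curryLeft (c 0)
        (Function.update (Fin.tail a) i (Fin.tail b i))) + X ^ 2 * Q₂, fun s => ?_⟩
    have e : (fun i => a i + s • b i + s ^ 2 • c i) = Fin.cons (a 0 + s • b 0 + s ^ 2 • c 0)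
        (fun i => Fin.tail a i + s • Fin.tail b i + s ^ 2 • Fin.tail c i) := by
      funext i
      refine Fin.cases ?_ (fun i => ?_) i <;> simp [Fin.tail]
    have h3 := h₀ s
    have h4 := h₁ s
    have h5 := h₂ s
    have h6 : F (Function.update a 0 (b 0)) = F.curryLeft (b 0) (Fin.tail a) := by
      rw [MultilinearMap.curryLeft_apply]
      conv_lhs => rw [← Fin.cons_self_tail a, Fin.update_cons_zero]
    have h7 : ∀ i : Fin m, F (Function.update a i.succ (b i.succ)) =
        F.curryLeft (a 0) (Function.update (Fin.tail a) i (Fin.tail b i)) := by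
      intro i
      rw [MultilinearMap.curryLeft_apply]
      conv_lhs => rw [← Fin.cons_self_tail a, ← Fin.cons_update]
      rfl
    have h8 : F a = F.curryLeft (a 0) (Fin.tail a) := by
      rw [MultilinearMap.curryLeft_apply, Fin.cons_self_tail]
    rw [e, MultilinearMap.cons_add, MultilinearMap.cons_add, MultilinearMap.cons_smul,
      MultilinearMap.cons_smul, Fin.sum_univ_succ, h6, h8]
    simp only [h7]
    simp only [MultilinearMap.curryLeft_apply] at h3 h4 h5 ⊢
    rw [h3, h4, h5]
    simp only [eval_add, eval_mul, eval_C, eval_X, eval_pow, smul_eq_mul]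
    ring

/-- The hypothesis at 0 shows that p is a polynomial, and at a general t that its derivative
vanishes there. In characteristic 0 a polynomial with zero derivative is constant. -/
lemma eq_of_second_order [CharZero k] {p : k → k}
    (h : ∀ t, ∃ Q : k[X], ∀ s, p (t + s) = p t + s ^ 2 * Q.eval s) (t : k) : p t = p 0 := by
  obtain ⟨Q₀, h₀⟩ := h 0
  let P : k[X] := C (p 0) + X ^ 2 * Q₀
  have hP : ∀ s, p s = P.eval s := by
    intro s
    have := h₀ s
    rw [zero_add] at this
    simp [P, this]
  have hd : P.derivative = 0 := by
    refine Polynomial.funext fun t => ?_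
    obtain ⟨Q, hQ⟩ := h t
    have h1 : P.comp (C t + X) = C (P.eval t) + X ^ 2 * Q := by
      refine Polynomial.funext fun s => ?_
      simp only [eval_comp, eval_add, eval_C, eval_X, eval_mul, eval_pow]
      rw [← hP, ← hP, hQ]
    have h2 := congrArg (fun q => (derivative q).eval 0) h1
    simpa [derivative_comp] using h2
  have h3 := derivative_eq_zero.1 hd
  rw [hP, hP, eq_C_of_natDegree_eq_zero h3]
  simp

end Polynomial

/-! ### Conjugation by unipotent elements -/

section Conjugation

variable {k : Type u} [Field k] {R : Type*} [Ring R] [Algebra k R]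

/-- The element `(1 + t γ) x (1 - t γ)`. -/
def shear (γ x : R) (t : k) : R := (1 + t • γ) * x * (1 - t • γ)

lemma shear_zero (γ x : R) : shear γ x (0 : k) = x := by simp [shear]

/-- As γ² = 0, the elements 1 + tγ form a one-parameter group with inverses 1 - tγ. The expansion at
t is therefore that at 0 applied to the conjugated element, with the commutator with γ as linear
coefficient. -/
lemma shear_add {γ : R} (hγ : γ * γ = 0) (x : R) (t s : k) : shear γ x (t + s) = shear γ x t +
    s • (γ * shear γ x t - shear γ x t * γ) + s ^ 2 • (-(γ * shear γ x t * γ)) := by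
  have h1 : (1 + (t + s) • γ) = (1 + s • γ) * (1 + t • γ) := by
    simp [mul_add, add_mul, hγ, add_smul]; abel
  have h2 : (1 - (t + s) • γ) = (1 - t • γ) * (1 - s • γ) := by
    simp [mul_sub, sub_mul, hγ, add_smul]; abel
  have h3 : shear γ x (t + s) = (1 + s • γ) * shear γ x t * (1 - s • γ) := by
    rw [shear, h1, h2, shear]; simp only [mul_assoc]
  rw [h3]
  simp only [mul_sub, add_mul, one_mul, mul_one, smul_mul_assoc, mul_smul_comm, smul_sub, pow_two,
    mul_smul, smul_neg, smul_add]
  abel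

lemma shear_mul {γ : R} (hγ : γ * γ = 0) (x y : R) (t : k) :
    shear γ x t * shear γ y t = shear γ (x * y) t := by
  have h : (1 - t • γ) * (1 + t • γ) = 1 := by simp [mul_add, sub_mul, hγ]
  simp only [shear]
  rw [mul_assoc, mul_assoc, ← mul_assoc (1 - t • γ) (_ * _), ← mul_assoc (1 - t • γ) (1 + t • γ), h]
  simp only [mul_assoc, one_mul]

lemma shear_sub_smul_one {γ : R} (hγ : γ * γ = 0) (x : R) (c t : k) :
    shear γ (x - c • 1) t = shear γ x t - c • 1 := by
  have h : (1 + t • γ) * (1 - t • γ) = 1 := by simp [mul_sub, add_mul, hγ]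
  simp only [shear, mul_sub (1 + t • γ) x, sub_mul _ _ (1 - t • γ)]
  rw [mul_smul_comm, mul_one, smul_mul_assoc, h]

end Conjugation

/-! ### Evaluation of the coboundary on words -/

section Words

variable {R : Type*}

/-- The word with the letters `z` in position `0`, `c` in position `p` and `e` elsewhere. -/
def word (e z : R) (p : ℕ) (c : R) {n : ℕ} : Fin n → R :=
  fun j => if (j : ℕ) = 0 then z else if (j : ℕ) = p then c else e

lemma word_self (e z : R) (p q : ℕ) {n : ℕ} : (word e z p e : Fin n → R) = word e z q e := by
  funext j; simp [word]

lemma word_const (e : R) (p : ℕ) {n : ℕ} : (word e e p e : Fin n → R) = fun _ => e := by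
  funext j; simp [word]

lemma cons_const_eq_word (e z : R) (p : ℕ) {n : ℕ} :
    (Fin.cons z fun _ => e : Fin (n + 1) → R) = word e z p e := by
  funext j
  refine Fin.cases ?_ (fun j => ?_) j <;> simp [word]

-- Merging two letters e to the left of c shortens the prefix, so c moves one place left; merging to
-- the right of c leaves the word's shape unchanged. Only the merges involving z or c produce a new
-- letter.
set_option maxHeartbeats 1600000 in
lemma contractNth_word [Ring R] {e : R} (he : e * e = e) (z : R) (p : ℕ) (hp : 1 ≤ p) (c : R) {n : ℕ}
    (j : Fin (n + 1)) :
    Fin.contractNth j.castSucc (· * ·) (word e z p c : Fin (n + 2) → R) =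
      if (j : ℕ) = 0 then if p = 1 then word e (z * c) 1 e else word e (z * e) (p - 1) c
      else if (j : ℕ) + 1 < p then word e z (p - 1) c
      else if (j : ℕ) + 1 = p then word e z (p - 1) (e * c)
      else if (j : ℕ) = p then word e z p (c * e) else word e z p c := by
  funext l
  have hl := l.2
  have hj := j.2
  simp only [ite_apply, Fin.contractNth, word, Fin.val_castSucc, Fin.val_succ]
  split_ifs <;> first | contradiction | exact he | omega | with_reducible rfl

end Words

section Trivial

variable {k : Type u} [Field k] {H : Type v} [Ring H] [HopfAlgebra k H] [BijectiveAntipode k H]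
variable {R : Type*} [Ring R] [Algebra k R]

lemma trivialModuleAlgebra_lastCoface_word (n : ℕ) (f : Cochain k H R n) (e z : R) (p : ℕ)
    (c : R) :
    (trivialModuleAlgebra k H R).lastCoface n f (word e z p c) =
      if p = n + 1 then f (word e (c * z) 1 e) else f (word e (e * z) p c) := by
  rw [ModuleAlgebra.lastCoface, LinearMap.comp_apply, ← Fin.snoc_init_self (word e z p c),
    trivialModuleAlgebra_cyclicOp]
  rw [← apply_ite f]
  change f _ = f _
  congr 1
  funext j
  refine Fin.cases ?_ (fun j => ?_) j
  · by_cases h : p = n + 1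
    · simp [h, Fin.contractNth, word, Fin.init]
    · simp [h, Ne.symm h, Fin.contractNth, word, Fin.init]
  · have h1 : ∀ (x : R) (y : Fin (n + 1) → R), Fin.contractNth (Fin.castSucc 0) (· * ·)
        (Fin.cons x y : Fin (n + 2) → R) j.succ = y j.succ := fun x y => by
      rw [Fin.contractNth_apply_of_gt _ _ _ _ (by simp), Fin.cons_succ]
    have hj := j.2
    rw [h1]
    simp only [ite_apply, word, Fin.init, Fin.val_castSucc, Fin.val_succ]
    split_ifs <;> first | contradiction | omega | with_reducible rfl

end Trivial

end
end EquivariantCyclic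

/-! ### Alternating sums and the homotopy formula -/

namespace EquivariantCyclic
noncomputable section

section AlternatingSums

variable {k : Type u} [Field k]

lemma sum_neg_one_pow_succ (n : ℕ) :
    ∑ j ∈ Finset.range n, (-1 : k) ^ (j + 1) = if Even n then 0 else -1 := by
  simp only [pow_succ, ← Finset.sum_mul, neg_one_geom_sum]
  split_ifs <;> simp

/-- Accounts for the cofaces up to the marked letter: x from the first merge, y from the merges e·e,
which cancel up to parity, and w from e·c. -/
lemma sum_neg_one_pow_mul_prefix (x y w : k) (i : ℕ) :
    ∑ j ∈ Finset.range (i + 2), (-1 : k) ^ j * (if j = 0 then x else if j < i + 1 then y else w) =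
      x - (if Even i then 0 else y) + (-1) ^ (i + 1) * w := by
  rw [Finset.sum_range_succ, Finset.sum_range_succ']
  have h : ∑ j ∈ Finset.range i, (-1 : k) ^ (j + 1) *
      (if j + 1 = 0 then x else if j + 1 < i + 1 then y else w) =
        ∑ j ∈ Finset.range i, (-1 : k) ^ (j + 1) * y := by
    refine Finset.sum_congr rfl fun j hj => ?_
    rw [Finset.mem_range] at hj
    rw [if_neg (by omega), if_pos (by omega)]
  rw [h, ← Finset.sum_mul, sum_neg_one_pow_succ]
  split_ifs <;> simp_all
  ring

/-- Accounts for the cofaces after the marked letter: x from c·e, then equal values y that cancel up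
to parity. -/
lemma sum_neg_one_pow_mul_suffix (x y : k) (i n : ℕ) (hn : Even n) (hi : i < n) :
    ∑ j ∈ Finset.range (n - i), (-1 : k) ^ (i + 1 + j) * (if j = 0 then x else y) =
      -((-1) ^ i * x) + if Even i then y else 0 := by
  obtain ⟨c, hc⟩ : ∃ c, n - i = c + 1 := ⟨n - i - 1, by omega⟩
  rw [hc, Finset.sum_range_succ']
  simp only [Nat.add_eq_zero_iff, one_ne_zero, and_false, if_false, if_true, add_zero, pow_add]
  rw [← Finset.sum_mul, ← Finset.mul_sum]
  have h1 : ∑ j ∈ Finset.range c, (-1 : k) ^ j * (-1) ^ 1 = if Even c then 0 else -1 := by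
    rw [← sum_neg_one_pow_succ]; simp [pow_succ]
  rw [h1]
  have hpar : Even c ↔ ¬ Even i := by
    rcases hn with ⟨m, rfl⟩
    rw [Nat.even_iff, Nat.even_iff]
    omega
  by_cases he : Even i
  · simp [hpar, he, he.neg_one_pow]; ring
  · simp [hpar, he, (Nat.not_even_iff_odd.1 he).neg_one_pow]

end AlternatingSums

section Trivial

variable {k : Type u} [Field k] {H : Type v} [Ring H] [HopfAlgebra k H] [BijectiveAntipode k H]
variable {R : Type*} [Ring R] [Algebra k R]

lemma trivialModuleAlgebra_hochschild_word (n : ℕ) (f : Cochain k H R n) {e : R} (he : e * e = e)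
    (z : R) (p : ℕ) (hp : 1 ≤ p) (c : R) (g : H) :
    (trivialModuleAlgebra k H R).hochschild n f (word e z p c) g =
      (∑ j ∈ Finset.range (n + 1), (-1 : k) ^ j *
        (if j = 0 then if p = 1 then f (word e (z * c) 1 e) g else f (word e (z * e) (p - 1) c) g
        else if j + 1 < p then f (word e z (p - 1) c) g
        else if j + 1 = p then f (word e z (p - 1) (e * c)) g
        else if j = p then f (word e z p (c * e)) g else f (word e z p c) g)) +
      (-1) ^ (n + 1) *
        if p = n + 1 then f (word e (c * z) 1 e) g else f (word e (e * z) p c) g := by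
  rw [ModuleAlgebra.hochschild, LinearMap.add_apply, LinearMap.sum_apply, add_apply, sum_apply,
    LinearMap.add_apply, LinearMap.sum_apply]
  congr 1
  · rw [← Fin.sum_univ_eq_sum_range (fun j => (-1 : k) ^ j *
        (if j = 0 then if p = 1 then f (word e (z * c) 1 e) g else f (word e (z * e) (p - 1) c) g
        else if j + 1 < p then f (word e z (p - 1) c) g
        else if j + 1 = p then f (word e z (p - 1) (e * c)) g
        else if j = p then f (word e z p (c * e)) g else f (word e z p c) g)) (n + 1)]
    refine Finset.sum_congr rfl fun j _ => ?_
    have h : coface k H R n j f (word e z p c) =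
      f (Fin.contractNth j.castSucc (· * ·) (word e z p c : Fin (n + 2) → R)) := rfl
    rw [LinearMap.smul_apply, smul_apply, LinearMap.smul_apply, smul_eq_mul, h,
      contractNth_word he z p hp c j]
    congr 1
    split_ifs <;> rfl
  · rw [LinearMap.smul_apply, smul_apply, LinearMap.smul_apply, smul_eq_mul,
      trivialModuleAlgebra_lastCoface_word n f e z p]
    congr 1
    split_ifs <;> rfl

/-- The homotopy formula for the inner derivation of `γ`. -/
lemma sum_hochschild_word (N : ℕ) (f : Cochain k H R (2 * N)) {e : R} (he : e * e = e) {z : R}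
    (hz : e * z = z * e) (c : R) (g : H) :
    ∑ i ∈ Finset.range (2 * N + 1), (-1 : k) ^ i *
        (trivialModuleAlgebra k H R).hochschild (2 * N) f (word e z (i + 1) c) g =
      f (word e (z * c) 1 e) g - f (word e (c * z) 1 e) g +
      ∑ m ∈ Finset.range (2 * N), (f (word e z (m + 1) (e * c)) g -
        f (word e z (m + 1) (c * e)) g) +
      ∑ m ∈ Finset.range (2 * N), (-1 : k) ^ m * (f (word e z (m + 1) c) g -
        2 * f (word e (z * e) (m + 1) c) g) := by
  set u : ℕ → k := fun m => f (word e z (m + 1) c) g with hu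
  set v : ℕ → k := fun m => f (word e (z * e) (m + 1) c) g with hv
  set p : ℕ → k := fun m => f (word e z (m + 1) (e * c)) g with hp
  set q : ℕ → k := fun m => f (word e z (m + 1) (c * e)) g with hq
  set α : k := f (word e (z * c) 1 e) g with hα
  set β : k := f (word e (c * z) 1 e) g with hβ
  -- Each coboundary splits into the cofaces up to the marked letter, those after it, and the last
  -- coface. At i = 0 the prefix is the single merge z·c; at i = 2N there is no suffix and the last
  -- coface is c·z.
  have hpre : ∀ i, i ≤ 2 * N → (trivialModuleAlgebra k H R).hochschild (2 * N) f
      (word e z (i + 1) c) g = (if i = 0 then α else v (i - 1) -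
        (if Even (i - 1) then 0 else u (i - 1)) + (-1) ^ i * p (i - 1)) +
      (if i = 2 * N then 0 else -((-1) ^ i * q i) + if Even i then u i else 0) -
      (if i = 2 * N then β else v i) := by
    intro i hi
    rw [trivialModuleAlgebra_hochschild_word (2 * N) f he z (i + 1) (by omega) c g,
      sub_eq_add_neg]
    congr 1
    · have hsplit : 2 * N + 1 = (i + 1) + (2 * N - i) := by omega
      refine (congrArg (fun r => Finset.sum (Finset.range r) _) hsplit).trans ?_
      rw [Finset.sum_range_add]
      congr 1
      · rcases Nat.eq_zero_or_pos i with rfl | hi0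
        · simp [hα]
        · obtain ⟨l, rfl⟩ : ∃ l, i = l + 1 := ⟨i - 1, by omega⟩
          simp only [Nat.add_sub_cancel, Nat.add_eq_zero_iff, one_ne_zero, and_false, if_false]
          refine Eq.trans ?_ (sum_neg_one_pow_mul_prefix (v l) (u l) (p l) l)
          refine Finset.sum_congr rfl fun j hj => ?_
          rw [Finset.mem_range] at hj
          congr 1
          split_ifs <;> first | contradiction | omega | rfl
      · by_cases h : i = 2 * N
        · simp [h]
        · rw [if_neg h, ← sum_neg_one_pow_mul_suffix (q i) (u i) i (2 * N) (even_two_mul N)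
            (by omega)]
          refine Finset.sum_congr rfl fun j hj => ?_
          congr 1
          split_ifs <;> first | contradiction | omega | rfl
    · have h1 : (-1 : k) ^ (2 * N + 1) = -1 := (odd_two_mul_add_one N).neg_one_pow
      rw [h1, neg_one_mul]
      congr 1
      simp only [Nat.add_right_cancel_iff, hv, hz]
      rfl
  rw [Finset.sum_congr rfl fun i hi => by
    rw [hpre i (by rw [Finset.mem_range] at hi; omega)]]
  simp only [mul_sub, mul_add, Finset.sum_add_distrib, Finset.sum_sub_distrib]
  have h1 : ∑ i ∈ Finset.range (2 * N + 1), (-1 : k) ^ i * (if i = 0 then α else v (i - 1) -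
        (if Even (i - 1) then 0 else u (i - 1)) + (-1) ^ i * p (i - 1)) =
      α + ∑ m ∈ Finset.range (2 * N), (-(-1 : k) ^ m * v m + (if Even m then 0 else (-1) ^ m * u m)
        + p m) := by
    rw [Finset.sum_range_succ', add_comm]
    congr 1
    · simp
    · refine Finset.sum_congr rfl fun m _ => ?_
      rw [if_neg (by omega), Nat.add_sub_cancel]
      have : (-1 : k) ^ (m + 1) * ((-1) ^ (m + 1) * p m) = p m := by
        rw [← mul_assoc, ← mul_pow]; simp
      rw [mul_add, this, pow_succ]
      split_ifs <;> ring
  have h2 : ∑ i ∈ Finset.range (2 * N + 1), (-1 : k) ^ i *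
      (if i = 2 * N then 0 else -((-1) ^ i * q i) + if Even i then u i else 0) =
      ∑ m ∈ Finset.range (2 * N), (-q m + if Even m then (-1 : k) ^ m * u m else 0) := by
    rw [Finset.sum_range_succ, if_pos rfl, mul_zero, add_zero]
    refine Finset.sum_congr rfl fun m hm => ?_
    rw [Finset.mem_range] at hm
    rw [if_neg (by omega)]
    have : (-1 : k) ^ m * (-((-1) ^ m * q m)) = - q m := by
      rw [mul_neg, ← mul_assoc, ← mul_pow]; simp
    rw [mul_add, this]
    split_ifs <;> ring
  have h3 : ∑ i ∈ Finset.range (2 * N + 1), (-1 : k) ^ i * (if i = 2 * N then β else v i) =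
      β + ∑ m ∈ Finset.range (2 * N), (-1 : k) ^ m * v m := by
    rw [Finset.sum_range_succ, if_pos rfl, (even_two_mul N).neg_one_pow, one_mul, add_comm]
    congr 1
    refine Finset.sum_congr rfl fun m hm => ?_
    rw [Finset.mem_range] at hm
    rw [if_neg (by omega)]
  rw [h1, h2, h3]
  -- Each u m survives exactly once: from the suffix for even m and from the prefix of the next word
  -- for odd m. Each v m occurs twice, once from z·e and once from e·z, which agree because e and z
  -- commute.
  have h5 : ∀ m, (-(-1 : k) ^ m * v m + (if Even m then 0 else (-1) ^ m * u m) + p m) +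
      (-q m + if Even m then (-1 : k) ^ m * u m else 0) - (-1 : k) ^ m * v m =
      (p m - q m) + ((-1 : k) ^ m * u m - (-1 : k) ^ m * (2 * v m)) := by
    intro m
    split_ifs <;> ring
  have h6 := Finset.sum_congr (rfl : Finset.range (2 * N) = _) fun m _ => h5 m
  simp only [Finset.sum_add_distrib, Finset.sum_sub_distrib] at h6 ⊢
  linear_combination h6

end Trivial

end
end EquivariantCyclic

/-! ### First-order variation under unipotent conjugation -/

namespace EquivariantCyclic
noncomputable section

section WordLinear

lemma update_word_zero {R : Type*} (e z x : R) (p : ℕ) (c : R) {n : ℕ} :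
    Function.update (word e z p c : Fin (n + 1) → R) 0 x = word e x p c := by
  funext j
  refine Fin.cases ?_ (fun j => ?_) j <;> simp [word]

lemma update_word_succ {R : Type*} (e z : R) (m : ℕ) (c x : R) {n : ℕ} (hm : m < n) :
    Function.update (word e z (m + 1) c : Fin (n + 1) → R) (Fin.succ ⟨m, hm⟩) x =
      word e z (m + 1) x := by
  funext j
  refine Fin.cases ?_ (fun j => ?_) j
  · simp [word]
  · simp only [word, Function.update_apply, Fin.ext_iff, Fin.val_succ]
    split_ifs <;> first | contradiction | omega | rfl

variable {k : Type u} [Field k] {R : Type*} [Ring R] [Algebra k R]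
variable {X : Type*} [AddCommGroup X] [Module k X]

lemma map_word_sub {n : ℕ} (f : MultilinearMap k (fun _ : Fin (n + 1) => R) X) (e x y : R) (p : ℕ)
    (c : R) : f (word e (x - y) p c) = f (word e x p c) - f (word e y p c) := by
  rw [← update_word_zero e 0 (x - y), f.map_update_sub, update_word_zero, update_word_zero]

lemma map_word_smul {n : ℕ} (f : MultilinearMap k (fun _ : Fin (n + 1) => R) X) (e x : R) (r : k)
    (p : ℕ) (c : R) : f (word e (r • x) p c) = r • f (word e x p c) := by
  rw [← update_word_zero e 0 (r • x), f.map_update_smul, update_word_zero]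

lemma map_word_letter_sub {n : ℕ} (f : MultilinearMap k (fun _ : Fin (n + 1) => R) X) (e z : R)
    (m : ℕ) (hm : m < n) (x y : R) :
    f (word e z (m + 1) (x - y)) = f (word e z (m + 1) x) - f (word e z (m + 1) y) := by
  rw [← update_word_succ e z m 0 (x - y) hm, f.map_update_sub, update_word_succ, update_word_succ]

/-- First-order expansion of a multilinear map along the family of words in `shear γ e t` and
`shear γ z t`. -/
lemma exists_expand_word_shear {n : ℕ} (F : MultilinearMap k (fun _ : Fin (n + 1) => R) k)
    {γ : R} (hγ : γ * γ = 0) (e z : R) (t : k) : ∃ Q : Polynomial k, ∀ s : k,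
      F (word (shear γ e (t + s)) (shear γ z (t + s)) 1 (shear γ e (t + s))) =
      F (word (shear γ e t) (shear γ z t) 1 (shear γ e t)) + s *
        (F (word (shear γ e t) (γ * shear γ z t) 1 (shear γ e t)) -
          F (word (shear γ e t) (shear γ z t * γ) 1 (shear γ e t)) +
        ∑ m ∈ Finset.range n,
          (F (word (shear γ e t) (shear γ z t) (m + 1) (γ * shear γ e t)) -
            F (word (shear γ e t) (shear γ z t) (m + 1) (shear γ e t * γ)))) +
      s ^ 2 * Q.eval s := by
  set e' := shear γ e t
  set z' := shear γ z t
  obtain ⟨Q, hQ⟩ := multilinear_expand F (word e' z' 1 e')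
    (word (γ * e' - e' * γ) (γ * z' - z' * γ) 1 (γ * e' - e' * γ))
    (word (-(γ * e' * γ)) (-(γ * z' * γ)) 1 (-(γ * e' * γ)))
  refine ⟨Q, fun s => ?_⟩
  have h1 : (word (shear γ e (t + s)) (shear γ z (t + s)) 1 (shear γ e (t + s)) :
      Fin (n + 1) → R) = fun i => (word e' z' 1 e' : Fin (n + 1) → R) i +
        s • (word (γ * e' - e' * γ) (γ * z' - z' * γ) 1 (γ * e' - e' * γ) : Fin (n + 1) → R) i +
        s ^ 2 • (word (-(γ * e' * γ)) (-(γ * z' * γ)) 1 (-(γ * e' * γ)) : Fin (n + 1) → R) i := by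
    funext i
    refine Fin.cases ?_ (fun i => ?_) i <;> simp only [word] <;> simp [shear_add hγ, e', z']
  rw [h1, hQ s, Fin.sum_univ_succ]
  refine congrArg (fun x => F (word e' z' 1 e') + s * x + s ^ 2 * Q.eval s)
    (congrArg₂ (· + ·) ?_ ?_)
  · rw [← map_word_sub, update_word_zero]
    rfl
  · rw [← Fin.sum_univ_eq_sum_range (fun m => F (word e' z' (m + 1) (γ * e')) -
      F (word e' z' (m + 1) (e' * γ))) n]
    refine Finset.sum_congr rfl fun m _ => ?_
    rw [← map_word_letter_sub F e' z' m m.2, word_self e' z' 1 (m + 1)]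
    have : (word (γ * e' - e' * γ) (γ * z' - z' * γ) 1 (γ * e' - e' * γ) : Fin (n + 1) → R) m.succ
        = γ * e' - e' * γ := by simp [word]
    rw [this]
    exact congrArg F (update_word_succ e' z' m e' _ m.2)

end WordLinear

section Trivial

variable {k : Type u} [Field k] {H : Type v} [Ring H] [HopfAlgebra k H] [BijectiveAntipode k H]
variable {R : Type*} [Ring R] [Algebra k R]

/-- The Leibniz terms in the first-order coefficient are the inner derivation terms of
`sum_hochschild_word` with opposite sign, so they can be exchanged for coboundary values and an
alternating sum. The first letter z stays general to allow both e and e - 1/2. -/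
lemma exists_expand_cochain (N : ℕ) (f : Cochain k H R (2 * N)) {γ : R} (hγ : γ * γ = 0) {e z : R}
    (he : e * e = e) (hz : e * z = z * e) (g : H) (t : k) : ∃ Q : Polynomial k, ∀ s : k,
      f (word (shear γ e (t + s)) (shear γ z (t + s)) 1 (shear γ e (t + s))) g =
      f (word (shear γ e t) (shear γ z t) 1 (shear γ e t)) g + s *
        (∑ m ∈ Finset.range (2 * N), (-1 : k) ^ m *
          (f (word (shear γ e t) (shear γ z t) (m + 1) γ) g -
            2 * f (word (shear γ e t) (shear γ z t * shear γ e t) (m + 1) γ) g) -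
        ∑ i ∈ Finset.range (2 * N + 1), (-1 : k) ^ i *
          (trivialModuleAlgebra k H R).hochschild (2 * N) f
            (word (shear γ e t) (shear γ z t) (i + 1) γ) g) + s ^ 2 * Q.eval s := by
  obtain ⟨Q, hQ⟩ := exists_expand_word_shear ((LinearMap.applyₗ g).compMultilinearMap f) hγ e z t
  refine ⟨Q, fun s => (hQ s).trans ?_⟩
  have he' : shear γ e t * shear γ e t = shear γ e t := by rw [shear_mul hγ, he]
  have hz' : shear γ e t * shear γ z t = shear γ z t * shear γ e t := by
    rw [shear_mul hγ, shear_mul hγ, hz]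
  have h1 := sum_hochschild_word N f he' hz' γ g
  simp only [LinearMap.compMultilinearMap_apply, LinearMap.applyₗ_apply_apply]
  rw [h1]
  simp only [Finset.sum_sub_distrib]
  ring

/-- A cyclic cocycle takes the same value on an idempotent and on its conjugates by unipotent
elements. -/
lemma cyclicCocycle_shear [CharZero k] (N : ℕ) {f : Cochain k H R (2 * N)}
    (hf : (trivialModuleAlgebra k H R).cyclicOp (2 * N) f = f)
    (hb : (trivialModuleAlgebra k H R).hochschild (2 * N) f = 0) {γ : R} (hγ : γ * γ = 0) {e : R}
    (he : e * e = e) (g : H) (t : k) :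
    f (fun _ => shear γ e t) g = f (fun _ => e) g := by
  have h := eq_of_second_order (p := fun t => f (fun _ => shear γ e t) g) ?_ t
  · simpa [shear_zero] using h
  intro t
  obtain ⟨Q, hQ⟩ := exists_expand_cochain N f hγ he rfl g t
  refine ⟨Q, fun s => ?_⟩
  have hs := hQ s
  set e' := shear γ e t with he'
  have hee : e' * e' = e' := by rw [he', shear_mul hγ, he]
  simp only [word_const, hb, hee] at hs
  rw [hs]
  -- In even degree T fixes f without sign, so the value does not depend on the position of γ. The
  -- alternating sum over an even number of positions is then zero.
  have hrot : ∀ m, m < 2 * N → f (word e' e' (m + 1) γ) g = f (word e' e' 1 γ) g := by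
    intro m
    induction m with
    | zero => intro _; rfl
    | succ m ih =>
      intro hm
      have hT := congrArg (fun F => F (word e' e' (m + 1) γ) g) hf
      simp only [trivialModuleAlgebra_cyclicOp_apply] at hT
      rw [← ih (by omega), ← hT]
      congr 2
      funext j
      refine Fin.cases ?_ (fun j => ?_) j
      · have h0 : ((0 - 1 : Fin (2 * N + 1)) : ℕ) = 2 * N := by
          rw [zero_sub, ← eq_neg_of_add_eq_zero_left (Fin.last_add_one _)]
          rfl
        simp only [word, h0]
        rw [Fin.val_zero, if_pos rfl, if_neg (by omega : ¬ 2 * N = 0), if_neg (by omega)]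
      · rw [← eq_sub_of_add_eq (Fin.coeSucc_eq_succ (a := j))]
        simp only [word, Fin.val_succ, Fin.val_castSucc]
        split_ifs <;> first | contradiction | omega | rfl
  have hsum : ∑ m ∈ Finset.range (2 * N), (-1 : k) ^ m * (f (word e' e' (m + 1) γ) g -
      2 * f (word e' e' (m + 1) γ) g) = 0 := by
    rw [Finset.sum_congr rfl fun m hm => by rw [hrot m (Finset.mem_range.1 hm)], ← Finset.sum_mul,
      neg_one_geom_sum, if_pos (even_two_mul N), zero_mul]
  rw [hsum]
  simp

end Trivial

end
end EquivariantCyclic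

/-! ### Normalized cochains and Connes' operator on words -/

namespace EquivariantCyclic
noncomputable section

section Normalized

open Fin.CommRing in
lemma nsmul_one_fin {n : ℕ} (r : Fin (n + 1)) : (r : ℕ) • (1 : Fin (n + 1)) = r :=
  (nsmul_one (A := Fin (n + 1)) (r : ℕ)).trans (Fin.cast_val_eq_self r)

lemma word_self_eq_update {R : Type*} (e c : R) {n : ℕ} (p : Fin n) :
    (word e e (p + 1) c : Fin (n + 1) → R) = Function.update (fun _ => e) p.succ c := by
  funext j
  simp only [word, Function.update_apply, Fin.ext_iff, Fin.val_succ]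
  split_ifs <;> first | omega | rfl

lemma cons_update_const_eq_word {R : Type*} (e x c : R) {n : ℕ} (q : Fin n) :
    (Fin.cons x (Function.update (fun _ => e) q c) : Fin (n + 1) → R) = word e x (q + 1) c := by
  funext j
  refine Fin.cases ?_ (fun j => ?_) j <;> simp [word, Function.update_apply, Fin.ext_iff]

variable {k : Type u} [Field k] {H : Type v} [Ring H] [HopfAlgebra k H]
variable {R : Type*} [Ring R] [Algebra k R]

/-- The codegeneracies insert 1 in positive positions only; a 1 in position 0 need not kill the
value. -/
lemma apply_eq_zero_of_codegeneracy {n : ℕ} {ψ : Cochain k H R (n + 1)}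
    (hψ : ∀ i, codegeneracy k H R n i ψ = 0) (a : Fin (n + 2) → R) (i : Fin (n + 1))
    (ha : a i.succ = 1) : ψ a = 0 := by
  have h := congrArg (fun F => F (i.succ.removeNth a)) (hψ i)
  rw [← Fin.insertNth_self_removeNth i.succ a, ha]
  exact h

variable [BijectiveAntipode k H]

/-- In the second summand of B the inserted 1 is rotated into position 1, where normalization kills
it. Hence B reduces to Nσ. -/
lemma trivialModuleAlgebra_connesB_apply {n : ℕ} {ψ : Cochain k H R (n + 1)}
    (hψ : ∀ i, codegeneracy k H R n i ψ = 0) (a : Fin (n + 1) → R) (g : H) :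
    (trivialModuleAlgebra k H R).connesB n ψ a g =
      ∑ r : Fin (n + 1), (-1 : k) ^ ((r : ℕ) * n) *
        ψ (Fin.cons 1 fun i => a (i - r)) g := by
  have h1 : extraCodegeneracy k H R n ((trivialModuleAlgebra k H R).cyclicOp (n + 1) ψ) = 0 := by
    ext1 x
    change (trivialModuleAlgebra k H R).cyclicOp (n + 1) ψ (Fin.cons 1 x) = 0
    rw [trivialModuleAlgebra_cyclicOp_apply]
    refine apply_eq_zero_of_codegeneracy hψ _ 0 ?_
    simp
  simp only [ModuleAlgebra.connesB, LinearMap.comp_apply, LinearMap.sub_apply, LinearMap.id_apply,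
    LinearMap.smul_apply, map_sub, map_smul, h1, smul_zero, sub_zero, ModuleAlgebra.normOp,
    LinearMap.sum_apply, sum_apply, smul_apply,
    trivialModuleAlgebra_cyclicOp_pow_apply, smul_eq_mul]
  rw [← Fin.sum_univ_eq_sum_range (fun r => (-1 : k) ^ (r * n) *
    (extraCodegeneracy k H R n ψ (fun i => a (i - r • 1))) g)]
  refine Finset.sum_congr rfl fun r _ => ?_
  have h2 : (r : ℕ) • (1 : Fin (n + 1)) = r := nsmul_one_fin r
  rw [h2]
  rfl

/-- Every term of Nσ has its own 1 in front, so a 1 among the arguments always lands in a positive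
position. In particular B does not see the shift by 1/2. -/
lemma trivialModuleAlgebra_connesB_eq_zero {n : ℕ} {ψ : Cochain k H R (n + 1)}
    (hψ : ∀ i, codegeneracy k H R n i ψ = 0) (a : Fin (n + 1) → R) (j : Fin (n + 1))
    (ha : a j = 1) : (trivialModuleAlgebra k H R).connesB n ψ a = 0 := by
  ext g
  rw [trivialModuleAlgebra_connesB_apply hψ]
  refine Finset.sum_eq_zero fun r _ => ?_
  rw [apply_eq_zero_of_codegeneracy hψ _ (j + r) (by simp [ha])]
  simp

lemma trivialModuleAlgebra_connesB_word {n : ℕ} {ψ : Cochain k H R (n + 1)}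
    (hψ : ∀ i, codegeneracy k H R n i ψ = 0) (e : R) (r : k) (p : ℕ) (c : R) :
    (trivialModuleAlgebra k H R).connesB n ψ (word e (e - r • 1) p c) =
      (trivialModuleAlgebra k H R).connesB n ψ (word e e p c) := by
  rw [map_word_sub, map_word_smul, 
    trivialModuleAlgebra_connesB_eq_zero hψ (word e 1 p c) 0 (by simp [word]),
    smul_zero, sub_zero]

lemma trivialModuleAlgebra_connesB_const {N : ℕ} {ψ : Cochain k H R (2 * N + 1)}
    (hψ : ∀ i, codegeneracy k H R (2 * N) i ψ = 0) (e : R) (g : H) :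
    (trivialModuleAlgebra k H R).connesB (2 * N) ψ (fun _ => e) g =
      (2 * N + 1) * ψ (word e 1 1 e) g := by
  rw [trivialModuleAlgebra_connesB_apply hψ]
  have h : ∀ r : ℕ, (-1 : k) ^ (r * (2 * N)) = 1 := fun r =>
    Even.neg_one_pow ((even_two_mul N).mul_left r)
  simp [h, cons_const_eq_word e 1 1]

/-- Addition in `Fin` is modulo 2N + 2, which is even, so parity is additive. -/
lemma neg_one_pow_val_add {N : ℕ} (p q : Fin (2 * N + 1 + 1)) :
    (-1 : k) ^ ((p + q : Fin _) : ℕ) = (-1) ^ (p : ℕ) * (-1) ^ (q : ℕ) := by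
  rw [← pow_add, Fin.val_add, neg_one_pow_eq_pow_mod_two,
    Nat.mod_mod_of_dvd _ (by omega : 2 ∣ 2 * N + 1 + 1), ← neg_one_pow_eq_pow_mod_two]

/-- For each of the 2N + 1 positions of c, the terms of Nσ let c run once through all positions
behind the leading 1, with alternating signs. After the cyclic reindexing every position contributes
the same sum; the sign is negative because c starts in position i + 1 with weight (-1)ⁱ. -/
lemma sum_connesB_word {N : ℕ} {ψ : Cochain k H R (2 * N + 2)}
    (hψ : ∀ i, codegeneracy k H R (2 * N + 1) i ψ = 0) (e c : R) (r : k) (g : H) :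
    ∑ i ∈ Finset.range (2 * N + 1), (-1 : k) ^ i *
      (trivialModuleAlgebra k H R).connesB (2 * N + 1) ψ (word e (e - r • 1) (i + 1) c) g =
    -(2 * N + 1) * ∑ q ∈ Finset.range (2 * N + 2), (-1 : k) ^ q * ψ (word e 1 (q + 1) c) g := by
  rw [← Fin.sum_univ_eq_sum_range (fun i => (-1 : k) ^ i *
      (trivialModuleAlgebra k H R).connesB (2 * N + 1) ψ (word e (e - r • 1) (i + 1) c) g),
    ← Fin.sum_univ_eq_sum_range (fun q => (-1 : k) ^ q * ψ (word e 1 (q + 1) c) g)]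
  set S := ∑ q : Fin (2 * N + 2), (-1 : k) ^ (q : ℕ) * ψ (word e 1 (q + 1) c) g with hS
  have key : ∀ p : Fin (2 * N + 1), (-1 : k) ^ (p : ℕ) *
      (trivialModuleAlgebra k H R).connesB (2 * N + 1) ψ (word e (e - r • 1) (p + 1) c) g =
        -S := by
    intro p
    rw [trivialModuleAlgebra_connesB_word hψ, word_self_eq_update,
      trivialModuleAlgebra_connesB_apply hψ, hS,
      ← Equiv.sum_comp (Equiv.addLeft p.succ) (fun q : Fin (2 * N + 2) => (-1 : k) ^ (q : ℕ) *
        ψ (word e 1 (q + 1) c) g), Finset.mul_sum, ← Finset.sum_neg_distrib]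
    refine Finset.sum_congr rfl fun q _ => ?_
    rw [Equiv.coe_addLeft, neg_one_pow_val_add, ← cons_update_const_eq_word]
    have h1 : (fun i => (Function.update (fun _ => e) p.succ c : Fin (2 * N + 2) → R) (i - q)) =
        Function.update (fun _ => e) (p.succ + q) c := by
      funext i
      simp only [Function.update_apply, sub_eq_iff_eq_add]
    have h2 : (-1 : k) ^ ((q : ℕ) * (2 * N + 1)) = (-1) ^ (q : ℕ) := by
      rw [mul_comm, pow_mul, Odd.neg_one_pow ⟨N, rfl⟩]
    rw [h1, h2, Fin.val_succ, pow_succ]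
    ring
  rw [Finset.sum_congr rfl fun p _ => key p, Finset.sum_const, Finset.card_univ, Fintype.card_fin,
    nsmul_eq_mul]
  push_cast
  ring

end Normalized

/-! ### Connes' pairing for an ordinary algebra -/

section Pairing

variable {k : Type u} [Field k] {H : Type v} [Ring H] [HopfAlgebra k H]
variable {R : Type*} [Ring R] [Algebra k R]

section Odd

variable [BijectiveAntipode k H]

/-- The interior merges e·e all give the same value; there is an odd number of them with alternating
signs, so one copy survives with sign -1. -/
lemma trivialModuleAlgebra_hochschild_word_odd (n : ℕ) (ψ : Cochain k H R (2 * n + 1)) {e : R}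
    (he : e * e = e) (z : R) (g : H) :
    (trivialModuleAlgebra k H R).hochschild (2 * n + 1) ψ (word e z 1 e) g =
      ψ (word e (z * e) 1 e) g - ψ (word e z 1 e) g + ψ (word e (e * z) 1 e) g := by
  rw [trivialModuleAlgebra_hochschild_word (2 * n + 1) _ he _ 1 le_rfl,
    if_neg (show ¬ 1 = 2 * n + 1 + 1 by omega), he, Finset.sum_range_succ']
  have h : ∀ j ∈ Finset.range (2 * n + 1), (-1 : k) ^ (j + 1) *
      (if j + 1 = 0 then if 1 = 1 then ψ (word e (z * e) 1 e) g else ψ (word e (z * e) (1 - 1) e) g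
        else if j + 1 + 1 < 1 then ψ (word e z (1 - 1) e) g
        else if j + 1 + 1 = 1 then ψ (word e z (1 - 1) e) g
        else if j + 1 = 1 then ψ (word e z 1 e) g else ψ (word e z 1 e) g) =
      (-1) ^ (j + 1) * ψ (word e z 1 e) g := by
    intro j _
    rw [if_neg (by omega), if_neg (by omega), if_neg (by omega), ite_self]
  rw [Finset.sum_congr rfl h, ← Finset.sum_mul, sum_neg_one_pow_succ, if_neg (by simp),
    if_pos rfl, if_pos rfl, (show Even (2 * n + 1 + 1) from ⟨n + 1, by ring⟩).neg_one_pow]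
  ring

/-- The coboundary of a cyclic cochain vanishes on idempotents. -/
lemma cyclicCoboundary_apply_idempotent [CharZero k] {N : ℕ} {ψ : Cochain k H R (2 * N + 1)}
    (hψ : (trivialModuleAlgebra k H R).cyclicOp (2 * N + 1) ψ = -ψ) {e : R} (he : e * e = e) :
    (trivialModuleAlgebra k H R).hochschild (2 * N + 1) ψ (fun _ => e) = 0 := by
  ext g
  have h := congrArg (fun F => F (fun _ => e) g) hψ
  simp only [trivialModuleAlgebra_cyclicOp_apply, neg_apply, LinearMap.neg_apply] at h
  -- A constant word is fixed by rotation, so its value equals its own negative.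
  replace h : ψ (fun _ => e) g = 0 := by linear_combination h / 2
  have h1 := trivialModuleAlgebra_hochschild_word_odd N ψ he e g
  rw [word_const, he, word_const, h] at h1
  rw [h1]
  simp

end Odd

/-- This is the reason for the shift: with z = e - 1/2 one gets z - 2ze = -1/2, so the leftover
words of the homotopy formula begin with 1, just like those produced by B. -/
lemma sub_half_mul [CharZero k] {e : R} (he : e * e = e) :
    (e - (1 / 2 : k) • 1) * e = (1 / 2 : k) • e := by
  have h : e = (1 / 2 : k) • e + (1 / 2 : k) • e := by rw [← add_smul]; norm_num
  rw [sub_mul, he, smul_one_mul]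
  nth_rewrite 1 [h]
  abel

variable (k) in
/-- The weight `(-1)ⁿ (2n)! / n!`. -/
def chernWeight (n : ℕ) : k := (-1 : k) ^ n * ((2 * n).factorial / n.factorial : k)

lemma chernWeight_zero : chernWeight k 0 = 1 := by simp [chernWeight]

/-- The recursion that makes the weighted sums telescope: half of each weight cancels 2n + 1 times
the preceding one. -/
lemma chernWeight_succ [CharZero k] (n : ℕ) :
    chernWeight k (n + 1) = -(2 * (2 * n + 1)) * chernWeight k n := by
  have h1 : ((2 * (n + 1)).factorial : k) = (2 * n + 2) * (2 * n + 1) * (2 * n).factorial := by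
    rw [show 2 * (n + 1) = 2 * n + 1 + 1 by ring, Nat.factorial_succ, Nat.factorial_succ]
    push_cast
    ring
  have h2 : (n.factorial : k) ≠ 0 := Nat.cast_ne_zero.2 n.factorial_ne_zero
  have h3 : (n + 1 : k) ≠ 0 := Nat.cast_add_one_ne_zero n
  rw [chernWeight, chernWeight, h1, Nat.factorial_succ]
  push_cast
  field_simp
  ring

/-- The pairing of an idempotent with the components of degree at most `2m` of a family of
cochains: `f₀(e) + ∑_{1 ≤ n ≤ m} (-1)ⁿ (2n)!/n! f_{2n}(e - 1/2, e, …, e)`. -/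
def chernPairing (f : (n : ℕ) → Cochain k H R n) (m : ℕ) (e : R) : H →ₗ[k] k :=
  f 0 (fun _ => e) + ∑ n ∈ Finset.Icc 1 m, chernWeight k n •
    f (2 * n) (Fin.cons (e - (1 / 2 : k) • 1) (fun _ => e))

/-- Writing e = 1/2 + (e - 1/2) in degree 0 puts all degrees in the same form, at the price of a
constant independent of e. -/
lemma chernPairing_eq (f : (n : ℕ) → Cochain k H R n) (m : ℕ) (e : R) :
    chernPairing f m e = (1 / 2 : k) • f 0 (fun _ => 1) + ∑ n ∈ Finset.range (m + 1),
      chernWeight k n • f (2 * n) (word e (e - (1 / 2 : k) • 1) 1 e) := by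
  have h0 : ∀ x y : R, (word y x 1 y : Fin (0 + 1) → R) = fun _ => x := by
    intro x y
    funext j
    simp [word, Fin.fin_one_eq_zero j]
  have h : f 0 (fun _ => e) = (1 / 2 : k) • f 0 (fun _ => 1) +
      f 0 (word e (e - (1 / 2 : k) • 1) 1 e) := by
    rw [map_word_sub, map_word_smul, h0, h0]
    abel
  rw [Finset.range_eq_Ico, Finset.sum_eq_sum_Ico_succ_bot (Nat.succ_pos m), chernWeight_zero,
    one_smul, chernPairing, h, add_assoc]
  simp only [cons_const_eq_word e _ 1]
  rfl

lemma chernPairing_eq_of_le (f : (n : ℕ) → Cochain k H R n) {m m' : ℕ} (h : m ≤ m')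
    (hf : ∀ n, m < n → f (2 * n) = 0) (e : R) : chernPairing f m' e = chernPairing f m e := by
  rw [chernPairing, chernPairing]
  congr 1
  symm
  refine Finset.sum_subset (Finset.Icc_subset_Icc_right h) fun n hn hn' => ?_
  rw [Finset.mem_Icc] at hn hn'
  rw [hf n (by omega)]
  simp

variable [BijectiveAntipode k H] [CharZero k]

/-- The pairing with a normalized periodic cocycle takes the same value on an idempotent and on its
conjugates by unipotent elements. -/
lemma chernPairing_shear (f : (n : ℕ) → Cochain k H R n)
    (hf : ∀ n i, codegeneracy k H R (2 * n + 1) i (f (2 * n + 2)) = 0)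
    (hd : ∀ n, (trivialModuleAlgebra k H R).hochschild (2 * n) (f (2 * n)) +
      (trivialModuleAlgebra k H R).connesB (2 * n + 1) (f (2 * n + 2)) = 0)
    (m : ℕ) (hm : f (2 * m + 2) = 0) {γ : R} (hγ : γ * γ = 0) {e : R} (he : e * e = e) (t : k) :
    chernPairing f m (shear γ e t) = chernPairing f m e := by
  ext g
  have h := eq_of_second_order (p := fun t => chernPairing f m (shear γ e t) g) ?_ t
  · simpa [shear_zero] using h
  intro t
  have hz : e * (e - (1 / 2 : k) • 1) = (e - (1 / 2 : k) • 1) * e := by simp [mul_sub, sub_mul]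
  choose Q hQ using fun n => exists_expand_cochain n (f (2 * n)) hγ he hz g t
  set e' := shear γ e t with he'
  have hee : e' * e' = e' := by rw [he', shear_mul hγ, he]
  let U : ℕ → k := fun n => ∑ q ∈ Finset.range (2 * n), (-1 : k) ^ q *
    f (2 * n) (word e' 1 (q + 1) γ) g
  -- The first-order coefficient in degree 2n: the words with first letter z - 2ze = -1/2 give the
  -- multiple of U n, and the coboundary terms become, through bf = -Bf and `sum_connesB_word`, the
  -- multiple of U (n + 1).
  have hcoef : ∀ n, (∑ q ∈ Finset.range (2 * n), (-1 : k) ^ q *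
      (f (2 * n) (word e' (shear γ (e - (1 / 2 : k) • 1) t) (q + 1) γ) g -
        2 * f (2 * n) (word e' (shear γ (e - (1 / 2 : k) • 1) t * e') (q + 1) γ) g) -
      ∑ i ∈ Finset.range (2 * n + 1), (-1 : k) ^ i *
        (trivialModuleAlgebra k H R).hochschild (2 * n) (f (2 * n))
          (word e' (shear γ (e - (1 / 2 : k) • 1) t) (i + 1) γ) g) =
      -(1 / 2) * U n - (2 * n + 1) * U (n + 1) := by
    intro n
    rw [shear_sub_smul_one hγ, ← he']
    have h1 : (e' - (1 / 2 : k) • 1) * e' = (1 / 2 : k) • e' := sub_half_mul hee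
    have h2 : (trivialModuleAlgebra k H R).hochschild (2 * n) (f (2 * n)) =
        -(trivialModuleAlgebra k H R).connesB (2 * n + 1) (f (2 * n + 2)) :=
      eq_neg_of_add_eq_zero_left (hd n)
    rw [h2, h1]
    have h3 := sum_connesB_word (hf n) e' γ (1 / 2) g
    simp only [neg_apply, LinearMap.neg_apply, mul_neg, Finset.sum_neg_distrib,
      sub_neg_eq_add]
    rw [h3, sub_eq_add_neg _ ((2 * (n : k) + 1) * U (n + 1)), ← neg_mul _ (U (n + 1))]
    refine congrArg₂ (· + ·) ?_ rfl
    rw [Finset.mul_sum]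
    refine Finset.sum_congr rfl fun q _ => ?_
    rw [map_word_sub, map_word_smul, map_word_smul, LinearMap.sub_apply, LinearMap.smul_apply,
      LinearMap.smul_apply]
    simp only [smul_eq_mul]
    ring
  have htel : ∀ M, ∑ n ∈ Finset.range (M + 1),
      chernWeight k n * (-(1 / 2) * U n - (2 * n + 1) * U (n + 1)) =
        1 / 2 * (chernWeight k (M + 1) * U (M + 1)) := by
    intro M
    induction M with
    | zero =>
      rw [Finset.sum_range_one, chernWeight_succ, show U 0 = 0 from rfl]
      push_cast
      ring
    | succ M ih =>
      rw [Finset.sum_range_succ, ih, chernWeight_succ (M + 1)]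
      push_cast
      ring
  -- The telescoped sum is a multiple of the first component beyond the truncation, which is zero.
  have hU : U (m + 1) = 0 := by
    refine Finset.sum_eq_zero fun q _ => ?_
    have : f (2 * (m + 1)) = 0 := hm
    rw [this]
    simp
  refine ⟨∑ n ∈ Finset.range (m + 1), Polynomial.C (chernWeight k n) * Q n, fun s => ?_⟩
  simp only [chernPairing_eq, LinearMap.add_apply, LinearMap.sum_apply, LinearMap.smul_apply,
    smul_eq_mul, ← shear_sub_smul_one hγ]
  rw [add_assoc]
  congr 1
  rw [Finset.sum_congr rfl fun n _ => by rw [hQ n s, hcoef n]]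
  simp only [mul_add, Finset.sum_add_distrib, Polynomial.eval_finsetSum, Polynomial.eval_mul,
    Polynomial.eval_C, Finset.mul_sum]
  have h5 : ∑ n ∈ Finset.range (m + 1), chernWeight k n *
      (s * (-(1 / 2) * U n - (2 * n + 1) * U (n + 1))) = 0 := by
    rw [Finset.sum_congr rfl fun n _ => mul_left_comm _ s _, ← Finset.mul_sum, htel, hU]
    simp
  rw [h5, add_zero]
  congr 1
  · rw [shear_sub_smul_one hγ]
  · exact Finset.sum_congr rfl fun n _ => by ring

/-- The pairing with the coboundary of a normalized odd periodic cochain vanishes. -/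
lemma chernPairing_coboundary (f ψ : (n : ℕ) → Cochain k H R n)
    (hψ : ∀ n i, codegeneracy k H R (2 * n) i (ψ (2 * n + 1)) = 0)
    (h0 : f 0 = (trivialModuleAlgebra k H R).connesB 0 (ψ 1))
    (hs : ∀ n, f (2 * n + 2) = (trivialModuleAlgebra k H R).hochschild (2 * n + 1) (ψ (2 * n + 1)) +
      (trivialModuleAlgebra k H R).connesB (2 * n + 2) (ψ (2 * n + 3)))
    (m : ℕ) (hm : ψ (2 * m + 1) = 0) {e : R} (he : e * e = e) : chernPairing f m e = 0 := by
  ext g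
  let W : ℕ → k := fun n => ψ (2 * n + 1) (word e 1 1 e) g
  have hB : ∀ n, (trivialModuleAlgebra k H R).connesB (2 * n) (ψ (2 * n + 1))
      (word e (e - (1 / 2 : k) • 1) 1 e) g = (2 * n + 1) * W n := by
    intro n
    rw [trivialModuleAlgebra_connesB_word (hψ n), word_const,
      trivialModuleAlgebra_connesB_const (hψ n)]
  -- With z = e - 1/2 the three surviving terms have first letters e/2, -(e - 1/2) and e/2, which
  -- add up to 1/2.
  have hb : ∀ n, (trivialModuleAlgebra k H R).hochschild (2 * n + 1) (ψ (2 * n + 1))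
      (word e (e - (1 / 2 : k) • 1) 1 e) g = 1 / 2 * W n := by
    intro n
    have h1 : (e - (1 / 2 : k) • 1) * e = (1 / 2 : k) • e := sub_half_mul he
    have h2 : e * (e - (1 / 2 : k) • 1) = (1 / 2 : k) • e := by
      rw [← h1, mul_sub, sub_mul, mul_smul_one, smul_one_mul]
    rw [trivialModuleAlgebra_hochschild_word_odd n _ he, h1, h2, map_word_sub, map_word_smul,
      map_word_smul, LinearMap.sub_apply, LinearMap.smul_apply, LinearMap.smul_apply]
    simp only [smul_eq_mul, W]
    ring
  have htel : ∀ M, ∑ n ∈ Finset.range (M + 1), chernWeight k n *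
      f (2 * n) (word e (e - (1 / 2 : k) • 1) 1 e) g =
        (2 * M + 1) * (chernWeight k M * W M) := by
    intro M
    induction M with
    | zero =>
      rw [Finset.sum_range_one]
      have := hB 0
      simp only [Nat.mul_zero] at this
      simp only [Nat.mul_zero, h0]
      rw [this]
      push_cast
      ring
    | succ M ih =>
      rw [Finset.sum_range_succ, ih, chernWeight_succ M]
      have h1 : f (2 * (M + 1)) (word e (e - (1 / 2 : k) • 1) 1 e) g =
          1 / 2 * W M + (2 * (M + 1 : ℕ) + 1) * W (M + 1) := by
        rw [← hb, ← hB]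
        exact congrArg (fun F => F (word e (e - (1 / 2 : k) • 1) 1 e) g) (hs M)
      rw [h1]
      push_cast
      ring
  have hW : W m = 0 := by simp [W, hm]
  -- The constant term is half of Bψ₁ at 1, zero by normalization; the rest telescopes to the
  -- vanishing top component of ψ.
  rw [chernPairing_eq, h0, trivialModuleAlgebra_connesB_eq_zero (hψ 0) _ 0 rfl]
  simp only [LinearMap.add_apply, LinearMap.sum_apply, LinearMap.smul_apply, smul_eq_mul, htel, hW]
  simp

end Pairing

end
end EquivariantCyclic

/-! ### Unipotent conjugations linking equivalent idempotents, and amplification of block sums -/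

namespace EquivariantCyclic
noncomputable section

section Unipotent

variable {k : Type u} [Field k] {R : Type*} [Ring R] [Algebra k R] {M : Type*}

/-- Murray–von Neumann equivalent orthogonal idempotents are linked by unipotent conjugations. -/
lemma apply_eq_of_shear (S : Subalgebra k R) (φ : R → M)
    (hφ : ∀ γ ∈ S, ∀ e ∈ S, γ * γ = 0 → e * e = e → φ (shear γ e (1 : k)) = φ e) {E F α β : R}
    (hE : E ∈ S) (hF : F ∈ S) (hα : α ∈ S) (hβ : β ∈ S) (EE : E * E = E) (FF : F * F = F)
    (αE : α * E = α) (Fα : F * α = α) (αβ : α * β = F) (βα : β * α = E) (Eβ : E * β = β)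
    (Eα : E * α = 0) (αα : α * α = 0) (αF : α * F = 0) (βE : β * E = 0) (ββ : β * β = 0) :
    φ E = φ F := by
  -- The chain is E → E + α → F + α ← F, with conjugations by 1 + α, 1 - β and 1 - α. All elements
  -- involved stay in S.
  have s₁ : shear α E (1 : k) = E + α := by
    simp only [shear, one_smul, add_mul, one_mul, mul_sub, mul_one, αE, Eα, αα, sub_zero, add_zero]
  have s₂ : shear (-β) (E + α) (1 : k) = F + α := by
    simp only [shear, one_smul, add_mul, one_mul, mul_add, mul_one, neg_mul, βE, βα, sub_neg_eq_add,
      Eβ, αβ, zero_mul]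
    abel
  have s₃ : shear (-α) F (1 : k) = F + α := by
    simp only [shear, one_smul, add_mul, one_mul, mul_add, mul_one, neg_mul, αF, sub_neg_eq_add,
      Fα, neg_zero, add_zero]
  rw [← hφ α hα E hE αα EE, s₁,
    ← hφ (-β) (neg_mem hβ) (E + α) (add_mem hE hα) (by rw [neg_mul_neg, ββ])
      (by simp only [mul_add, add_mul, EE, Eα, αE, αα, add_zero]), s₂, ← s₃,
    hφ (-α) (neg_mem hα) F hF (by rw [neg_mul_neg, αα]) FF]

end Unipotent

section AmplifyBlock

variable {k : Type u} [Field k]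

/-- Amplification is additive along an orthogonal pair of multiplicative inclusions whose units
add up to the unit. -/
lemma amplify_block (A : Type w) [AddCommGroup A] [Module k A] {B B₁ B₂ : Type*} [Ring B]
    [Algebra k B] [Ring B₁] [Algebra k B₁] [Ring B₂] [Algebra k B₂] {X : Type*} [AddCommGroup X]
    [Module k X] (i₁ : B₁ →ₗ[k] B) (i₂ : B₂ →ₗ[k] B) (h₁ : ∀ u v, i₁ (u * v) = i₁ u * i₁ v)
    (h₂ : ∀ u v, i₂ (u * v) = i₂ u * i₂ v) (h₁₂ : ∀ u v, i₁ u * i₂ v = 0)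
    (h₂₁ : ∀ u v, i₂ u * i₁ v = 0) (h : i₁ 1 + i₂ 1 = 1) (m : ℕ)
    (F : MultilinearMap k (fun _ : Fin m => A) X) (x : Fin m → A ⊗[k] B₁)
    (y : Fin m → A ⊗[k] B₂) :
    amplify A B m F (fun j => i₁.lTensor A (x j) + i₂.lTensor A (y j)) =
      i₁.lTensor X (amplify A B₁ m F x) + i₂.lTensor X (amplify A B₂ m F y) := by
  induction m with
  | zero =>
    change F Fin.elim0 ⊗ₜ[k] (1 : B) =
      F Fin.elim0 ⊗ₜ[k] i₁ (1 : B₁) + F Fin.elim0 ⊗ₜ[k] i₂ (1 : B₂)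
    rw [← TensorProduct.tmul_add, h]
  | succ m ih =>
    have l₁ : ∀ (u : B₁) (ζ : X ⊗[k] B₁), (LinearMap.mulLeft k (i₁ u)).lTensor X
        (i₁.lTensor X ζ) = i₁.lTensor X ((LinearMap.mulLeft k u).lTensor X ζ) := by
      intro u ζ
      rw [← LinearMap.comp_apply, ← LinearMap.comp_apply, ← LinearMap.lTensor_comp,
        ← LinearMap.lTensor_comp]
      congr 2
      ext v
      exact (h₁ u v).symm
    have l₂ : ∀ (u : B₂) (ζ : X ⊗[k] B₂), (LinearMap.mulLeft k (i₂ u)).lTensor X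
        (i₂.lTensor X ζ) = i₂.lTensor X ((LinearMap.mulLeft k u).lTensor X ζ) := by
      intro u ζ
      rw [← LinearMap.comp_apply, ← LinearMap.comp_apply, ← LinearMap.lTensor_comp,
        ← LinearMap.lTensor_comp]
      congr 2
      ext v
      exact (h₂ u v).symm
    have l₁₂ : ∀ (u : B₁) (ζ : X ⊗[k] B₂), (LinearMap.mulLeft k (i₁ u)).lTensor X
        (i₂.lTensor X ζ) = 0 := by
      intro u ζ
      rw [← LinearMap.comp_apply, ← LinearMap.lTensor_comp,
        show LinearMap.mulLeft k (i₁ u) ∘ₗ i₂ = 0 from LinearMap.ext fun v => h₁₂ u v]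
      simp
    have l₂₁ : ∀ (u : B₂) (ζ : X ⊗[k] B₁), (LinearMap.mulLeft k (i₂ u)).lTensor X
        (i₁.lTensor X ζ) = 0 := by
      intro u ζ
      rw [← LinearMap.comp_apply, ← LinearMap.lTensor_comp,
        show LinearMap.mulLeft k (i₂ u) ∘ₗ i₁ = 0 from LinearMap.ext fun v => h₂₁ u v]
      simp
    have key₁ : ∀ z : A ⊗[k] B₁, amplifyStep (amplify A B m ∘ₗ F.curryLeft) (i₁.lTensor A z)
        (fun j => i₁.lTensor A (Fin.tail x j) + i₂.lTensor A (Fin.tail y j)) =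
        i₁.lTensor X (amplifyStep (amplify A B₁ m ∘ₗ F.curryLeft) z (Fin.tail x)) := by
      intro z
      induction z with
      | zero => simp
      | add z z' hz hz' => simp only [map_add, add_apply, hz, hz']
      | tmul a u =>
        rw [LinearMap.lTensor_tmul, amplifyStep_tmul, amplifyStep_tmul, LinearMap.comp_apply, ih,
          map_add, l₁, l₁₂, add_zero]
        rfl
    have key₂ : ∀ z : A ⊗[k] B₂, amplifyStep (amplify A B m ∘ₗ F.curryLeft) (i₂.lTensor A z)
        (fun j => i₁.lTensor A (Fin.tail x j) + i₂.lTensor A (Fin.tail y j)) =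
        i₂.lTensor X (amplifyStep (amplify A B₂ m ∘ₗ F.curryLeft) z (Fin.tail y)) := by
      intro z
      induction z with
      | zero => simp
      | add z z' hz hz' => simp only [map_add, add_apply, hz, hz']
      | tmul a u =>
        rw [LinearMap.lTensor_tmul, amplifyStep_tmul, amplifyStep_tmul, LinearMap.comp_apply, ih,
          map_add, l₂, l₂₁, zero_add]
        rfl
    rw [amplify_succ, amplify_succ, amplify_succ, map_add, add_apply]
    exact congrArg₂ (· + ·) (key₁ (x 0)) (key₂ (y 0))

end AmplifyBlock

/-! ### Direct sums and Murray–von Neumann equivalence -/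

namespace YetterDrinfeldAlgebra

open FinDimRep

variable {k : Type u} [Field k] {H : Type v} [Ring H] [HopfAlgebra k H]
variable {A : Type w} [Ring A] [Algebra k A] (D : YetterDrinfeldAlgebra k H A)
variable (V W : FinDimRep k H)

/-- The map `u ↦ φ u ψ` from `End(V)` to `End(W)`. -/
def endMap {V W : FinDimRep k H} (φ : V.V →ₗ[k] W.V) (ψ : W.V →ₗ[k] V.V) :
    Module.End k V.V →ₗ[k] Module.End k W.V :=
  LinearMap.lcomp k W.V ψ ∘ₗ LinearMap.llcomp k V.V V.V W.V φ

/-- The factor S(a₍₁₎) multiplies from the left, so only φ has to commute with H. -/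
lemma untwist_transport {V W : FinDimRep k H} {φ : V.V →ₗ[k] W.V} (ψ : W.V →ₗ[k] V.V)
    (hφ : IsIntertwiner V W φ) (x : A ⊗[k] Module.End k V.V) :
    D.untwist W (transport A (V := V) (W := V) (V' := W) (W' := W) φ ψ x) =
      (endMap φ ψ).lTensor A (D.untwist V x) := by
  induction x with
  | zero => simp
  | add x y hx hy => simp only [map_add, hx, hy]
  | tmul a u =>
    rw [transport_tmul, untwist_tmul, untwist_tmul]
    induction D.coact a with
    | zero => simp
    | add x y hx hy => simp only [map_add, hx, hy]
    | tmul b h =>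
      rw [LinearMap.lTensor_tmul, LinearMap.lTensor_tmul, LinearMap.lTensor_tmul]
      congr 1
      change W.act _ ∘ₗ φ ∘ₗ u ∘ₗ ψ = φ ∘ₗ (V.act _ ∘ₗ u) ∘ₗ ψ
      rw [← LinearMap.comp_assoc, ← hφ]
      rfl

/-- Move ψ past g⁽⁰⁾ by H-linearity, then around the trace, where it cancels φ. -/
lemma contractTrace_endMap {V W : FinDimRep k H} {φ : V.V →ₗ[k] W.V} {ψ : W.V →ₗ[k] V.V}
    (hψ : IsIntertwiner W V ψ) (h : ψ ∘ₗ φ = LinearMap.id)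
    (ζ : (H →ₗ[k] k) ⊗[k] Module.End k V.V) :
    contractTrace W ((endMap φ ψ).lTensor _ ζ) = contractTrace V ζ := by
  induction ζ with
  | zero => simp
  | add x y hx hy => simp only [map_add, hx, hy]
  | tmul χ u =>
    ext g
    rw [LinearMap.lTensor_tmul, contractTrace_tmul, contractTrace_tmul]
    refine Finset.sum_congr rfl fun i _ => ?_
    congr 1
    change LinearMap.trace k W.V ((φ ∘ₗ u ∘ₗ ψ) ∘ₗ W.act _) = LinearMap.trace k V.V (u ∘ₗ V.act _)
    rw [LinearMap.comp_assoc, LinearMap.comp_assoc, hψ, LinearMap.trace_comp_comm']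
    congr 1
    rw [LinearMap.comp_assoc, LinearMap.comp_assoc, h]
    rfl

/-- The block-diagonal sum of `x ∈ A ⊗ End(V)` and `y ∈ A ⊗ End(W)`. -/
def blockSum {V W : FinDimRep k H} (x : A ⊗[k] Module.End k V.V) (y : A ⊗[k] Module.End k W.V) :
    A ⊗[k] Module.End k (V.prod W).V :=
  (endMap (V.inl W) (V.fst W)).lTensor A x + (endMap (V.inr W) (V.snd W)).lTensor A y

lemma untwist_blockDiag {V W : FinDimRep k H} (x : A ⊗[k] Module.End k V.V)
    (y : A ⊗[k] Module.End k W.V) :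
    D.untwist (V.prod W) (blockDiag (V := V) (W := V) (V' := W) (W' := W) x y) =
      blockSum (D.untwist V x) (D.untwist W y) := by
  rw [blockDiag, map_add]
  exact congrArg₂ (· + ·) (D.untwist_transport (V.fst W) (isIntertwiner_inl V W) x)
    (D.untwist_transport (V.snd W) (isIntertwiner_inr V W) y)

lemma blockSum_one : blockSum (A := A) (V := V) (W := W) 1 1 = 1 := by
  rw [blockSum, Algebra.TensorProduct.one_def, Algebra.TensorProduct.one_def,
    Algebra.TensorProduct.one_def, LinearMap.lTensor_tmul, LinearMap.lTensor_tmul,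
    ← TensorProduct.tmul_add]
  congr 1
  exact inl_fst_add V W

/-- The generalized trace is additive with respect to direct sums. -/
lemma ampTrace_blockSum (n : ℕ) (f : Cochain k H A n) (x : Fin (n + 1) → A ⊗[k] Module.End k V.V)
    (y : Fin (n + 1) → A ⊗[k] Module.End k W.V) :
    ampTrace A (V.prod W) n f (fun i => blockSum (x i) (y i)) =
      ampTrace A V n f x + ampTrace A W n f y := by
  rw [ampTrace_apply]
  refine (congrArg (contractTrace (V.prod W)) (amplify_block A (endMap (V.inl W) (V.fst W))
    (endMap (V.inr W) (V.snd W)) ?_ ?_ ?_ ?_ ?_ (n + 1) f x y)).trans ?_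
  · intro u v; rfl
  · intro u v; rfl
  · intro u v
    refine LinearMap.ext fun z => ?_
    change V.inl W (u 0) = 0
    rw [map_zero, map_zero]
  · intro u v
    refine LinearMap.ext fun z => ?_
    change V.inr W (u 0) = 0
    rw [map_zero, map_zero]
  · exact inl_fst_add V W
  · rw [map_add, contractTrace_endMap (isIntertwiner_fst V W) (fst_inl V W),
      contractTrace_endMap (isIntertwiner_snd V W) (snd_inr V W)]
    rfl

/-- An additive function of idempotents that is invariant under conjugation by invariant unipotent
elements is invariant under Murray–von Neumann equivalence. -/
lemma apply_eq_of_equivalent {M : Type*} [AddCommGroup M]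
    (φ : (V : FinDimRep k H) → A ⊗[k] Module.End k V.V → M)
    (hadd : ∀ V W x y, φ (V.prod W) (blockSum x y) = φ V x + φ W y) (hzero : ∀ V, φ V 0 = 0)
    (hshear : ∀ V, ∀ γ ∈ D.invariantSubalgebra V, ∀ e ∈ D.invariantSubalgebra V, γ * γ = 0 →
      e * e = e → φ V (shear γ e (1 : k)) = φ V e)
    {V W : FinDimRep k H} {e : A ⊗[k] (V.V →ₗ[k] V.V)} {e' : A ⊗[k] (W.V →ₗ[k] W.V)}
    (he : D.tmul V V V e e = e) (he' : D.tmul W W W e' e' = e') (ie : D.IsInvariant e)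
    (ie' : D.IsInvariant e') {γ₁ : A ⊗[k] (V.V →ₗ[k] W.V)} {γ₂ : A ⊗[k] (W.V →ₗ[k] V.V)}
    (i₁ : D.IsInvariant γ₁) (i₂ : D.IsInvariant γ₂) (h₁ : D.tmul V W V γ₂ γ₁ = e)
    (h₂ : D.tmul W V W γ₁ γ₂ = e') :
    φ V (D.untwist V e) = φ W (D.untwist W e') := by
  -- Cutting γ₁ and γ₂ down by e yields a and b that still multiply to e and e' and are in addition
  -- absorbed by both idempotents.
  obtain ⟨a, ha⟩ : ∃ a, a = D.tmul V V W γ₁ e := ⟨_, rfl⟩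
  obtain ⟨b, hb⟩ : ∃ b, b = D.tmul W V V e γ₂ := ⟨_, rfl⟩
  have hia : D.IsInvariant a := ha ▸ D.isInvariant_tmul i₁ ie
  have hib : D.IsInvariant b := hb ▸ D.isInvariant_tmul ie i₂
  have hba : D.tmul V W V b a = e := by
    rw [ha, hb, D.tmul_assoc, ← D.tmul_assoc _ _ _ _ γ₂, h₁, he, he]
  have hab : D.tmul W V W a b = e' := by
    rw [ha, hb, D.tmul_assoc, ← D.tmul_assoc _ _ _ _ e, he, ← h₁, D.tmul_assoc _ _ _ _ γ₂,
      h₂, ← D.tmul_assoc, h₂, he']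
  have hae : D.tmul V V W a e = a := by rw [ha, D.tmul_assoc, he]
  have heb : D.tmul W V V e b = b := by rw [hb, ← D.tmul_assoc, he]
  have hea : D.tmul V W W e' a = a := by rw [← hab, D.tmul_assoc, hba, hae]
  have hbe : D.tmul W W V b e' = b := by rw [← hab, ← D.tmul_assoc, hba, heb]
  -- Over V ⊕ W the elements e and e' become the diagonal blocks and a, b the off-diagonal ones,
  -- which gives the matrix-unit relations required by `apply_eq_of_shear`.
  let U := V.prod W
  let E := D.untwist U (transport A (V := V) (W := V) (V' := U) (W' := U) (V.inl W) (V.fst W) e)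
  let F := D.untwist U
    (transport A (V := W) (W := W) (V' := U) (W' := U) (V.inr W) (V.snd W) e')
  let α := D.untwist U (transport A (V := V) (W := W) (V' := U) (W' := U) (V.inr W) (V.fst W) a)
  let β := D.untwist U (transport A (V := W) (W := V) (V' := U) (W' := U) (V.inl W) (V.snd W) b)
  have jl := isIntertwiner_inl V W
  have jr := isIntertwiner_inr V W
  have pl := isIntertwiner_fst V W
  have pr := isIntertwiner_snd V W
  have hE : E ∈ D.invariantSubalgebra U :=
    D.untwist_mem_invariantSubalgebra U (D.isInvariant_transport jl pl ie)
  have hF : F ∈ D.invariantSubalgebra U :=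
    D.untwist_mem_invariantSubalgebra U (D.isInvariant_transport jr pr ie')
  have hα : α ∈ D.invariantSubalgebra U :=
    D.untwist_mem_invariantSubalgebra U (D.isInvariant_transport jr pl hia)
  have hβ : β ∈ D.invariantSubalgebra U :=
    D.untwist_mem_invariantSubalgebra U (D.isInvariant_transport jl pr hib)
  have t : ∀ {x y z : A ⊗[k] Module.End k U.V}, D.tmul U U U x y = z →
      D.untwist U x * D.untwist U y = D.untwist U z := by
    rintro x y z rfl
    exact (D.untwist_tmul_eq_mul U x y).symm
  have t0 : ∀ {x y : A ⊗[k] Module.End k U.V}, D.tmul U U U x y = 0 →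
      D.untwist U x * D.untwist U y = 0 := fun h => (t h).trans (map_zero _)
  have EE : E * E = E := t (by rw [D.tmul_transport_id jl pl (fst_inl V W), he])
  have αE : α * E = α := t (by rw [D.tmul_transport_id jr pl (fst_inl V W), hae])
  have Fα : F * α = α := t (by rw [D.tmul_transport_id jr pr (snd_inr V W), hea])
  have αβ : α * β = F := t (by rw [D.tmul_transport_id jr pl (fst_inl V W), hab])
  have βα : β * α = E := t (by rw [D.tmul_transport_id jl pr (snd_inr V W), hba])
  have Eβ : E * β = β := t (by rw [D.tmul_transport_id jl pl (fst_inl V W), heb])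
  have FF : F * F = F := t (by rw [D.tmul_transport_id jr pr (snd_inr V W), he'])
  have Eα : E * α = 0 := t0 (D.tmul_transport_zero jl pl (fst_inr V W) _ _)
  have αα : α * α = 0 := t0 (D.tmul_transport_zero jr pl (fst_inr V W) _ _)
  have αF : α * F = 0 := t0 (D.tmul_transport_zero jr pl (fst_inr V W) _ _)
  have βE : β * E = 0 := t0 (D.tmul_transport_zero jl pr (snd_inl V W) _ _)
  have ββ : β * β = 0 := t0 (D.tmul_transport_zero jl pr (snd_inl V W) _ _)
  have hEF : φ U E = φ U F := apply_eq_of_shear _ (φ U) (hshear U) hE hF hα hβ EE FF αE Fα αβ βα Eβ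
    Eα αα αF βE ββ
  have e₁ : E = blockSum (D.untwist V e) 0 := by
    rw [blockSum, map_zero, add_zero]
    exact D.untwist_transport (V.fst W) jl e
  have e₂ : F = blockSum 0 (D.untwist W e') := by
    rw [blockSum, map_zero, zero_add]
    exact D.untwist_transport (V.snd W) jr e'
  rw [e₁, e₂, hadd, hadd, hzero, hzero, add_zero, zero_add] at hEF
  exact hEF

lemma InvIdem.MvN.apply_eq {M : Type*} [AddCommGroup M]
    (φ : (V : FinDimRep k H) → A ⊗[k] Module.End k V.V → M)
    (hadd : ∀ V W x y, φ (V.prod W) (blockSum x y) = φ V x + φ W y) (hzero : ∀ V, φ V 0 = 0)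
    (hshear : ∀ V, ∀ γ ∈ D.invariantSubalgebra V, ∀ e ∈ D.invariantSubalgebra V, γ * γ = 0 →
      e * e = e → φ V (shear γ e (1 : k)) = φ V e)
    {e e' : D.InvIdem} (h : e.MvN e') :
    φ e.rep (D.untwist e.rep e.val) = φ e'.rep (D.untwist e'.rep e'.val) := by
  obtain ⟨γ₁, γ₂, i₁, i₂, h₁, h₂⟩ := h
  exact D.apply_eq_of_equivalent φ hadd hzero hshear e.idem e'.idem e.inv e'.inv i₁ i₂ h₁ h₂

end YetterDrinfeldAlgebra

end
end EquivariantCyclic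

namespace EquivariantCyclic
noncomputable section

namespace YetterDrinfeldAlgebra

variable {k : Type u} [Field k] {H : Type v} [Ring H] [HopfAlgebra k H]
variable {A : Type w} [Ring A] [Algebra k A] (D : YetterDrinfeldAlgebra k H A)

/-! ### Homomorphisms on equivariant K-theory -/

section K0

variable {D} {M : Type*} [AddCommGroup M]

/-- A homomorphism out of a Grothendieck group is determined on the monoid, whose elements are the
classes of idempotents. This is the source of uniqueness in both pairings. -/
lemma K0.hom_ext {P Q : D.K0 →+ M} (h : ∀ e, P (K0.mk D e) = Q (K0.mk D e)) : P = Q := by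
  refine Algebra.GrothendieckAddGroup.lift.symm.injective (AddMonoidHom.ext fun x => ?_)
  induction x using Quotient.inductionOn with
  | h e => exact h e

/-- The homomorphism on K-theory induced by an additive invariant of idempotents. -/
def K0.lift (F : D.InvIdem → M) (hF : ∀ e e' : D.InvIdem, e.MvN e' → F e = F e')
    (hadd : ∀ e e' : D.InvIdem, F (e.add e') = F e + F e') : D.K0 →+ M :=
  Algebra.GrothendieckAddGroup.lift
    { toFun := Quotient.lift F hF
      map_zero' := by
        -- The zero idempotent is equivalent to 0 ⊕ 0, so its value equals its own double.
        have h := hF _ _ (InvIdem.zero_add_equiv (D := D) InvIdem.zero)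
        rw [hadd] at h
        exact left_eq_add.1 h
      map_add' := by
        rintro ⟨e⟩ ⟨e'⟩
        exact hadd e e' }

lemma K0.lift_mk (F : D.InvIdem → M) (hF : ∀ e e' : D.InvIdem, e.MvN e' → F e = F e')
    (hadd : ∀ e e' : D.InvIdem, F (e.add e') = F e + F e') (e : D.InvIdem) :
    K0.lift F hF hadd (K0.mk D e) = F e :=
  congrArg (fun f : D.IdemClass →+ M => f (Quotient.mk _ e))
    (Algebra.GrothendieckAddGroup.lift.symm_apply_apply _)

end K0

variable {D} in
/-- The element `e₍₀₎ ⊗ S(e₍₁₎)` of the untwisted algebra defined by an invariant idempotent. -/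
def InvIdem.untwisted (e : D.InvIdem) : D.invariantSubalgebra e.rep :=
  ⟨D.untwist e.rep e.val, D.untwist_mem_invariantSubalgebra e.rep e.inv⟩

variable {D} in
lemma InvIdem.untwisted_mul (e : D.InvIdem) : e.untwisted * e.untwisted = e.untwisted :=
  Subtype.ext ((D.untwist_tmul_eq_mul e.rep e.val e.val).symm.trans
    (congrArg (D.untwist e.rep) e.idem))

variable (V : FinDimRep k H)

/-! ### The pairing with cyclic cohomology -/

section Cyclic

instance invariantFunctionals.instAddCommGroup : AddCommGroup (invariantFunctionals k H) :=
  Submodule.addCommGroup (invariantFunctionals k H)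

variable [BijectiveAntipode k H]

variable {D} in
lemma cyclicOp_invTrace_of_mem {n : ℕ} {f : Cochain k H A n} (hf : f ∈ D.cyclicCochains n) :
    (trivialModuleAlgebra k H (D.invariantSubalgebra V)).cyclicOp n (D.invTrace V n f) =
      (-1 : k) ^ n • D.invTrace V n f := by
  have h : D.cyclicOp n f - (-1 : k) ^ n • f = 0 := hf.2
  rw [← invTrace_cyclicOp, sub_eq_zero.1 h, map_smul]

lemma HC_hom_ext {n : ℕ} {L L' : D.HC (2 * n) →ₗ[k] invariantFunctionals k H}
    (h : ∀ f : D.cyclicCocycles (2 * n), (L (Submodule.Quotient.mk f) : H →ₗ[k] k) =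
      L' (Submodule.Quotient.mk f)) : L = L' := by
  refine LinearMap.ext fun x => ?_
  obtain ⟨f, rfl⟩ := Submodule.Quotient.mk_surjective _ x
  exact Subtype.ext (h f)

variable [CharZero k]

lemma ampTrace_shear {n : ℕ} (f : D.cyclicCocycles (2 * n)) (γ e : D.invariantSubalgebra V)
    (hγ : γ * γ = 0) (he : e * e = e) :
    ampTrace A V (2 * n) (f : Cochain k H A (2 * n)) (fun _ => ↑(shear γ e (1 : k))) =
      ampTrace A V (2 * n) (f : Cochain k H A (2 * n))
        (fun _ => (e : A ⊗[k] Module.End k V.V)) := by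
  have h1 := cyclicOp_invTrace_of_mem V f.2.1
  rw [(even_two_mul n).neg_one_pow, one_smul] at h1
  have h2 : D.hochschild (2 * n) f = 0 := f.2.2
  have h3 := D.invTrace_hochschild V (2 * n) f
  rw [h2, map_zero] at h3
  ext g
  exact cyclicCocycle_shear n h1 h3.symm hγ he g 1

lemma ampTrace_cyclicCoboundaries {n : ℕ} {f : Cochain k H A (2 * n)}
    (hf : f ∈ D.cyclicCoboundaries (2 * n)) (e : D.invariantSubalgebra V) (he : e * e = e) :
    ampTrace A V (2 * n) f (fun _ => (e : A ⊗[k] Module.End k V.V)) = 0 := by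
  cases n with
  | zero =>
    have : f = 0 := hf
    rw [this]
    simp
  | succ n =>
    obtain ⟨ψ, hψ, rfl⟩ : f ∈ (D.cyclicCochains (2 * n + 1)).map (D.hochschild (2 * n + 1)) := hf
    have h1 := cyclicOp_invTrace_of_mem V hψ
    rw [(odd_two_mul_add_one n).neg_one_pow, neg_one_smul] at h1
    have h2 := cyclicCoboundary_apply_idempotent h1 he
    rw [← invTrace_hochschild] at h2
    exact h2

/-- The linear map on cyclic cocycles defined by an invariant idempotent. -/
def cyclicEvalCocycle (n : ℕ) (e : D.InvIdem) :
    D.cyclicCocycles (2 * n) →ₗ[k] invariantFunctionals k H where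
  toFun f := ⟨ampTrace A e.rep (2 * n) (f : Cochain k H A (2 * n))
      (fun _ => D.untwist e.rep e.val),
    D.ampTrace_mem_invariantFunctionals e.rep (2 * n) f.2.1.1 _ (fun _ => e.untwisted.2)⟩
  map_add' f f' := Subtype.ext (by simp)
  map_smul' c f := Subtype.ext (by simp)

/-- The linear map on cyclic cohomology defined by an invariant idempotent. -/
def cyclicEval (n : ℕ) (e : D.InvIdem) : D.HC (2 * n) →ₗ[k] invariantFunctionals k H :=
  Submodule.liftQ ((D.cyclicCoboundaries (2 * n)).submoduleOf (D.cyclicCocycles (2 * n)))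
    (D.cyclicEvalCocycle n e) (by
      intro f hf
      exact LinearMap.mem_ker.2 (Subtype.ext
        (D.ampTrace_cyclicCoboundaries e.rep hf e.untwisted e.untwisted_mul)))

lemma cyclicEval_mk (n : ℕ) (e : D.InvIdem) (f : D.cyclicCocycles (2 * n)) :
    (D.cyclicEval n e (Submodule.Quotient.mk f) : H →ₗ[k] k) =
      ampTrace A e.rep (2 * n) (f : Cochain k H A (2 * n)) (fun _ => D.untwist e.rep e.val) := rfl

lemma cyclicEval_eq_of_mvN (n : ℕ) (e e' : D.InvIdem) (h : e.MvN e') :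
    D.cyclicEval n e = D.cyclicEval n e' := by
  refine D.HC_hom_ext fun f => ?_
  rw [cyclicEval_mk, cyclicEval_mk]
  exact h.apply_eq D (fun V x => ampTrace A V (2 * n) (f : Cochain k H A (2 * n)) fun _ => x)
    (fun V W x y => ampTrace_blockSum V W _ _ _ _)
    (fun V => MultilinearMap.map_coord_zero _ 0 rfl)
    (fun V γ hγ e he hγγ hee => D.ampTrace_shear V f ⟨γ, hγ⟩ ⟨e, he⟩ (Subtype.ext hγγ)
      (Subtype.ext hee))

lemma cyclicEval_add (n : ℕ) (e e' : D.InvIdem) :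
    D.cyclicEval n (e.add e') = D.cyclicEval n e + D.cyclicEval n e' := by
  refine D.HC_hom_ext fun f => ?_
  rw [LinearMap.add_apply, Submodule.coe_add, cyclicEval_mk, cyclicEval_mk, cyclicEval_mk]
  have h : D.untwist (e.add e').rep (e.add e').val =
    blockSum (D.untwist e.rep e.val) (D.untwist e'.rep e'.val) := D.untwist_blockDiag _ _
  rw [h]
  exact ampTrace_blockSum e.rep e'.rep _ _ _ _

end Cyclic

/-! ### The pairing with periodic cyclic cohomology -/

section Periodic

/-- The family of amplified cochains. -/
def ampFamily : ((n : ℕ) → Cochain k H A n) →ₗ[k]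
    ((n : ℕ) → Cochain k H (A ⊗[k] Module.End k V.V) n) :=
  LinearMap.pi fun n => ampTrace A V n ∘ₗ LinearMap.proj n

lemma ampFamily_apply (f : (n : ℕ) → Cochain k H A n) (n : ℕ) :
    ampFamily V f n = ampTrace A V n (f n) := rfl

lemma chernPairing_invTrace (f : (n : ℕ) → Cochain k H A n) (m : ℕ)
    (e : D.invariantSubalgebra V) :
    chernPairing (fun n => D.invTrace V n (f n)) m e = chernPairing (ampFamily V f) m ↑e := by
  rw [chernPairing, chernPairing]
  congr 1

lemma chernPairing_blockSum (W : FinDimRep k H) (f : (n : ℕ) → Cochain k H A n) (m : ℕ)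
    (x : A ⊗[k] Module.End k V.V) (y : A ⊗[k] Module.End k W.V) :
    chernPairing (ampFamily (V.prod W) f) m (blockSum x y) =
      chernPairing (ampFamily V f) m x + chernPairing (ampFamily W f) m y := by
  simp only [chernPairing, ampFamily_apply]
  rw [ampTrace_blockSum V W 0 (f 0) (fun _ => x) (fun _ => y), add_add_add_comm,
    ← Finset.sum_add_distrib]
  congr 1
  refine Finset.sum_congr rfl fun n _ => ?_
  rw [← smul_add, ← ampTrace_blockSum V W]
  congr 2
  funext i
  refine Fin.cases ?_ (fun i => rfl) i
  simp only [Fin.cons_zero]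
  -- The shifted first argument is also block-diagonal, because the unit over V ⊕ W is the block sum
  -- of the two units.
  rw [← blockSum_one V W]
  simp only [blockSum, map_sub, map_smul, smul_add]
  abel

lemma chernPairing_zero (f : (n : ℕ) → Cochain k H A n) (m : ℕ) :
    chernPairing (ampFamily V f) m 0 = 0 := by
  rw [chernPairing, MultilinearMap.map_coord_zero _ 0 rfl, zero_add]
  refine Finset.sum_eq_zero fun n hn => ?_
  -- The first letter is -1/2 and does not vanish; for n ≥ 1 the second letter does.
  rw [MultilinearMap.map_coord_zero _ ⟨1, by have := (Finset.mem_Icc.1 hn).1; omega⟩ rfl, smul_zero]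

lemma chernPairing_mem_invariantFunctionals (f : (n : ℕ) → Cochain k H A n)
    (hf : ∀ n, f n ∈ D.equivariantCochains n) (m : ℕ) (e : D.invariantSubalgebra V) :
    chernPairing (ampFamily V f) m ↑e ∈ invariantFunctionals k H := by
  refine add_mem (D.ampTrace_mem_invariantFunctionals V 0 (hf 0) _ fun _ => e.2)
    (sum_mem fun n _ => Submodule.smul_mem _ _
      (D.ampTrace_mem_invariantFunctionals V (2 * n) (hf _) _ fun i => ?_))
  refine Fin.cases ?_ (fun i => ?_) i
  · exact (e - (1 / 2 : k) • 1).2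
  · exact e.2

variable {D} in
lemma equivariantCochains_of_normalizedCochains : ∀ {n : ℕ} {f : Cochain k H A n},
    f ∈ D.normalizedCochains n → f ∈ D.equivariantCochains n
  | 0, _, hf => hf
  | _ + 1, _, hf => hf.1

variable {D} in
lemma codegeneracy_invTrace_of_mem {n : ℕ} {f : Cochain k H A (n + 1)}
    (hf : f ∈ D.normalizedCochains (n + 1)) (i : Fin (n + 1)) :
    codegeneracy k H (D.invariantSubalgebra V) n i (D.invTrace V (n + 1) f) = 0 := by
  have h : codegeneracy k H A n i f = 0 := (Submodule.mem_iInf _).1 hf.2 i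
  rw [← invTrace_codegeneracy, h, map_zero]

/-- Untwisting sends 1 ⊗ 1 to 1, so it is compatible with the shift by 1/2. -/
lemma chernPairing_traceMap (f : (n : ℕ) → Cochain k H A n) (m : ℕ)
    (x : A ⊗[k] Module.End k V.V) (g : H) :
    D.traceMap V 0 (f 0) (fun _ => x) g + ∑ n ∈ Finset.Icc 1 m,
      (-1 : k) ^ n * ((2 * n).factorial / n.factorial : k) * D.traceMap V (2 * n) (f (2 * n))
        (Fin.cons (x - (1 / 2 : k) • (1 ⊗ₜ[k] 1)) (fun _ => x)) g =
      chernPairing (ampFamily V f) m (D.untwist V x) g := by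
  rw [chernPairing, LinearMap.add_apply, LinearMap.sum_apply]
  congr 1
  refine Finset.sum_congr rfl fun n _ => ?_
  rw [LinearMap.smul_apply, smul_eq_mul, chernWeight, ampFamily_apply, traceMap_eq]
  congr 3
  funext i
  refine Fin.cases ?_ (fun i => rfl) i
  rw [Fin.cons_zero, Fin.cons_zero, map_sub, map_smul, untwist_one]

variable [BijectiveAntipode k H]

lemma HP0_hom_ext {L L' : D.HP0 →ₗ[k] invariantFunctionals k H}
    (h : ∀ f : D.evenPeriodicCocycles, (L (Submodule.Quotient.mk f) : H →ₗ[k] k) =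
      L' (Submodule.Quotient.mk f)) : L = L' := by
  refine LinearMap.ext fun x => ?_
  obtain ⟨f, rfl⟩ := Submodule.Quotient.mk_surjective _ x
  exact Subtype.ext (h f)

variable {D} in
/-- A bound for the degrees of the non-zero components of an even periodic cocycle. -/
def degreeBound (f : D.evenPeriodicCocycles) : ℕ := f.2.1.2.2.choose

variable {D} in
lemma degreeBound_spec (f : D.evenPeriodicCocycles) (n : ℕ) (hn : degreeBound f < n) :
    (f : (n : ℕ) → Cochain k H A n) (2 * n) = 0 :=
  f.2.1.2.2.choose_spec (2 * n) (by
    have : f.2.1.2.2.choose < n := hn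
    omega)

variable {D} in
-- The bound is an arbitrary choice for each cocycle, unrelated between f, f' and f + f'.
-- Independence of it is what makes the evaluation linear.
lemma chernPairing_eq_degreeBound (f : D.evenPeriodicCocycles) {m : ℕ}
    (hm : ∀ n, m < n → (f : (n : ℕ) → Cochain k H A n) (2 * n) = 0)
    (x : A ⊗[k] Module.End k V.V) :
    chernPairing (ampFamily V (f : (n : ℕ) → Cochain k H A n)) (degreeBound f) x =
      chernPairing (ampFamily V (f : (n : ℕ) → Cochain k H A n)) m x := by
  rw [← chernPairing_eq_of_le _ (le_max_left (degreeBound f) m)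
      (fun n hn => by rw [ampFamily_apply, degreeBound_spec f n hn, map_zero]),
    ← chernPairing_eq_of_le _ (le_max_right (degreeBound f) m)
      (fun n hn => by rw [ampFamily_apply, hm n hn, map_zero])]

variable [CharZero k]

lemma chernPairing_shear_of_mem {f : (n : ℕ) → Cochain k H A n} (hf : f ∈ D.evenPeriodicCocycles)
    {m : ℕ} (hm : ∀ n, m < n → f (2 * n) = 0) (γ e : D.invariantSubalgebra V) (hγ : γ * γ = 0)
    (he : e * e = e) : chernPairing (ampFamily V f) m ↑(shear γ e (1 : k)) =
      chernPairing (ampFamily V f) m (e : A ⊗[k] Module.End k V.V) := by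
  rw [← chernPairing_invTrace, ← chernPairing_invTrace]
  refine chernPairing_shear _ (fun n i => codegeneracy_invTrace_of_mem V (hf.1.1 (2 * n + 2)) i)
    (fun n => ?_) m ?_ hγ he 1
  · have h : D.hochschild (2 * n) (f (2 * n)) + D.connesB (2 * n + 1) (f (2 * n + 2)) = 0 :=
      congrFun (hf.2 : D.totalDifferential f = 0) (2 * n + 1)
    rw [← invTrace_hochschild, ← invTrace_connesB, ← map_add, h, map_zero]
  · have h : f (2 * m + 2) = 0 := hm (m + 1) (Nat.lt_succ_self m)
    rw [h, map_zero]

lemma chernPairing_evenPeriodicCoboundaries {f : (n : ℕ) → Cochain k H A n}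
    (hf : f ∈ D.evenPeriodicCoboundaries) {m : ℕ} (hm : ∀ n, m < n → f (2 * n) = 0)
    (e : D.invariantSubalgebra V) (he : e * e = e) :
    chernPairing (ampFamily V f) m (e : A ⊗[k] Module.End k V.V) = 0 := by
  obtain ⟨ψ, hψ, rfl⟩ := hf
  obtain ⟨M, hM⟩ := hψ.2.2
  -- The cochain ψ may reach beyond degree 2m although its coboundary does not. The truncation is
  -- raised until the top component of ψ vanishes too.
  rw [← chernPairing_invTrace, ← chernPairing_eq_of_le _ (le_max_left m M)
    (fun n hn => by rw [hm n hn, map_zero])]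
  refine chernPairing_coboundary _ (fun n => D.invTrace V n (ψ n))
    (fun n i => codegeneracy_invTrace_of_mem V (hψ.1 (2 * n + 1)) i) ?_ (fun n => ?_) _ ?_ he
  · exact D.invTrace_connesB V 0 (ψ 1)
  · rw [← invTrace_hochschild, ← invTrace_connesB, ← map_add]
    rfl
  · change D.invTrace V _ (ψ _) = 0
    rw [hM _ (by have := le_max_right m M; omega), map_zero]

/-- The linear map on periodic cocycles defined by an invariant idempotent. -/
def periodicEvalCocycle (e : D.InvIdem) :
    D.evenPeriodicCocycles →ₗ[k] invariantFunctionals k H where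
  toFun f := ⟨chernPairing (ampFamily e.rep (f : (n : ℕ) → Cochain k H A n))
      (degreeBound f) (D.untwist e.rep e.val),
    D.chernPairing_mem_invariantFunctionals e.rep _
      (fun n => equivariantCochains_of_normalizedCochains (f.2.1.1 n)) _ e.untwisted⟩
  map_add' f f' := by
    refine Subtype.ext ?_
    change chernPairing _ _ _ = chernPairing _ _ _ + chernPairing _ _ _
    let m := max (degreeBound f) (degreeBound f')
    have h : ∀ n, m < n → (f : (n : ℕ) → Cochain k H A n) (2 * n) = 0 := fun n hn =>
      degreeBound_spec f n (lt_of_le_of_lt (le_max_left _ _) hn)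
    have h' : ∀ n, m < n → (f' : (n : ℕ) → Cochain k H A n) (2 * n) = 0 := fun n hn =>
      degreeBound_spec f' n (lt_of_le_of_lt (le_max_right _ _) hn)
    rw [chernPairing_eq_degreeBound e.rep f h, chernPairing_eq_degreeBound e.rep f' h',
      chernPairing_eq_degreeBound e.rep (f + f') (m := m) (fun n hn => by
        rw [Submodule.coe_add, Pi.add_apply, h n hn, h' n hn, add_zero])]
    simp only [chernPairing, Submodule.coe_add, map_add, Pi.add_apply, add_apply,
      smul_add, Finset.sum_add_distrib]
    abel
  map_smul' c f := by
    refine Subtype.ext ?_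
    change chernPairing _ _ _ = c • chernPairing _ _ _
    rw [chernPairing_eq_degreeBound e.rep (c • f) (m := degreeBound f) (fun n hn => by
      rw [Submodule.coe_smul, Pi.smul_apply, degreeBound_spec f n hn, smul_zero])]
    simp only [chernPairing, Submodule.coe_smul, map_smul, Pi.smul_apply, smul_apply,
      smul_add, Finset.smul_sum]
    congr 1
    exact Finset.sum_congr rfl fun n _ => smul_comm _ _ _

/-- The linear map on periodic cyclic cohomology defined by an invariant idempotent. -/
def periodicEval (e : D.InvIdem) : D.HP0 →ₗ[k] invariantFunctionals k H :=
  Submodule.liftQ (D.evenPeriodicCoboundaries.submoduleOf D.evenPeriodicCocycles)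
    (D.periodicEvalCocycle e) (by
      intro f hf
      exact LinearMap.mem_ker.2 (Subtype.ext
        (D.chernPairing_evenPeriodicCoboundaries e.rep hf (degreeBound_spec f) e.untwisted
          e.untwisted_mul)))

lemma periodicEval_mk (e : D.InvIdem) (f : D.evenPeriodicCocycles) {m : ℕ}
    (hm : ∀ n, m < n → (f : (n : ℕ) → Cochain k H A n) (2 * n) = 0) :
    (D.periodicEval e (Submodule.Quotient.mk f) : H →ₗ[k] k) =
      chernPairing (ampFamily e.rep (f : (n : ℕ) → Cochain k H A n)) m (D.untwist e.rep e.val) :=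
  chernPairing_eq_degreeBound e.rep f hm _

lemma periodicEval_eq_of_mvN (e e' : D.InvIdem) (h : e.MvN e') :
    D.periodicEval e = D.periodicEval e' := by
  refine D.HP0_hom_ext fun f => ?_
  rw [D.periodicEval_mk e f (degreeBound_spec f), D.periodicEval_mk e' f (degreeBound_spec f)]
  exact h.apply_eq D (fun V x => chernPairing (ampFamily V (f : (n : ℕ) → Cochain k H A n)) _ x)
    (fun V W x y => chernPairing_blockSum V W _ _ _ _) (fun V => chernPairing_zero V _ _)
    (fun V γ hγ e he hγγ hee => D.chernPairing_shear_of_mem V f.2 (degreeBound_spec f) ⟨γ, hγ⟩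
      ⟨e, he⟩ (Subtype.ext hγγ) (Subtype.ext hee))

lemma periodicEval_add (e e' : D.InvIdem) :
    D.periodicEval (e.add e') = D.periodicEval e + D.periodicEval e' := by
  refine D.HP0_hom_ext fun f => ?_
  rw [LinearMap.add_apply, Submodule.coe_add, D.periodicEval_mk _ f (degreeBound_spec f),
    D.periodicEval_mk _ f (degreeBound_spec f), D.periodicEval_mk _ f (degreeBound_spec f)]
  have h : D.untwist (e.add e').rep (e.add e').val =
    blockSum (D.untwist e.rep e.val) (D.untwist e'.rep e'.val) := D.untwist_blockDiag _ _
  rw [h]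
  exact chernPairing_blockSum e.rep e'.rep _ _ _ _

end Periodic

end YetterDrinfeldAlgebra

end
end EquivariantCyclic

theorem mainTheorem5 {k : Type u} [Field k] [CharZero k] {H : Type v} [Ring H] [HopfAlgebra k H]
    [BijectiveAntipode k H] {A : Type w} [Ring A] [Algebra k A] (D : YetterDrinfeldAlgebra k H A) :
    (∀ n : ℕ, ∃! P : D.K0 →+ (D.HC (2 * n) →ₗ[k] invariantFunctionals k H),
      ∀ (e : D.InvIdem) (f : D.cyclicCocycles (2 * n)) (g : H),
        (P (YetterDrinfeldAlgebra.K0.mk D e) (Submodule.Quotient.mk f) : H →ₗ[k] k) g =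
          D.traceMap e.rep (2 * n) f (fun _ => e.val) g) ∧
    (∃! P : D.K0 →+ (D.HP0 →ₗ[k] invariantFunctionals k H),
      ∀ (e : D.InvIdem) (f : D.evenPeriodicCocycles) (m : ℕ),
        (∀ n : ℕ, m < n → (f : (n : ℕ) → Cochain k H A n) (2 * n) = 0) → ∀ g : H,
          (P (YetterDrinfeldAlgebra.K0.mk D e) (Submodule.Quotient.mk f) : H →ₗ[k] k) g =
            D.traceMap e.rep 0 ((f : (n : ℕ) → Cochain k H A n) 0) (fun _ => e.val) g +
              ∑ n ∈ Finset.Icc 1 m, (-1 : k) ^ n * ((2 * n).factorial / n.factorial : k) *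
                D.traceMap e.rep (2 * n) ((f : (n : ℕ) → Cochain k H A n) (2 * n))
                  (Fin.cons (e.val - (1 / 2 : k) • (1 ⊗ₜ[k] 1)) (fun _ => e.val)) g) := by
  refine ⟨fun n => ?_, ?_⟩
  · refine ⟨YetterDrinfeldAlgebra.K0.lift (D.cyclicEval n) (D.cyclicEval_eq_of_mvN n)
      (D.cyclicEval_add n), fun e f g => ?_, fun P hP => ?_⟩
    · rw [YetterDrinfeldAlgebra.K0.lift_mk]
      rfl
    -- Uniqueness: the formula fixes P on all [e] and on the classes of all cocycles.
    · refine YetterDrinfeldAlgebra.K0.hom_ext fun e => D.HC_hom_ext fun f => ?_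
      rw [YetterDrinfeldAlgebra.K0.lift_mk]
      exact LinearMap.ext (hP e f)
  · refine ⟨YetterDrinfeldAlgebra.K0.lift D.periodicEval D.periodicEval_eq_of_mvN
      D.periodicEval_add, fun e f m hm g => ?_, fun P hP => ?_⟩
    · rw [YetterDrinfeldAlgebra.K0.lift_mk, D.periodicEval_mk e f hm]
      exact (D.chernPairing_traceMap e.rep _ m e.val g).symm
    · refine YetterDrinfeldAlgebra.K0.hom_ext fun e => D.HP0_hom_ext fun f => ?_
      rw [YetterDrinfeldAlgebra.K0.lift_mk,
        D.periodicEval_mk e f (YetterDrinfeldAlgebra.degreeBound_spec f)]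
      refine LinearMap.ext fun g => ?_
      rw [hP e f _ (YetterDrinfeldAlgebra.degreeBound_spec f) g]
      exact D.chernPairing_traceMap e.rep _ _ e.val g
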